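/- Let $I\subseteq\mathbb{R}$ be an open interval, let $F,C:I\to(0,\infty)$ be smooth, and let $\eta^1,\eta^2,\eta^3$ be the left-invariant coframe of $\mathbb{S}^3=SU(2)$ with $d\eta^1=-2\eta^2\wedge\eta^3$ (and cyclically), with dual frame $e_1,e_2,e_3$. On $I\times\mathbb{S}^3$, with coordinate $z$ on $I$, consider the $U(2)$-invariant metric $$g=C\left(\frac{1}{4F}dz^2+F(\eta^1)^2+(\eta^2)^2+(\eta^3)^2\right)$$ and the complex structure $$J^+=-2F\,\frac{\partial}{\partial z}\otimes\eta^1+\frac{1}{2F}\,e_1\otimes dz-e_2\otimes\eta^3+e_3\otimes\eta^2 .$$ Let $s$ be the scalar curvature of $g$, let $W^+$ and $W^-$ be the self-dual and anti-self-dual parts of its Weyl tensor for the orientation $dz\wedge\eta^1\wedge\eta^2\wedge\eta^3$ (the orientation of $J^+$), and let $\delta W^\pm$ be their divergences. Put $$\mathcal{L}^{+}=\left(-\tfrac12\tfrac{d}{dz}+1\right)\left(-\tfrac{d}{dz}+1\right),\qquad \mathcal{L}^-=\left(\tfrac12\tfrac{d}{dz}+1\right)\left(\tfrac{d}{dz}+1\right).$$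 1. For every $s_0\in\mathbb{R}$, $s=s_0$ on $I\times\mathbb{S}^3$ if and only if, on $I$, $$0=s_0C^{3/2}+4C^{1/2}\left(F_{zz}+\tfrac12F-2\right)+24\left(F\,(C^{1/2})_z\right)_z .$$ 2. $\delta W^+=0$ if and only if $e^{\frac32z}(\mathcal{L}^+F-1)\sqrt{C}$ is constant on $I$, and $\delta W^-=0$ if and only if $e^{-\frac32z}(\mathcal{L}^-F-1)\sqrt{C}$ is constant on $I$. 3. The metric $g$ is Kähler with respect to $J^+$ if and only if $C=C_0e^{-z}$ for some constant $C_0>0$. Suppose that this is the case. Then: (a) $\delta W^+=0$ if and only if $F=1+C_2e^{-z}+C_3e^{z}+\frac12C_4e^{2z}$ for some constants $C_2,C_3,C_4$, in which case the scalar curvature is the constant $s=-24C_2/C_0$. (b) $\delta W^-=0$ if and only if $F=1+\frac12C_1e^{-2z}+C_2e^{-z}+\frac12C_4e^{2z}$ for some constants $C_1,C_2,C_4$, in which case $g$ is an extremal Kähler metric with respect to $J^+$ (that is, the gradient of $s$ is a holomorphic vector field) and $s=-\frac{24}{C_0}\left(C_1e^{-z}+C_2\right)$. -/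

import Mathlib

open scoped ContDiff

noncomputable section

namespace U2Inv

/-! ## Riemannian geometry of a metric in one chart of dimension four

A metric is a field `g` of symmetric matrices `g x i j = g(∂ᵢ, ∂ⱼ)` on an open set of `ℝ⁴`. -/

/-- Points of the coordinate space `ℝ⁴`. -/
abbrev E4 := Fin 4 → ℝ

/-- The partial derivative `∂ᵢ f` at `x`. -/
def pd (i : Fin 4) (f : E4 → ℝ) (x : E4) : ℝ := fderiv ℝ f x (Pi.single i 1)

/-- Fields of `4 × 4` matrices: covariant two-tensors (`g x i j`), and endomorphisms of the tangent
bundle, for which `J x k i` is the `k`-th component of `J ∂ᵢ`. -/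
abbrev MatField := E4 → Matrix (Fin 4) (Fin 4) ℝ

/-- The components of a covariant four-tensor field. -/
abbrev Tensor4 := Fin 4 → Fin 4 → Fin 4 → Fin 4 → E4 → ℝ

/-- The Christoffel symbol `Γᵏᵢⱼ` of the Levi-Civita connection. -/
def christoffel (g : MatField) (k i j : Fin 4) (x : E4) : ℝ :=
  1 / 2 * ∑ l, (g x)⁻¹ k l *
    (pd i (fun y => g y j l) x + pd j (fun y => g y i l) x - pd l (fun y => g y i j) x)

/-- The component along `∂ₗ` of `R(∂ᵢ, ∂ⱼ)∂ₖ`, where `R(X, Y) = [∇_X, ∇_Y] - ∇_[X, Y]`. -/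
def riemUp (g : MatField) (i j k l : Fin 4) (x : E4) : ℝ :=
  pd i (christoffel g l j k) x - pd j (christoffel g l i k) x
    + ∑ m, (christoffel g l i m x * christoffel g m j k x
      - christoffel g l j m x * christoffel g m i k x)

/-- The curvature tensor `Rᵢⱼₖₗ = g(R(∂ᵢ, ∂ⱼ)∂ₖ, ∂ₗ)`. -/
def riem (g : MatField) : Tensor4 := fun i j k l x => ∑ m, riemUp g i j k m x * g x m l

/-- The Ricci tensor, the trace of `X ↦ R(X, ∂ⱼ)∂ₖ`. -/
def ric (g : MatField) (j k : Fin 4) (x : E4) : ℝ := ∑ i, riemUp g i j k i x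

/-- The scalar curvature. -/
def scal (g : MatField) (x : E4) : ℝ := ∑ j, ∑ k, (g x)⁻¹ j k * ric g j k x

/-- The Weyl tensor in dimension four, all indices lowered. -/
def weyl (g : MatField) : Tensor4 := fun i j k l x =>
  riem g i j k l x
    - 1 / 2 * (g x i l * ric g j k x + g x j k * ric g i l x
        - g x i k * ric g j l x - g x j l * ric g i k x)
    + scal g x / 6 * (g x i l * g x j k - g x i k * g x j l)

/-- The permutation symbol on four indices, with value `1` at `(0, 1, 2, 3)`. -/
def levi (i j k l : Fin 4) : ℝ :=
  Matrix.det (Matrix.of fun a b : Fin 4 => if (![i, j, k, l] : Fin 4 → Fin 4) a = b then (1 : ℝ) else 0)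

/-- The Riemannian volume form, for the standard orientation of `ℝ⁴`. -/
def volForm (g : MatField) : Tensor4 := fun i j k l x => √((g x).det) * levi i j k l

/-- The Hodge star operator on two-forms, applied to the first two indices of a four-tensor. -/
def star12 (g : MatField) (T : Tensor4) : Tensor4 := fun i j k l x =>
  1 / 2 * ∑ m, ∑ n, ∑ p, ∑ q,
    volForm g i j m n x * (g x)⁻¹ m p * (g x)⁻¹ n q * T p q k l x

/-- The self-dual part `W⁺` of the Weyl tensor. -/
def weylPlus (g : MatField) : Tensor4 := fun i j k l x =>
  1 / 2 * (weyl g i j k l x + star12 g (weyl g) i j k l x)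

/-- The anti-self-dual part `W⁻` of the Weyl tensor. -/
def weylMinus (g : MatField) : Tensor4 := fun i j k l x =>
  1 / 2 * (weyl g i j k l x - star12 g (weyl g) i j k l x)

/-- The covariant derivative `∇ₘ Tᵢⱼₖₗ`. -/
def covDeriv (g : MatField) (T : Tensor4) (m i j k l : Fin 4) (x : E4) : ℝ :=
  pd m (T i j k l) x - ∑ p,
    (christoffel g p m i x * T p j k l x + christoffel g p m j x * T i p k l x
      + christoffel g p m k x * T i j p l x + christoffel g p m l x * T i j k p x)

/-- The divergence `(δT)ⱼₖₗ = ∇ⁱ Tᵢⱼₖₗ`. -/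
def divergence (g : MatField) (T : Tensor4) (j k l : Fin 4) (x : E4) : ℝ :=
  ∑ m, ∑ i, (g x)⁻¹ m i * covDeriv g T m i j k l x

/-- The two-form `ω = g(J ·, ·)`. -/
def kahlerForm (g J : MatField) (i j : Fin 4) (x : E4) : ℝ := ∑ k, J x k i * g x k j

/-- The Nijenhuis tensor: the `k`-th component of `[J∂ᵢ, J∂ⱼ] - J[J∂ᵢ, ∂ⱼ] - J[∂ᵢ, J∂ⱼ]`. -/
def nijenhuis (J : MatField) (i j k : Fin 4) (x : E4) : ℝ :=
  ∑ l, (J x l i * pd l (fun y => J y k j) x - J x l j * pd l (fun y => J y k i) x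
    - J x k l * (pd i (fun y => J y l j) x - pd j (fun y => J y l i) x))

/-- `(U, g, J)` is a Kähler manifold: `J` is an almost complex structure which is integrable
(by the vanishing of its Nijenhuis tensor) and `g`-compatible, and `ω = g(J ·, ·)` is closed. -/
structure IsKahler (U : Set E4) (g J : MatField) : Prop where
  sq_eq : ∀ x ∈ U, J x * J x = -1
  compatible : ∀ x ∈ U, (J x).transpose * g x * J x = g x
  integrable : ∀ x ∈ U, ∀ i j k, nijenhuis J i j k x = 0
  closed : ∀ x ∈ U, ∀ i j k, pd i (kahlerForm g J j k) x + pd j (kahlerForm g J k i) x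
    + pd k (kahlerForm g J i j) x = 0

/-- The `k`-th component of the gradient of a function. -/
def grad (g : MatField) (f : E4 → ℝ) (k : Fin 4) (x : E4) : ℝ := ∑ l, (g x)⁻¹ k l * pd l f x

/-- The Lie derivative of the endomorphism field `J` along the vector field `X`:
the `k`-th component of `(L_X J) ∂ᵢ`. -/
def lieDerivEnd (X : Fin 4 → E4 → ℝ) (J : MatField) (k i : Fin 4) (x : E4) : ℝ :=
  ∑ l, (X l x * pd l (fun y => J y k i) x - J x l i * pd l (X k) x + J x k l * pd i (X l) x)

/-- An extremal Kähler metric: the gradient of the scalar curvature is a holomorphic vector field,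
that is, its flow preserves the complex structure. -/
def IsExtremal (U : Set E4) (g J : MatField) : Prop :=
  IsKahler U g J ∧ ∀ x ∈ U, ∀ k i, lieDerivEnd (grad g (scal g)) J k i x = 0

/-! ## The manifold `I × S³` and its `U(2)`-invariant metrics

`S³` is the group of unit quaternions and `ℝ⁴` is the space `x = x₀ + x₁ i + x₂ j + x₃ k` of
quaternions. The diffeomorphism `(z, q) ↦ e^{z/2} q` is a global chart of `I × S³`, with image
`{x ≠ 0 | log |x|² ∈ I}`. The pulled back Maurer-Cartan form is
`x⁻¹ dx = dz/2 + i η¹ + j η² + k η³`, so that `dηⁱ = -εⁱⱼₖ ηʲ ∧ ηᵏ`, and the standard orientation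
of `ℝ⁴` is that of `dz ∧ η¹ ∧ η² ∧ η³`. -/

/-- `|x|² = e^z`. -/
def nsq (x : E4) : ℝ := ∑ i, x i ^ 2

/-- The coordinate `z`. -/
def zc (x : E4) : ℝ := Real.log (nsq x)

/-- The manifold `I × S³` in its global chart. -/
def dom (I : Set ℝ) : Set E4 := {x | x ≠ 0 ∧ zc x ∈ I}

/-- The coordinate vector field `∂/∂z`. -/
def ez (x : E4) : E4 := (1 / 2 : ℝ) • x

/-- The left-invariant vector field `x ↦ x i` on the quaternions. -/
def e1 (x : E4) : E4 := ![-x 1, x 0, x 3, -x 2]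

/-- The left-invariant vector field `x ↦ x j` on the quaternions. -/
def e2 (x : E4) : E4 := ![-x 2, -x 3, x 0, x 1]

/-- The left-invariant vector field `x ↦ x k` on the quaternions. -/
def e3 (x : E4) : E4 := ![-x 3, x 2, -x 1, x 0]

/-- The covector field `dz`. -/
def dz (x : E4) : E4 := (2 / nsq x) • x

/-- The left-invariant covector field `η¹`. -/
def eta1 (x : E4) : E4 := (1 / nsq x) • e1 x

/-- The left-invariant covector field `η²`. -/
def eta2 (x : E4) : E4 := (1 / nsq x) • e2 x

/-- The left-invariant covector field `η³`. -/
def eta3 (x : E4) : E4 := (1 / nsq x) • e3 x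

/-- The metric `C (dz² / (4F) + F (η¹)² + (η²)² + (η³)²)`, with `F` and `C` functions of `z`. -/
def metric (F C : ℝ → ℝ) : MatField := fun x => Matrix.of fun i j =>
  C (zc x) * (1 / (4 * F (zc x)) * (dz x i * dz x j) + F (zc x) * (eta1 x i * eta1 x j)
    + eta2 x i * eta2 x j + eta3 x i * eta3 x j)

/-- The complex structure `J⁺ = -2F ∂_z ⊗ η¹ + (2F)⁻¹ e₁ ⊗ dz - e₂ ⊗ η³ + e₃ ⊗ η²`. -/
def Jplus (F : ℝ → ℝ) : MatField := fun x => Matrix.of fun k i =>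
  -2 * F (zc x) * (ez x k * eta1 x i) + 1 / (2 * F (zc x)) * (e1 x k * dz x i)
    - e2 x k * eta3 x i + e3 x k * eta2 x i

/-- `𝓛⁺ = (-½ d/dz + 1)(-d/dz + 1)`. -/
def Lplus (F : ℝ → ℝ) : ℝ → ℝ :=
  let G : ℝ → ℝ := fun t => -deriv F t + F t
  fun z => -(1 / 2) * deriv G z + G z

/-- `𝓛⁻ = (½ d/dz + 1)(d/dz + 1)`. -/
def Lminus (F : ℝ → ℝ) : ℝ → ℝ :=
  let G : ℝ → ℝ := fun t => deriv F t + F t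
  fun z => 1 / 2 * deriv G z + G z

end U2Inv

end

open U2Inv

noncomputable section

namespace U2Inv

section

/-! ## Partial derivatives -/

/-! Everything is computed in the left-invariant frame ∂_z, e₁, e₂, e₃. Its matrix E is linear in
the quaternion x, its inverse is the coframe Θ, and the brackets of its columns are constant
combinations of the frame. All tensors involved have components depending on z alone, and the metric
becomes diag(C/(4F), CF, C, C).

The Levi-Civita coefficients A are written down as a table and recognised by vanishing torsion and
metric compatibility (`leviCivita`, `christoffel_frameMetric`). The coordinate Christoffel matrices
are the gauge transform (EA - dE)Θ of A, so curvature is merely conjugated (`riemUp_frameMetric`).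
The Weyl tensor, the Hodge star and the divergence are likewise pullbacks by Θ of expressions in z.
As Θ is invertible, a pullback vanishes exactly when its frame components do
(`divergence_eq_zero_iff`).

Symmetry leaves one scalar in each half of the Weyl tensor. With m = 𝓛^±F - 1, the half W^± is Cm
times a fixed algebraic tensor (`frameWeyl_eq`, `frameStar_weyl`); by conformal invariance C enters
only as a factor. The divergence is a nowhere zero tensor times m' ± (3/2)m + (C'/2C)m
(`frameDiv_halfWeyl`). This scalar is, up to a positive factor, the derivative of e^{±3z/2} m √C,
which gives part 2 on an interval. Part 1 is the formula for s multiplied by C^{3/2}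
(`scalFun_eq_iff`).

For every F and C, J⁺ is integrable and compatible with g. The Kähler form is ω = C(½ dz∧η¹ +
η²∧η³), so dω = (C' + C) dz∧η²∧η³ and the Kähler condition is C' = -C (`isKahler_iff`). Then C'/C =
-1, and the divergence conditions read 𝓛⁺F - 1 = κe^{-z} and 𝓛⁻F - 1 = κe^{2z}. Since 𝓛⁺ =
½(D-1)(D-2) and 𝓛⁻ = ½(D+1)(D+2), where D = d/dz, these equations integrate explicitly. Moreover s =
-8(𝓛⁺F - 1)/C in the Kähler case, which yields both formulas for s. In case (b) the gradient of s is
a constant multiple of F ∂_z, a holomorphic field (`lieDerivEnd_Jplus`). -/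

lemma pd_congr {i : Fin 4} {f g : E4 → ℝ} {x : E4} (h : f =ᶠ[nhds x] g) : pd i f x = pd i g x := by
  unfold pd; rw [h.fderiv_eq]

lemma pd_const (i : Fin 4) (c : ℝ) (x : E4) : pd i (fun _ => c) x = 0 := by
  simp [pd]

lemma pd_sub {i : Fin 4} {f g : E4 → ℝ} {x : E4} (hf : DifferentiableAt ℝ f x)
    (hg : DifferentiableAt ℝ g x) : pd i (fun y => f y - g y) x = pd i f x - pd i g x := by
  unfold pd; rw [fderiv_fun_sub hf hg]; rfl

lemma pd_mul {i : Fin 4} {f g : E4 → ℝ} {x : E4} (hf : DifferentiableAt ℝ f x)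
    (hg : DifferentiableAt ℝ g x) :
    pd i (fun y => f y * g y) x = pd i f x * g x + f x * pd i g x := by
  unfold pd; rw [fderiv_fun_mul hf hg]; simp; ring

lemma pd_sum {ι : Type*} {s : Finset ι} {i : Fin 4} {f : ι → E4 → ℝ} {x : E4}
    (hf : ∀ a ∈ s, DifferentiableAt ℝ (f a) x) :
    pd i (fun y => ∑ a ∈ s, f a y) x = ∑ a ∈ s, pd i (f a) x := by
  unfold pd; rw [fderiv_fun_sum hf]; simp

/-- The entrywise partial derivative of a field of matrices. -/
def pdM (i : Fin 4) (M : MatField) (x : E4) : Matrix (Fin 4) (Fin 4) ℝ :=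
  Matrix.of fun a b => pd i (fun y => M y a b) x

/-- Entrywise differentiability of a field of matrices. -/
def DiffM (M : MatField) (x : E4) : Prop := ∀ a b, DifferentiableAt ℝ (fun y => M y a b) x

lemma DiffM.mul {M N : MatField} {x : E4} (hM : DiffM M x) (hN : DiffM N x) :
    DiffM (fun y => M y * N y) x := by
  intro a b
  simp only [Matrix.mul_apply]
  exact DifferentiableAt.fun_sum fun c _ => (hM a c).mul (hN c b)

lemma DiffM.sub {M N : MatField} {x : E4} (hM : DiffM M x) (hN : DiffM N x) :
    DiffM (fun y => M y - N y) x := fun a b => (hM a b).sub (hN a b)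

lemma DiffM.transpose {M : MatField} {x : E4} (hM : DiffM M x) :
    DiffM (fun y => (M y).transpose) x := fun a b => hM b a

lemma DiffM.const (M : Matrix (Fin 4) (Fin 4) ℝ) (x : E4) : DiffM (fun _ => M) x :=
  fun _ _ => differentiableAt_const _

lemma pdM_mul {i : Fin 4} {M N : MatField} {x : E4} (hM : DiffM M x) (hN : DiffM N x) :
    pdM i (fun y => M y * N y) x = pdM i M x * N x + M x * pdM i N x := by
  ext a b
  simp only [pdM, Matrix.of_apply, Matrix.mul_apply, Matrix.add_apply]
  rw [pd_sum (f := fun c y => M y a c * N y c b) fun c _ => (hM a c).mul (hN c b), ← Finset.sum_add_distrib]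
  exact Finset.sum_congr rfl fun c _ => pd_mul (hM a c) (hN c b)

lemma pdM_sub {i : Fin 4} {M N : MatField} {x : E4} (hM : DiffM M x) (hN : DiffM N x) :
    pdM i (fun y => M y - N y) x = pdM i M x - pdM i N x := by
  ext a b
  exact pd_sub (hM a b) (hN a b)

lemma pdM_const {i : Fin 4} (M : Matrix (Fin 4) (Fin 4) ℝ) (x : E4) :
    pdM i (fun _ => M) x = 0 := by
  ext a b
  exact pd_const _ _ _

lemma pdM_transpose {i : Fin 4} (M : MatField) (x : E4) :
    pdM i (fun y => (M y).transpose) x = (pdM i M x).transpose := rfl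

lemma pdM_congr {i : Fin 4} {M N : MatField} {x : E4} (h : M =ᶠ[nhds x] N) :
    pdM i M x = pdM i N x := by
  ext a b
  exact pd_congr (h.mono fun y hy => by simp only [hy])

/-! ## The left-invariant frame -/

/-- The frame `∂_z, e₁, e₂, e₃`, as the columns of a matrix. -/
def frame (x : E4) : Matrix (Fin 4) (Fin 4) ℝ :=
  Matrix.of fun k a => (![ez x, e1 x, e2 x, e3 x] : Fin 4 → E4) a k

/-- The coframe `dz, η¹, η², η³`, as the rows of a matrix. -/
def coframe (x : E4) : Matrix (Fin 4) (Fin 4) ℝ :=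
  Matrix.of fun a i => (![dz x, eta1 x, eta2 x, eta3 x] : Fin 4 → E4) a i

/-- The structure constants of the frame: `[e_a, e_b] = ∑ structConst c a b • e_c`. -/
def structConst (c a b : Fin 4) : ℝ :=
  (![0, ![![0, 0, 0, 0], ![0, 0, 0, 0], ![0, 0, 0, 2], ![0, 0, -2, 0]],
    ![![0, 0, 0, 0], ![0, 0, 0, -2], ![0, 0, 0, 0], ![0, 2, 0, 0]],
    ![![0, 0, 0, 0], ![0, 0, 2, 0], ![0, -2, 0, 0], ![0, 0, 0, 0]]] :
      Fin 4 → Fin 4 → Fin 4 → ℝ) c a b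

lemma nsq_pos {x : E4} (hx : x ≠ 0) : 0 < nsq x := by
  obtain ⟨i, hi⟩ := Function.ne_iff.1 hx
  exact Finset.sum_pos' (fun j _ => sq_nonneg _) ⟨i, Finset.mem_univ _, by
    simpa using pow_pos (abs_pos.2 hi) 2⟩

lemma coframe_mul_frame {x : E4} (hx : x ≠ 0) : coframe x * frame x = 1 := by
  have h := (nsq_pos hx).ne'
  ext a b
  rw [Matrix.mul_apply, Fin.sum_univ_four]
  fin_cases a <;> fin_cases b <;>
    simp [frame, coframe, dz, eta1, eta2, eta3, ez, e1, e2, e3] <;>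
    field_simp <;> simp only [nsq, Fin.sum_univ_four] <;> ring

lemma frame_mul_coframe {x : E4} (hx : x ≠ 0) : frame x * coframe x = 1 :=
  mul_eq_one_comm.1 (coframe_mul_frame hx)

lemma frame_add (x y : E4) : frame (x + y) = frame x + frame y := by
  ext k a
  fin_cases a <;> fin_cases k <;> simp [frame, ez, e1, e2, e3] <;> ring

lemma frame_smul (c : ℝ) (x : E4) : frame (c • x) = c • frame x := by
  ext k a
  fin_cases a <;> fin_cases k <;> simp [frame, ez, e1, e2, e3] <;> ring

/-- The frame as a linear map. -/
def frameL : E4 →ₗ[ℝ] Matrix (Fin 4) (Fin 4) ℝ where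
  toFun := frame
  map_add' := frame_add
  map_smul' := frame_smul

/-- The constant partial derivatives of the frame. -/
def dframe (i : Fin 4) : Matrix (Fin 4) (Fin 4) ℝ := frame (Pi.single i 1)

lemma hasFDerivAt_frame (k a : Fin 4) (x : E4) :
    HasFDerivAt (fun y => frame y k a)
      (LinearMap.toContinuousLinearMap
        ((Matrix.entryLinearMap ℝ ℝ k a).comp frameL)) x :=
  (LinearMap.toContinuousLinearMap ((Matrix.entryLinearMap ℝ ℝ k a).comp frameL)).hasFDerivAt

lemma diffM_frame (x : E4) : DiffM frame x := fun k a =>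
  (hasFDerivAt_frame k a x).differentiableAt

lemma pdM_frame (i : Fin 4) (x : E4) : pdM i frame x = dframe i := by
  ext k a
  simp only [pdM, Matrix.of_apply, pd, (hasFDerivAt_frame k a x).fderiv]
  rfl

/-- Linearity of the frame in x makes its derivative along v equal to its value at v. -/
lemma sum_smul_dframe (v : E4) : ∑ i, v i • dframe i = frame v := by
  have h := (pi_eq_sum_univ' v)
  conv_rhs => rw [h]
  change _ = frameL _
  rw [map_sum]
  refine Finset.sum_congr rfl fun i _ => ?_
  rw [map_smul]
  change _ = _ • frame _
  rw [dframe]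

lemma differentiableAt_nsq (x : E4) : DifferentiableAt ℝ nsq x := by
  unfold nsq
  fun_prop

lemma diffM_coframe {x : E4} (hx : x ≠ 0) : DiffM coframe x := by
  have h := (nsq_pos hx).ne'
  have hn := differentiableAt_nsq x
  intro a i
  fin_cases a <;> fin_cases i <;>
    simp [coframe, dz, eta1, eta2, eta3, e1, e2, e3] <;>
    fun_prop (disch := assumption)

lemma eventually_ne_zero {x : E4} (hx : x ≠ 0) : ∀ᶠ y in nhds x, y ≠ 0 :=
  isOpen_ne.mem_nhds hx

/-- Differentiating ΘE = 1 avoids any differentiation of 1/|x|². -/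
lemma pdM_coframe {x : E4} (hx : x ≠ 0) (i : Fin 4) :
    pdM i coframe x = -(coframe x * dframe i * coframe x) := by
  have h1 : pdM i (fun y => coframe y * frame y) x = 0 := by
    rw [← pdM_const (i := i) 1 x]
    exact pdM_congr ((eventually_ne_zero hx).mono fun y hy => coframe_mul_frame hy)
  rw [pdM_mul (diffM_coframe hx) (diffM_frame x), pdM_frame] at h1
  have h2 := congrArg (· * coframe x) h1
  simp only [add_mul, zero_mul, mul_assoc, frame_mul_coframe hx, mul_one] at h2
  rw [mul_assoc]
  exact eq_neg_of_add_eq_zero_left h2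

lemma differentiableAt_zc {x : E4} (hx : x ≠ 0) : DifferentiableAt ℝ zc x :=
  (differentiableAt_nsq x).log (nsq_pos hx).ne'

lemma pd_nsq (i : Fin 4) (x : E4) : pd i nsq x = 2 * x i := by
  have h : HasFDerivAt nsq (∑ j, (2 * x j) • (ContinuousLinearMap.proj j : E4 →L[ℝ] ℝ)) x := by
    unfold nsq
    refine HasFDerivAt.fun_sum fun j _ => ?_
    have := (hasFDerivAt_apply (𝕜 := ℝ) j x).pow 2
    exact this.congr_fderiv (by norm_num)
  rw [pd, h.fderiv]
  simp [Pi.single_apply]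

lemma pd_zc {x : E4} (hx : x ≠ 0) (i : Fin 4) : pd i zc x = coframe x 0 i := by
  have h : HasFDerivAt zc ((nsq x)⁻¹ • fderiv ℝ nsq x) x :=
    (differentiableAt_nsq x).hasFDerivAt.log (nsq_pos hx).ne'
  have h2 := pd_nsq i x
  simp only [pd] at h2
  rw [pd, h.fderiv]
  simp [h2, coframe, dz]
  ring

lemma pd_comp_zc {x : E4} (hx : x ≠ 0) (i : Fin 4) {f : ℝ → ℝ} {f' : ℝ}
    (hf : HasDerivAt f f' (zc x)) : pd i (fun y => f (zc y)) x = f' * coframe x 0 i := by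
  have h := hf.comp_hasFDerivAt x (differentiableAt_zc hx).hasFDerivAt
  rw [← pd_zc hx i, pd, show (fun y => f (zc y)) = f ∘ zc from rfl, h.fderiv]
  rfl

lemma differentiableAt_comp_zc {x : E4} (hx : x ≠ 0) {f : ℝ → ℝ}
    (hf : DifferentiableAt ℝ f (zc x)) : DifferentiableAt ℝ (fun y => f (zc y)) x :=
  hf.comp x (differentiableAt_zc hx)

/-- The commutators of the frame. -/
lemma frame_bracket (x : E4) (a b k : Fin 4) :
    frame (fun i => frame x i a) k b - frame (fun i => frame x i b) k a
      = ∑ c, frame x k c * structConst c a b := by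
  rw [Fin.sum_univ_four]
  fin_cases a <;> fin_cases b <;> fin_cases k <;>
    simp [frame, ez, e1, e2, e3, structConst] <;> ring

lemma isOpen_dom {I : Set ℝ} (hI : IsOpen I) : IsOpen (dom I) := by
  rw [isOpen_iff_mem_nhds]
  rintro x ⟨hx, hz⟩
  filter_upwards [eventually_ne_zero hx,
    (differentiableAt_zc hx).continuousAt.preimage_mem_nhds (hI.mem_nhds hz)] with y h1 h2
  exact ⟨h1, h2⟩

/-- The real quaternion e^{z/2} lies over z. This turns statements at all points of the manifold
into statements on all of I. -/
lemma exists_mem_dom {I : Set ℝ} {z : ℝ} (hz : z ∈ I) : ∃ x ∈ dom I, zc x = z := by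
  have h : nsq (Pi.single 0 (Real.exp (z / 2))) = Real.exp z := by
    simp [nsq, Fin.sum_univ_four, ← Real.exp_nat_mul]
    ring_nf
  have h2 : zc (Pi.single 0 (Real.exp (z / 2))) = z := by rw [zc, h, Real.log_exp]
  refine ⟨_, ⟨?_, by rwa [h2]⟩, h2⟩
  intro h0
  simpa using congrFun h0 0

end

section

/-! ## Connections in the left-invariant frame -/

/-- EΘ = 1 expands the coordinate vector ∂ᵢ in the frame, and the frame matrix depends linearly on
its argument. -/
lemma dframe_eq_sum {x : E4} (hx : x ≠ 0) (i k b : Fin 4) :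
    dframe i k b = ∑ a, coframe x a i * frame (fun l => frame x l a) k b := by
  have h : (Pi.single i 1 : E4) = ∑ a, coframe x a i • (fun l => frame x l a : E4) := by
    ext l
    have := congrFun (congrFun (frame_mul_coframe hx) l) i
    rw [Matrix.mul_apply, Matrix.one_apply] at this
    simp only [Finset.sum_apply, Pi.smul_apply, smul_eq_mul, Pi.single_apply]
    rw [← this]
    exact Finset.sum_congr rfl fun a _ => mul_comm _ _
  rw [dframe, h]
  change frameL _ k b = _
  rw [map_sum, Matrix.sum_apply]
  refine Finset.sum_congr rfl fun a _ => ?_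
  rw [map_smul]
  rfl

/-- Expanding both coordinate directions in the frame turns the antisymmetrised derivative of E into
brackets of frame fields, hence into structure constants. -/
lemma dframe_torsion {x : E4} (hx : x ≠ 0) (i j k : Fin 4) :
    (dframe i * coframe x) k j - (dframe j * coframe x) k i
      = ∑ c, ∑ a, ∑ b, frame x k c * structConst c a b * coframe x a i * coframe x b j := by
  have h1 : ∀ i j, (dframe i * coframe x) k j
      = ∑ a, ∑ b, coframe x a i * coframe x b j * frame (fun l => frame x l a) k b := by
    intro i j
    rw [Matrix.mul_apply, Finset.sum_comm]
    refine Finset.sum_congr rfl fun b _ => ?_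
    rw [dframe_eq_sum hx, Finset.sum_mul]
    exact Finset.sum_congr rfl fun a _ => by ring
  rw [h1 i j, h1 j i, Finset.sum_comm (f := fun a b => coframe x a j * _ * _),
    ← Finset.sum_sub_distrib, Finset.sum_comm]
  refine Finset.sum_congr rfl fun a _ => ?_
  rw [← Finset.sum_sub_distrib, Finset.sum_comm]
  refine Finset.sum_congr rfl fun b _ => ?_
  have h2 := frame_bracket x a b k
  calc _ = coframe x a i * coframe x b j * (frame (fun l => frame x l a) k b
      - frame (fun l => frame x l b) k a) := by ring
    _ = _ := by
      rw [h2, Finset.mul_sum]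
      exact Finset.sum_congr rfl fun c _ => by ring

/-- Connection coefficients in the left-invariant frame: `∇_{e_a} e_b = ∑ A a c b • e_c`. -/
abbrev Coeff := Fin 4 → Matrix (Fin 4) (Fin 4) ℝ

/-- The connection matrix in the direction of the `i`-th coordinate. -/
def connA (A : ℝ → Coeff) (i : Fin 4) (x : E4) : Matrix (Fin 4) (Fin 4) ℝ :=
  ∑ a, coframe x a i • A (zc x) a

/-- The coordinate Christoffel symbols, as matrices, of the connection with coefficients `A`. -/
def conn (A : ℝ → Coeff) (i : Fin 4) (x : E4) : Matrix (Fin 4) (Fin 4) ℝ :=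
  (frame x * connA A i x - dframe i) * coframe x

/-- The torsion vanishes. -/
def TorsionFree (A : Coeff) : Prop := ∀ a b c, A a c b - A b c a = structConst c a b

lemma frame_connA_coframe (A : ℝ → Coeff) (i j k : Fin 4) (x : E4) :
    (frame x * connA A i x * coframe x) k j
      = ∑ c, ∑ a, ∑ b, frame x k c * A (zc x) a c b * coframe x a i * coframe x b j := by
  rw [mul_assoc, Matrix.mul_apply]
  refine Finset.sum_congr rfl fun c _ => ?_
  rw [connA, Finset.sum_mul, Matrix.sum_apply, Finset.mul_sum]
  refine Finset.sum_congr rfl fun a _ => ?_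
  rw [Matrix.smul_mul, Matrix.smul_apply, Matrix.mul_apply, smul_eq_mul, Finset.mul_sum,
    Finset.mul_sum]
  exact Finset.sum_congr rfl fun b _ => by ring

/-- In Γ = (EA - dE)Θ the antisymmetric part of dE contributes the structure constants, and these
are exactly the antisymmetric part of a torsion-free A. -/
lemma conn_symm {A : ℝ → Coeff} {x : E4} (hx : x ≠ 0) (hA : TorsionFree (A (zc x)))
    (i j k : Fin 4) : conn A i x k j = conn A j x k i := by
  have h := dframe_torsion hx i j k
  rw [conn, conn, sub_mul, sub_mul, Matrix.sub_apply, Matrix.sub_apply, frame_connA_coframe,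
    frame_connA_coframe]
  rw [sub_eq_sub_iff_sub_eq_sub, h, ← Finset.sum_sub_distrib]
  refine Finset.sum_congr rfl fun c _ => ?_
  rw [Finset.sum_comm (f := fun a b => _ * A (zc x) a c b * coframe x a j * _),
    ← Finset.sum_sub_distrib]
  refine Finset.sum_congr rfl fun a _ => ?_
  rw [← Finset.sum_sub_distrib]
  refine Finset.sum_congr rfl fun b _ => ?_
  rw [← hA a b c]
  ring

/-- The coframe is covariantly constant up to the connection coefficients. -/
lemma pdM_coframe_eq {x : E4} (hx : x ≠ 0) (A : ℝ → Coeff) (i : Fin 4) :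
    pdM i coframe x = coframe x * conn A i x - connA A i x * coframe x := by
  rw [pdM_coframe hx, conn, sub_mul, mul_sub]
  rw [show coframe x * (frame x * connA A i x * coframe x)
    = coframe x * frame x * connA A i x * coframe x by noncomm_ring, coframe_mul_frame hx]
  noncomm_ring

lemma pdM_frame_eq {x : E4} (hx : x ≠ 0) (A : ℝ → Coeff) (i : Fin 4) :
    pdM i frame x = frame x * connA A i x - conn A i x * frame x := by
  rw [pdM_frame, conn, mul_assoc, coframe_mul_frame hx]
  noncomm_ring

/-- Entrywise derivatives of a matrix-valued function. -/
def HasDerivM (w : ℝ → Matrix (Fin 4) (Fin 4) ℝ) (w' : Matrix (Fin 4) (Fin 4) ℝ) (z : ℝ) : Prop :=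
  ∀ a b, HasDerivAt (fun t => w t a b) (w' a b) z

lemma HasDerivM.diffM {w : ℝ → Matrix (Fin 4) (Fin 4) ℝ} {w' : Matrix (Fin 4) (Fin 4) ℝ} {x : E4}
    (hx : x ≠ 0) (hw : HasDerivM w w' (zc x)) : DiffM (fun y => w (zc y)) x := fun a b =>
  differentiableAt_comp_zc hx (hw a b).differentiableAt

lemma HasDerivM.pdM {w : ℝ → Matrix (Fin 4) (Fin 4) ℝ} {w' : Matrix (Fin 4) (Fin 4) ℝ} {x : E4}
    (hx : x ≠ 0) (hw : HasDerivM w w' (zc x)) (i : Fin 4) :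
    pdM i (fun y => w (zc y)) x = coframe x 0 i • w' := by
  ext a b
  rw [U2Inv.pdM, Matrix.of_apply, pd_comp_zc hx i (hw a b)]
  simp [mul_comm]

/-- The covariant two-tensor with frame components `w`. -/
def lift2 (w : ℝ → Matrix (Fin 4) (Fin 4) ℝ) : MatField := fun x =>
  (coframe x).transpose * w (zc x) * coframe x

/-- The endomorphism field with frame components `w`. -/
def liftEnd (w : ℝ → Matrix (Fin 4) (Fin 4) ℝ) : MatField := fun x =>
  frame x * w (zc x) * coframe x

/-- The partial derivative is split into the covariant derivative, seen in the frame, and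
Christoffel terms. The choice of A is free: it changes the two pieces oppositely. -/
lemma pdM_lift2 {A : ℝ → Coeff} {w : ℝ → Matrix (Fin 4) (Fin 4) ℝ}
    {w' : Matrix (Fin 4) (Fin 4) ℝ} {x : E4} (hx : x ≠ 0) (hw : HasDerivM w w' (zc x))
    (i : Fin 4) : pdM i (lift2 w) x =
      (coframe x).transpose * (coframe x 0 i • w' - (connA A i x).transpose * w (zc x)
        - w (zc x) * connA A i x) * coframe x
      + (conn A i x).transpose * lift2 w x + lift2 w x * conn A i x := by
  have hΘ := diffM_coframe hx
  have hw2 := hw.diffM hx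
  have e : pdM i (lift2 w) x = pdM i (fun y => (coframe y).transpose * w (zc y) * coframe y) x :=
    rfl
  rw [e, pdM_mul (hΘ.transpose.mul hw2) hΘ, pdM_mul hΘ.transpose hw2, pdM_transpose,
    pdM_coframe_eq hx A, hw.pdM hx, Matrix.transpose_sub, Matrix.transpose_mul,
    Matrix.transpose_mul, lift2]
  noncomm_ring

lemma pdM_liftEnd {A : ℝ → Coeff} {w : ℝ → Matrix (Fin 4) (Fin 4) ℝ}
    {w' : Matrix (Fin 4) (Fin 4) ℝ} {x : E4} (hx : x ≠ 0) (hw : HasDerivM w w' (zc x))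
    (i : Fin 4) : pdM i (liftEnd w) x =
      frame x * (coframe x 0 i • w' + connA A i x * w (zc x)
        - w (zc x) * connA A i x) * coframe x
      - conn A i x * liftEnd w x + liftEnd w x * conn A i x := by
  have hΘ := diffM_coframe hx
  have hw2 := hw.diffM hx
  have e : pdM i (liftEnd w) x = pdM i (fun y => frame y * w (zc y) * coframe y) x := rfl
  rw [e, pdM_mul ((diffM_frame x).mul hw2) hΘ, pdM_mul (diffM_frame x) hw2,
    pdM_coframe_eq hx A, pdM_frame_eq hx A, hw.pdM hx, liftEnd]
  noncomm_ring

/-- The metric with frame components `diag h`. -/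
def frameMetric (h : ℝ → Fin 4 → ℝ) : MatField := lift2 fun z => Matrix.diagonal (h z)

/-- `A` are the coefficients, with derivatives `A'`, of the Levi-Civita connection of
`frameMetric h`. -/
structure LeviCivita (I : Set ℝ) (h h' : ℝ → Fin 4 → ℝ) (A A' : ℝ → Coeff) : Prop where
  isOpen : IsOpen I
  ne : ∀ z ∈ I, ∀ a, h z a ≠ 0
  hasDeriv : ∀ z ∈ I, ∀ a, HasDerivAt (fun t => h t a) (h' z a) z
  hasDeriv_coeff : ∀ z ∈ I, ∀ a, HasDerivM (fun t => A t a) (A' z a) z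
  torsion : ∀ z ∈ I, TorsionFree (A z)
  compat : ∀ z ∈ I, ∀ a b c,
    A z a c b * h z c + h z b * A z a b c = if a = 0 ∧ b = c then h' z b else 0

variable {I : Set ℝ} {h h' : ℝ → Fin 4 → ℝ} {A A' : ℝ → Coeff}

lemma frameMetric_transpose (h : ℝ → Fin 4 → ℝ) (x : E4) :
    (frameMetric h x).transpose = frameMetric h x := by
  simp [frameMetric, lift2, Matrix.transpose_mul, mul_assoc]

lemma inv_frameMetric {x : E4} (hx : x ≠ 0) (hne : ∀ a, h (zc x) a ≠ 0) :
    (frameMetric h x)⁻¹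
      = frame x * Matrix.diagonal (fun a => (h (zc x) a)⁻¹) * (frame x).transpose := by
  refine Matrix.inv_eq_left_inv ?_
  have h1 : (frame x).transpose * (coframe x).transpose = 1 := by
    rw [← Matrix.transpose_mul, coframe_mul_frame hx, Matrix.transpose_one]
  have h2 : Matrix.diagonal (fun a => (h (zc x) a)⁻¹) * Matrix.diagonal (h (zc x)) = 1 := by
    rw [Matrix.diagonal_mul_diagonal, ← Matrix.diagonal_one]
    congr 1
    ext a
    exact inv_mul_cancel₀ (hne a)
  calc _ = frame x * (Matrix.diagonal (fun a => (h (zc x) a)⁻¹) *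
        (((frame x).transpose * (coframe x).transpose) * Matrix.diagonal (h (zc x)))) * coframe x := by
        simp only [frameMetric, lift2]; noncomm_ring
    _ = 1 := by rw [h1, one_mul, h2, mul_one, frame_mul_coframe hx]

/-- This says ∇g = 0 in the frame; the diagonal of h' enters only in the ∂_z direction because h
depends on z alone. -/
lemma connA_compat (L : LeviCivita I h h' A A') {x : E4} (hx : x ∈ dom I) (i : Fin 4) :
    coframe x 0 i • Matrix.diagonal (h' (zc x))
      - (connA A i x).transpose * Matrix.diagonal (h (zc x))
      - Matrix.diagonal (h (zc x)) * connA A i x = 0 := by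
  rw [sub_sub, sub_eq_zero]
  ext b c
  simp only [connA, Matrix.transpose_sum, Matrix.add_apply, Matrix.mul_diagonal,
    Matrix.diagonal_mul, Matrix.sum_apply, Matrix.transpose_apply, Matrix.smul_apply,
    Finset.sum_mul, Finset.mul_sum, smul_eq_mul]
  rw [← Finset.sum_add_distrib]
  have : ∀ a, coframe x a i * A (zc x) a c b * h (zc x) c
      + h (zc x) b * (coframe x a i * A (zc x) a b c)
      = if a = 0 then coframe x a i * Matrix.diagonal (h' (zc x)) b c else 0 := by
    intro a
    have := L.compat _ hx.2 a b c
    calc _ = coframe x a i * (A (zc x) a c b * h (zc x) c + h (zc x) b * A (zc x) a b c) := by ring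
      _ = _ := by
        rw [this]
        by_cases h1 : a = 0 <;> by_cases h2 : b = c <;> simp [h1, h2]
  simp only [this]
  simp

lemma pdM_frameMetric (L : LeviCivita I h h' A A') {x : E4} (hx : x ∈ dom I) (i : Fin 4) :
    pdM i (frameMetric h) x
      = (conn A i x).transpose * frameMetric h x + frameMetric h x * conn A i x := by
  have hw : HasDerivM (fun z => Matrix.diagonal (h z)) (Matrix.diagonal (h' (zc x))) (zc x) := by
    intro a b
    by_cases hab : a = b
    · subst hab
      simpa using L.hasDeriv _ hx.2 a
    · simpa [hab] using hasDerivAt_const (zc x) (0 : ℝ)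
  rw [frameMetric, pdM_lift2 (A := A) hx.1 hw, connA_compat L hx]
  simp

/-- Uniqueness of the Levi-Civita connection: a symmetric Γ with ∇g = 0 is recovered by the Koszul
combination of the derivatives of g. -/
lemma christoffel_frameMetric (L : LeviCivita I h h' A A') {x : E4} (hx : x ∈ dom I)
    (k i j : Fin 4) : christoffel (frameMetric h) k i j x = conn A i x k j := by
  set g := frameMetric h with hg
  have hs : ∀ a b, g x a b = g x b a := fun a b =>
    congrFun (congrFun (frameMetric_transpose h x) b) a
  have hc := conn_symm hx.1 (L.torsion _ hx.2)
  have hp : ∀ i j l, pd i (fun y => g y j l) x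
      = ∑ m, (conn A i x m j * g x m l + g x j m * conn A i x m l) := by
    intro i j l
    have := congrFun (congrFun (pdM_frameMetric L hx i) j) l
    rw [Matrix.add_apply, Matrix.mul_apply, Matrix.mul_apply, ← Finset.sum_add_distrib] at this
    exact this
  have hinv : g x * (g x)⁻¹ = 1 := by
    refine Matrix.mul_nonsing_inv _ ?_
    rw [Matrix.isUnit_iff_isUnit_det _ |>.symm, hg]
    have hd : IsUnit (Matrix.diagonal (h (zc x))) := by
      rw [Matrix.isUnit_diagonal, Pi.isUnit_iff]
      exact fun a => (L.ne _ hx.2 a).isUnit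
    have hΘ : IsUnit (coframe x) :=
      ⟨⟨_, _, coframe_mul_frame hx.1, frame_mul_coframe hx.1⟩, rfl⟩
    have hΘ2 : IsUnit (coframe x).transpose := by
      rwa [Matrix.isUnit_transpose]
    exact (hΘ2.mul hd).mul hΘ
  -- In the Koszul combination, symmetry of Γ and of g cancels all terms but two equal ones.
  have hkey : ∀ l, pd i (fun y => g y j l) x + pd j (fun y => g y i l) x
      - pd l (fun y => g y i j) x = 2 * ∑ m, g x l m * conn A i x m j := by
    intro l
    rw [hp, hp, hp, ← Finset.sum_add_distrib, ← Finset.sum_sub_distrib, Finset.mul_sum]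
    refine Finset.sum_congr rfl fun m _ => ?_
    rw [hc j i m, hc l i m, hc l j m, hs m l, hs m j]
    ring
  have hinv' : (g x)⁻¹ * g x = 1 := mul_eq_one_comm.1 hinv
  rw [christoffel]
  simp only [hkey]
  calc _ = ((g x)⁻¹ * (g x * conn A i x)) k j := by
        rw [Matrix.mul_apply, Finset.mul_sum]
        refine Finset.sum_congr rfl fun l _ => ?_
        rw [Matrix.mul_apply]; ring
    _ = _ := by rw [← mul_assoc, hinv', one_mul]

end

section

variable {I : Set ℝ} {h h' : ℝ → Fin 4 → ℝ} {A A' : ℝ → Coeff}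

/-! ## Curvature in the left-invariant frame -/

/-- The curvature `R(e_a, e_b)` as a matrix in the frame. -/
def curvMat (A A' : ℝ → Coeff) (z : ℝ) (a b : Fin 4) : Matrix (Fin 4) (Fin 4) ℝ :=
  (if a = 0 then A' z b else 0) - (if b = 0 then A' z a else 0)
    - ∑ e, structConst e a b • A z e + (A z a * A z b - A z b * A z a)

/-- Applying Θ to the bracket identity gives the structure equation for dΘ, up to sign. -/
lemma coframe_dframe_coframe {x : E4} (hx : x ≠ 0) (i j e : Fin 4) :
    (coframe x * dframe i * coframe x) e j - (coframe x * dframe j * coframe x) e i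
      = ∑ a, ∑ b, structConst e a b * coframe x a i * coframe x b j := by
  have hE := coframe_mul_frame hx
  have h1 : ∀ i j, (coframe x * dframe i * coframe x) e j
      = ∑ k, coframe x e k * (dframe i * coframe x) k j := by
    intro i j
    rw [mul_assoc, Matrix.mul_apply]
  rw [h1 i j, h1 j i, ← Finset.sum_sub_distrib]
  have h2 : ∀ k, coframe x e k * (dframe i * coframe x) k j
      - coframe x e k * (dframe j * coframe x) k i
      = ∑ c, coframe x e k * frame x k c *
          ∑ a, ∑ b, structConst c a b * coframe x a i * coframe x b j := by
    intro k
    rw [← mul_sub, dframe_torsion hx, Finset.mul_sum]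
    refine Finset.sum_congr rfl fun c _ => ?_
    simp only [Finset.mul_sum]
    exact Finset.sum_congr rfl fun a _ => Finset.sum_congr rfl fun b _ => by ring
  simp only [h2]
  rw [Finset.sum_comm]
  simp only [← Finset.sum_mul, ← Matrix.mul_apply, hE, Matrix.one_apply]
  simp

lemma diffM_connA (L : LeviCivita I h h' A A') {x : E4} (hx : x ∈ dom I) (j : Fin 4) :
    DiffM (connA A j) x := by
  intro c d
  have e : (fun y => connA A j y c d) = fun y => ∑ a, coframe y a j * A (zc y) a c d := by
    ext y
    simp [connA, Matrix.sum_apply]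
  rw [e]
  exact DifferentiableAt.fun_sum fun a _ => (diffM_coframe hx.1 a j).mul
    ((L.hasDeriv_coeff _ hx.2 a).diffM hx.1 c d)

lemma pdM_connA (L : LeviCivita I h h' A A') {x : E4} (hx : x ∈ dom I) (i j : Fin 4) :
    pdM i (connA A j) x = ∑ a, (-(coframe x * dframe i * coframe x) a j • A (zc x) a
      + (coframe x a j * coframe x 0 i) • A' (zc x) a) := by
  ext c d
  have e : (fun y => connA A j y c d) = fun y => ∑ a, coframe y a j * A (zc y) a c d := by
    ext y
    simp [connA, Matrix.sum_apply]
  rw [pdM, Matrix.of_apply, e, pd_sum (f := fun a y => coframe y a j * A (zc y) a c d)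
    fun a _ => (diffM_coframe hx.1 a j).mul ((L.hasDeriv_coeff _ hx.2 a).diffM hx.1 c d),
    Matrix.sum_apply]
  refine Finset.sum_congr rfl fun a _ => ?_
  rw [pd_mul (diffM_coframe hx.1 a j) ((L.hasDeriv_coeff _ hx.2 a).diffM hx.1 c d)]
  have h1 := congrFun (congrFun (pdM_coframe hx.1 i) a) j
  have h2 := congrFun (congrFun ((L.hasDeriv_coeff _ hx.2 a).pdM hx.1 i) c) d
  simp only [pdM, Matrix.of_apply] at h1 h2
  rw [h1, h2]
  simp
  ring

/-- Cartan's second structure equation dA + A∧A. Differentiating the coefficients gives the A'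
terms, which need a dz leg; differentiating the coframe gives the structure constants; the
commutator is the quadratic part. -/
lemma connA_curv (L : LeviCivita I h h' A A') {x : E4} (hx : x ∈ dom I) (i j : Fin 4) :
    pdM i (connA A j) x - pdM j (connA A i) x
      + (connA A i x * connA A j x - connA A j x * connA A i x)
      = ∑ a, ∑ b, (coframe x a i * coframe x b j) • curvMat A A' (zc x) a b := by
  have h1 : connA A i x * connA A j x
      = ∑ a, ∑ b, (coframe x a i * coframe x b j) • (A (zc x) a * A (zc x) b) := by
    simp only [connA, Finset.sum_mul, Finset.mul_sum, Matrix.smul_mul, Matrix.mul_smul, smul_smul]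
    exact Finset.sum_comm.trans (Finset.sum_congr rfl fun a _ => Finset.sum_congr rfl fun b _ => by
      first | rfl | rw [mul_comm])
  have h2 : connA A j x * connA A i x
      = ∑ a, ∑ b, (coframe x a i * coframe x b j) • (A (zc x) b * A (zc x) a) := by
    simp only [connA, Finset.sum_mul, Finset.mul_sum, Matrix.smul_mul, Matrix.mul_smul, smul_smul]
  have h3 : ∑ a, ∑ b, (coframe x a i * coframe x b j) • (if a = 0 then A' (zc x) b else 0)
      = ∑ a, (coframe x a j * coframe x 0 i) • A' (zc x) a := by
    rw [Finset.sum_comm]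
    simp [smul_ite, mul_comm]
  have h4 : ∑ a, ∑ b, (coframe x a i * coframe x b j) • (if b = 0 then A' (zc x) a else 0)
      = ∑ a, (coframe x a i * coframe x 0 j) • A' (zc x) a := by
    simp [smul_ite]
  have h5 : ∑ a, ∑ b, (coframe x a i * coframe x b j) • ∑ e, structConst e a b • A (zc x) e
      = ∑ e, ((coframe x * dframe i * coframe x) e j
          - (coframe x * dframe j * coframe x) e i) • A (zc x) e := by
    simp only [coframe_dframe_coframe hx.1, Finset.smul_sum, Finset.sum_smul, smul_smul]
    rw [Finset.sum_comm' (t' := Finset.univ) (s' := fun _ => Finset.univ) (by simp)]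
    rw [Finset.sum_comm]
    conv_rhs => rw [Finset.sum_comm]
    refine Finset.sum_congr rfl fun a _ => ?_
    conv_rhs => rw [Finset.sum_comm]
    refine Finset.sum_congr rfl fun b _ => Finset.sum_congr rfl fun e _ => ?_
    congr 1
    ring
  simp only [curvMat, smul_add, smul_sub, Finset.sum_add_distrib, Finset.sum_sub_distrib]
  rw [h3, h4, h5, h1, h2, pdM_connA L hx, pdM_connA L hx]
  simp only [Finset.sum_add_distrib, sub_smul, neg_smul, Finset.sum_neg_distrib,
    Finset.sum_sub_distrib]
  abel

/-- Curvature is gauge covariant. With Γ = (EA - dE)Θ, all terms containing derivatives of E cancel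
and the curvature of A is conjugated by E. -/
lemma riemUp_frameMetric (L : LeviCivita I h h' A A') {x : E4} (hx : x ∈ dom I)
    (i j k l : Fin 4) : riemUp (frameMetric h) i j k l x =
      ∑ a, ∑ b, coframe x a i * coframe x b j *
        (frame x * curvMat A A' (zc x) a b * coframe x) l k := by
  have hev : ∀ᶠ y in nhds x, y ∈ dom I := (isOpen_dom L.isOpen).mem_nhds hx
  have hpd : ∀ i j k l, pd i (christoffel (frameMetric h) l j k) x
      = pdM i (conn A j) x l k := by
    intro i j k l
    exact pd_congr (hev.mono fun y hy => christoffel_frameMetric L hy l j k)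
  -- No second derivative of E appears, because E is linear and `dframe j` is constant.
  have hpc : ∀ i j, pdM i (conn A j) x = (dframe i * connA A j x
      + frame x * pdM i (connA A j) x) * coframe x
      - (frame x * connA A j x - dframe j) * (coframe x * dframe i * coframe x) := by
    intro i j
    have h1 : pdM i (conn A j) x
        = pdM i (fun y => (frame y * connA A j y - dframe j) * coframe y) x := rfl
    have hF := (diffM_frame x).mul (diffM_connA L hx j)
    rw [h1, pdM_mul (hF.sub (DiffM.const _ x)) (diffM_coframe hx.1),
      pdM_sub hF (DiffM.const _ x), pdM_const, pdM_mul (diffM_frame x) (diffM_connA L hx j),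
      pdM_frame, pdM_coframe hx.1]
    noncomm_ring
  have hE : ∀ X, coframe x * (frame x * X) = X := fun X => by
    rw [← mul_assoc, coframe_mul_frame hx.1, one_mul]
  have hM : pdM i (conn A j) x - pdM j (conn A i) x
      + (conn A i x * conn A j x - conn A j x * conn A i x)
      = frame x * (∑ a, ∑ b, (coframe x a i * coframe x b j) • curvMat A A' (zc x) a b)
        * coframe x := by
    rw [← connA_curv L hx, hpc, hpc, conn, conn]
    simp only [mul_sub, sub_mul, mul_add, add_mul, mul_assoc, hE]
    abel
  have hM2 := congrFun (congrFun hM l) k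
  have : riemUp (frameMetric h) i j k l x = (pdM i (conn A j) x - pdM j (conn A i) x
      + (conn A i x * conn A j x - conn A j x * conn A i x)) l k := by
    simp only [riemUp, hpd, christoffel_frameMetric L hx, Finset.sum_sub_distrib,
      Matrix.add_apply, Matrix.sub_apply, Matrix.mul_apply]
  rw [this, hM2]
  simp only [Finset.mul_sum, Finset.sum_mul, Matrix.sum_apply, Matrix.mul_smul, Matrix.smul_mul,
    Matrix.smul_apply, smul_eq_mul]

/-- The pullback of a four-tensor along a linear map. -/
def pull4 (P : Matrix (Fin 4) (Fin 4) ℝ) (t : Fin 4 → Fin 4 → Fin 4 → Fin 4 → ℝ)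
    (i j k l : Fin 4) : ℝ :=
  ∑ a, ∑ b, ∑ c, ∑ d, P a i * P b j * P c k * P d l * t a b c d

/-- The pullback of a three-tensor along a linear map. -/
def pull3 (P : Matrix (Fin 4) (Fin 4) ℝ) (t : Fin 4 → Fin 4 → Fin 4 → ℝ)
    (j k l : Fin 4) : ℝ :=
  ∑ b, ∑ c, ∑ d, P b j * P c k * P d l * t b c d

/-- The covariant four-tensor with frame components `t`. -/
def lift4 (t : ℝ → Fin 4 → Fin 4 → Fin 4 → Fin 4 → ℝ) : Tensor4 := fun i j k l x =>
  pull4 (coframe x) (t (zc x)) i j k l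

/-- Frame components of the curvature tensor. -/
def frameRiem (h : ℝ → Fin 4 → ℝ) (A A' : ℝ → Coeff) (z : ℝ) (a b c d : Fin 4) : ℝ :=
  curvMat A A' z a b d c * h z d

/-- Frame components of the Ricci tensor. -/
def frameRic (A A' : ℝ → Coeff) (z : ℝ) : Matrix (Fin 4) (Fin 4) ℝ :=
  Matrix.of fun b c => ∑ a, curvMat A A' z a b a c

/-- The scalar curvature as a function of `z`. -/
def frameScal (h : ℝ → Fin 4 → ℝ) (A A' : ℝ → Coeff) (z : ℝ) : ℝ :=
  ∑ a, (h z a)⁻¹ * frameRic A A' z a a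

lemma riem_frameMetric (L : LeviCivita I h h' A A') {x : E4} (hx : x ∈ dom I)
    (i j k l : Fin 4) : riem (frameMetric h) i j k l x = lift4 (frameRiem h A A') i j k l x := by
  simp only [riem, riemUp_frameMetric L hx, lift4, pull4, Finset.sum_mul]
  rw [Finset.sum_comm]
  refine Finset.sum_congr rfl fun a _ => ?_
  rw [Finset.sum_comm]
  refine Finset.sum_congr rfl fun b _ => ?_
  have hT : (frame x).transpose * (coframe x).transpose = 1 := by
    rw [← Matrix.transpose_mul, coframe_mul_frame hx.1, Matrix.transpose_one]
  have h1 : (frame x * curvMat A A' (zc x) a b * coframe x).transpose * frameMetric h x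
      = (coframe x).transpose * ((curvMat A A' (zc x) a b).transpose
        * Matrix.diagonal (h (zc x)) * coframe x) := by
    simp only [frameMetric, lift2, Matrix.transpose_mul]
    calc _ = (coframe x).transpose * ((curvMat A A' (zc x) a b).transpose
        * (((frame x).transpose * (coframe x).transpose) * Matrix.diagonal (h (zc x)))
          * coframe x) := by noncomm_ring
      _ = _ := by rw [hT, one_mul]
  have h2 := congrFun (congrFun h1 k) l
  rw [Matrix.mul_apply] at h2
  calc _ = coframe x a i * coframe x b j * ∑ m,
        (frame x * curvMat A A' (zc x) a b * coframe x).transpose k m * frameMetric h x m l := by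
        rw [Finset.mul_sum]
        exact Finset.sum_congr rfl fun m _ => by rw [Matrix.transpose_apply]; ring
    _ = _ := by
        rw [h2, Matrix.mul_apply, Finset.mul_sum]
        refine Finset.sum_congr rfl fun c _ => ?_
        rw [Matrix.mul_apply, Finset.mul_sum, Finset.mul_sum]
        refine Finset.sum_congr rfl fun d _ => ?_
        simp only [frameRiem, Matrix.mul_diagonal, Matrix.transpose_apply]
        ring

lemma ric_frameMetric (L : LeviCivita I h h' A A') {x : E4} (hx : x ∈ dom I)
    (j k : Fin 4) : ric (frameMetric h) j k x = lift2 (frameRic A A') x j k := by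
  simp only [ric, riemUp_frameMetric L hx]
  have h1 : ∀ a b, ∑ i, coframe x a i * (frame x * curvMat A A' (zc x) a b * coframe x) i k
      = (curvMat A A' (zc x) a b * coframe x) a k := by
    intro a b
    rw [← Matrix.mul_apply, mul_assoc, ← mul_assoc (coframe x), coframe_mul_frame hx.1, one_mul]
  calc _ = ∑ a, ∑ b, coframe x b j *
        ∑ i, coframe x a i * (frame x * curvMat A A' (zc x) a b * coframe x) i k := by
        rw [Finset.sum_comm]
        refine Finset.sum_congr rfl fun a _ => ?_
        rw [Finset.sum_comm]
        refine Finset.sum_congr rfl fun b _ => ?_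
        rw [Finset.mul_sum]
        exact Finset.sum_congr rfl fun i _ => by ring
    _ = _ := by
        simp only [h1]
        rw [lift2, mul_assoc, Matrix.mul_apply, Finset.sum_comm]
        refine Finset.sum_congr rfl fun b _ => ?_
        rw [← Finset.mul_sum, Matrix.transpose_apply]
        congr 1
        simp only [Matrix.mul_apply, frameRic, Matrix.of_apply, Finset.sum_mul]
        exact Finset.sum_comm

lemma scal_frameMetric (L : LeviCivita I h h' A A') {x : E4} (hx : x ∈ dom I) :
    scal (frameMetric h) x = frameScal h A A' (zc x) := by
  have hE := coframe_mul_frame hx.1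
  have hT : (frame x).transpose * (coframe x).transpose = 1 := by
    rw [← Matrix.transpose_mul, hE, Matrix.transpose_one]
  have hs : ∀ a b, (frameMetric h x)⁻¹ a b = (frameMetric h x)⁻¹ b a := fun a b => by
    rw [← Matrix.transpose_apply (frameMetric h x)⁻¹, Matrix.transpose_nonsing_inv,
      frameMetric_transpose]
  calc scal (frameMetric h) x
      = Matrix.trace ((frameMetric h x)⁻¹ * lift2 (frameRic A A') x) := by
        simp only [scal, ric_frameMetric L hx, Matrix.trace, Matrix.diag, Matrix.mul_apply]
        rw [Finset.sum_comm]
        exact Finset.sum_congr rfl fun a _ => Finset.sum_congr rfl fun b _ => by rw [hs]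
    _ = Matrix.trace (Matrix.diagonal (fun a => (h (zc x) a)⁻¹) * frameRic A A' (zc x)) := by
        have hX' : (frame x).transpose * ((coframe x).transpose * (frameRic A A' (zc x) * coframe x))
            = frameRic A A' (zc x) * coframe x := by rw [← mul_assoc, hT, one_mul]
        rw [inv_frameMetric hx.1 (L.ne _ hx.2), lift2, mul_assoc, mul_assoc, mul_assoc, hX',
          Matrix.trace_mul_comm, mul_assoc, mul_assoc, hE, mul_one]
    _ = _ := by
        simp [Matrix.trace, Matrix.diagonal_mul, frameScal]

end

section

variable {I : Set ℝ} {h h' : ℝ → Fin 4 → ℝ} {A A' : ℝ → Coeff}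

/-! ## Four-tensors in the left-invariant frame -/

section sums

variable {ι M : Type*} [Fintype ι] [AddCommMonoid M]

/-- Index bookkeeping for contractions: the `push` lemmas move the outermost sum innermost, the
`swap` lemmas exchange the first and last indices. -/
lemma sum_push2 (X : ι → ι → ι → M) :
    ∑ e, ∑ a, ∑ b, X e a b = ∑ a, ∑ b, ∑ e, X e a b := by
  rw [Finset.sum_comm]
  exact Finset.sum_congr rfl fun a _ => Finset.sum_comm

lemma sum_push3 (X : ι → ι → ι → ι → M) :
    ∑ e, ∑ a, ∑ b, ∑ c, X e a b c = ∑ a, ∑ b, ∑ c, ∑ e, X e a b c := by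
  rw [Finset.sum_comm]
  refine Finset.sum_congr rfl fun a _ => ?_
  rw [Finset.sum_comm]
  exact Finset.sum_congr rfl fun b _ => Finset.sum_comm

lemma sum_push4 (X : ι → ι → ι → ι → ι → M) :
    ∑ e, ∑ a, ∑ b, ∑ c, ∑ d, X e a b c d = ∑ a, ∑ b, ∑ c, ∑ d, ∑ e, X e a b c d := by
  rw [Finset.sum_comm]
  exact Finset.sum_congr rfl fun a _ => sum_push3 _

lemma sum_swap3 (X : ι → ι → ι → M) :
    ∑ a, ∑ b, ∑ e, X a b e = ∑ a, ∑ b, ∑ e, X e b a := by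
  calc _ = ∑ b, ∑ a, ∑ e, X a b e := Finset.sum_comm
    _ = ∑ b, ∑ e, ∑ a, X a b e := Finset.sum_congr rfl fun b _ => Finset.sum_comm
    _ = _ := Finset.sum_comm

lemma sum_swap4 (X : ι → ι → ι → ι → M) :
    ∑ a, ∑ b, ∑ c, ∑ e, X a b c e = ∑ a, ∑ b, ∑ c, ∑ e, X e b c a := by
  calc _ = ∑ b, ∑ a, ∑ c, ∑ e, X a b c e := Finset.sum_comm
    _ = ∑ b, ∑ a, ∑ c, ∑ e, X e b c a := Finset.sum_congr rfl fun b _ => sum_swap3 _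
    _ = _ := Finset.sum_comm

lemma sum_swap5 (X : ι → ι → ι → ι → ι → M) :
    ∑ a, ∑ b, ∑ c, ∑ d, ∑ e, X a b c d e = ∑ a, ∑ b, ∑ c, ∑ d, ∑ e, X e b c d a := by
  calc _ = ∑ b, ∑ a, ∑ c, ∑ d, ∑ e, X a b c d e := Finset.sum_comm
    _ = ∑ b, ∑ a, ∑ c, ∑ d, ∑ e, X e b c d a := Finset.sum_congr rfl fun b _ => sum_swap4 _
    _ = _ := Finset.sum_comm

end sums

lemma lift2_apply (w : ℝ → Matrix (Fin 4) (Fin 4) ℝ) (x : E4) (i j : Fin 4) :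
    lift2 w x i j = ∑ a, ∑ b, coframe x a i * coframe x b j * w (zc x) a b := by
  rw [lift2, mul_assoc, Matrix.mul_apply]
  refine Finset.sum_congr rfl fun a _ => ?_
  rw [Matrix.mul_apply, Finset.mul_sum]
  refine Finset.sum_congr rfl fun b _ => ?_
  rw [Matrix.transpose_apply]
  ring

lemma lift2_mul_outer (u v : ℝ → Matrix (Fin 4) (Fin 4) ℝ) (x : E4) (i j k l : Fin 4) :
    lift2 u x i l * lift2 v x j k
      = pull4 (coframe x) (fun a b c d => u (zc x) a d * v (zc x) b c) i j k l := by
  rw [lift2_apply, lift2_apply, Finset.sum_mul_sum, pull4]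
  refine Finset.sum_congr rfl fun a _ => Finset.sum_congr rfl fun b _ => ?_
  rw [Finset.sum_mul_sum, Finset.sum_comm]
  exact Finset.sum_congr rfl fun c _ => Finset.sum_congr rfl fun d _ => by ring

lemma lift2_mul_cross (u v : ℝ → Matrix (Fin 4) (Fin 4) ℝ) (x : E4) (i j k l : Fin 4) :
    lift2 u x i k * lift2 v x j l
      = pull4 (coframe x) (fun a b c d => u (zc x) a c * v (zc x) b d) i j k l := by
  rw [lift2_apply, lift2_apply, Finset.sum_mul_sum, pull4]
  refine Finset.sum_congr rfl fun a _ => Finset.sum_congr rfl fun b _ => ?_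
  rw [Finset.sum_mul_sum]
  exact Finset.sum_congr rfl fun c _ => Finset.sum_congr rfl fun d _ => by ring

lemma pull4_add (P : Matrix (Fin 4) (Fin 4) ℝ) (t u : Fin 4 → Fin 4 → Fin 4 → Fin 4 → ℝ)
    (i j k l : Fin 4) :
    pull4 P (fun a b c d => t a b c d + u a b c d) i j k l
      = pull4 P t i j k l + pull4 P u i j k l := by
  simp only [pull4, mul_add, Finset.sum_add_distrib]

lemma pull4_sub (P : Matrix (Fin 4) (Fin 4) ℝ) (t u : Fin 4 → Fin 4 → Fin 4 → Fin 4 → ℝ)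
    (i j k l : Fin 4) :
    pull4 P (fun a b c d => t a b c d - u a b c d) i j k l
      = pull4 P t i j k l - pull4 P u i j k l := by
  simp only [pull4, mul_sub, Finset.sum_sub_distrib]

lemma pull4_smul (P : Matrix (Fin 4) (Fin 4) ℝ) (r : ℝ)
    (t : Fin 4 → Fin 4 → Fin 4 → Fin 4 → ℝ) (i j k l : Fin 4) :
    pull4 P (fun a b c d => r * t a b c d) i j k l = r * pull4 P t i j k l := by
  simp only [pull4, Finset.mul_sum]
  exact Finset.sum_congr rfl fun a _ => Finset.sum_congr rfl fun b _ =>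
    Finset.sum_congr rfl fun c _ => Finset.sum_congr rfl fun d _ => by ring

/-- Frame components of the Weyl tensor. -/
def frameWeyl (h : ℝ → Fin 4 → ℝ) (A A' : ℝ → Coeff) (z : ℝ) (a b c d : Fin 4) : ℝ :=
  frameRiem h A A' z a b c d
    - 1 / 2 * (Matrix.diagonal (h z) a d * frameRic A A' z b c
      + frameRic A A' z a d * Matrix.diagonal (h z) b c
      - Matrix.diagonal (h z) a c * frameRic A A' z b d
      - frameRic A A' z a c * Matrix.diagonal (h z) b d)
    + frameScal h A A' z / 6 * (Matrix.diagonal (h z) a d * Matrix.diagonal (h z) b c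
      - Matrix.diagonal (h z) a c * Matrix.diagonal (h z) b d)

lemma weyl_frameMetric (L : LeviCivita I h h' A A') {x : E4} (hx : x ∈ dom I)
    (i j k l : Fin 4) : weyl (frameMetric h) i j k l x = lift4 (frameWeyl h A A') i j k l x := by
  rw [weyl, lift4, riem_frameMetric L hx, scal_frameMetric L hx]
  unfold frameWeyl
  simp only [pull4_add, pull4_sub, pull4_smul]
  simp only [ric_frameMetric L hx]
  have o := lift2_mul_outer (frameRic A A') (fun z => Matrix.diagonal (h z)) x i j k l
  have c := lift2_mul_cross (frameRic A A') (fun z => Matrix.diagonal (h z)) x i j k l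
  rw [← lift2_mul_outer (fun z => Matrix.diagonal (h z)) (frameRic A A'), ← o,
    ← lift2_mul_cross (fun z => Matrix.diagonal (h z)) (frameRic A A'), ← c,
    ← lift2_mul_outer (fun z => Matrix.diagonal (h z)) (fun z => Matrix.diagonal (h z)),
    ← lift2_mul_cross (fun z => Matrix.diagonal (h z)) (fun z => Matrix.diagonal (h z))]
  simp only [lift4, frameMetric]
  ring

/-! ## The Hodge star -/

lemma sum_fun_succ {n : ℕ} (f : (Fin (n + 1) → Fin 4) → ℝ) :
    ∑ r, f r = ∑ a, ∑ r' : Fin n → Fin 4, f (Fin.cons a r') := by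
  rw [← (Fin.consEquiv fun _ => Fin 4).sum_comp, Fintype.sum_prod_type]
  rfl

/-- The columns i, j, k, l of P are expanded in the standard basis; multilinearity of the
determinant produces the fourfold sum, while multiplicativity evaluates it as det P times the
symbol. -/
lemma pull4_levi (P : Matrix (Fin 4) (Fin 4) ℝ) (i j k l : Fin 4) :
    pull4 P levi i j k l = P.det * levi i j k l := by
  have h1 : P.det * levi i j k l
      = Matrix.detRowAlternating.toMultilinearMap
        (fun a : Fin 4 => ∑ c, P c ((![i, j, k, l] : Fin 4 → Fin 4) a) • (Pi.single c 1 : E4)) := by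
    rw [levi, ← Matrix.det_transpose P, mul_comm, ← Matrix.det_mul]
    change Matrix.det _ = Matrix.det _
    congr 1
    ext a c
    simp [Matrix.mul_apply, Pi.single_apply]
  rw [h1, MultilinearMap.map_sum]
  simp only [MultilinearMap.map_smul_univ]
  rw [sum_fun_succ, pull4]
  refine Finset.sum_congr rfl fun a _ => ?_
  rw [sum_fun_succ]
  refine Finset.sum_congr rfl fun b _ => ?_
  rw [sum_fun_succ]
  refine Finset.sum_congr rfl fun c _ => ?_
  rw [sum_fun_succ]
  refine Finset.sum_congr rfl fun d _ => ?_
  rw [Fintype.sum_unique, smul_eq_mul, Fin.prod_univ_four]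
  congr 1
  rw [levi]
  change Matrix.det _ = Matrix.det _
  congr 1
  ext s t
  have key : ∀ c : Fin 4, (Pi.single c 1 : E4) t = if c = t then 1 else 0 := fun c => by
    simp [Pi.single_apply, eq_comm]
  fin_cases s <;> exact (key _).symm

lemma det_frame (x : E4) : (frame x).det = nsq x ^ 2 / 2 := by
  simp [Matrix.det_succ_row_zero, Fin.sum_univ_succ, frame, ez, e1, e2, e3, nsq,
    Fin.succAbove]
  ring

lemma det_coframe_pos {x : E4} (hx : x ≠ 0) : 0 < (coframe x).det := by
  have h1 : (coframe x).det * (frame x).det = 1 := by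
    rw [← Matrix.det_mul, coframe_mul_frame hx, Matrix.det_one]
  have h2 : 0 < (frame x).det := by
    have := nsq_pos hx
    rw [det_frame]; positivity
  exact pos_of_mul_pos_left (by rw [h1]; exact one_pos) h2.le

/-- Frame components of the volume form. -/
def frameVol (h : ℝ → Fin 4 → ℝ) (z : ℝ) (a b c d : Fin 4) : ℝ := √(∏ e, h z e) * levi a b c d

/-- det g = (det Θ)² ∏ h, and positivity of det Θ removes the absolute value from the root. This is
where the frame orientation is matched with that of ℝ⁴. -/
lemma volForm_frameMetric (h : ℝ → Fin 4 → ℝ) {x : E4} (hx : x ≠ 0) (i j k l : Fin 4) :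
    volForm (frameMetric h) i j k l x = lift4 (frameVol h) i j k l x := by
  have h1 : (frameMetric h x).det = (coframe x).det ^ 2 * ∏ e, h (zc x) e := by
    rw [frameMetric, lift2, Matrix.det_mul, Matrix.det_mul, Matrix.det_transpose,
      Matrix.det_diagonal]
    ring
  have h2 := det_coframe_pos hx
  rw [lift4]
  unfold frameVol
  rw [pull4_smul, pull4_levi, volForm, h1, Real.sqrt_mul (sq_nonneg _), Real.sqrt_sq h2.le]
  ring

lemma contract_inv {x : E4} (hx : x ≠ 0) (hne : ∀ a, h (zc x) a ≠ 0) :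
    coframe x * (frameMetric h x)⁻¹ * (coframe x).transpose
      = Matrix.diagonal (fun a => (h (zc x) a)⁻¹) := by
  have hE := coframe_mul_frame hx
  have hT : (frame x).transpose * (coframe x).transpose = 1 := by
    rw [← Matrix.transpose_mul, hE, Matrix.transpose_one]
  rw [inv_frameMetric hx hne]
  calc _ = (coframe x * frame x) * Matrix.diagonal (fun a => (h (zc x) a)⁻¹)
        * ((frame x).transpose * (coframe x).transpose) := by noncomm_ring
    _ = _ := by rw [hE, hT, one_mul, mul_one]

/-- Contracting two lifted indices with g⁻¹ reduces to a diagonal frame contraction, since Θ g⁻¹ Θᵀ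
= diag(1/h). -/
lemma sum_contract_inv {x : E4} (hx : x ≠ 0) (hne : ∀ a, h (zc x) a ≠ 0)
    (Y : Matrix (Fin 4) (Fin 4) ℝ) :
    ∑ m, ∑ i, (frameMetric h x)⁻¹ m i * ∑ n, ∑ a, coframe x n m * coframe x a i * Y n a
      = ∑ a, (h (zc x) a)⁻¹ * Y a a := by
  have h1 := contract_inv hx hne
  have h2 : ∀ n a, ∑ m, ∑ i, coframe x n m * (frameMetric h x)⁻¹ m i * coframe x a i
      = Matrix.diagonal (fun a => (h (zc x) a)⁻¹) n a := by
    intro n a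
    rw [← h1, Matrix.mul_apply, Finset.sum_comm]
    refine Finset.sum_congr rfl fun i _ => ?_
    rw [Matrix.mul_apply, Finset.sum_mul, Matrix.transpose_apply]
  calc _ = ∑ m, ∑ i, ∑ n, ∑ a, coframe x n m * (frameMetric h x)⁻¹ m i * coframe x a i * Y n a := by
        refine Finset.sum_congr rfl fun m _ => Finset.sum_congr rfl fun i _ => ?_
        simp only [Finset.mul_sum]
        exact Finset.sum_congr rfl fun n _ => Finset.sum_congr rfl fun a _ => by ring
    _ = ∑ n, ∑ a, ∑ m, ∑ i, coframe x n m * (frameMetric h x)⁻¹ m i * coframe x a i * Y n a := by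
        simp only [sum_push2 (fun i n a => coframe x n _ * (frameMetric h x)⁻¹ _ i * coframe x a i * Y n a)]
        exact sum_push2 _
    _ = ∑ n, ∑ a, Matrix.diagonal (fun a => (h (zc x) a)⁻¹) n a * Y n a := by
        simp only [← Finset.sum_mul, h2]
    _ = _ := by simp [Matrix.diagonal_apply]

end

section

variable {I : Set ℝ} {h h' : ℝ → Fin 4 → ℝ} {A A' : ℝ → Coeff}

/-! ### Contractions of lifted tensors and the Hodge star in the frame -/

lemma congr_matrix_apply (P w : Matrix (Fin 4) (Fin 4) ℝ) (i j : Fin 4) :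
    (P.transpose * w * P) i j = ∑ a, ∑ b, P a i * P b j * w a b := by
  rw [mul_assoc, Matrix.mul_apply]
  refine Finset.sum_congr rfl fun a _ => ?_
  rw [Matrix.mul_apply, Finset.mul_sum]
  refine Finset.sum_congr rfl fun b _ => ?_
  rw [Matrix.transpose_apply]
  ring

lemma pull4_eq_first (P : Matrix (Fin 4) (Fin 4) ℝ) (t : Fin 4 → Fin 4 → Fin 4 → Fin 4 → ℝ)
    (i j k l : Fin 4) : pull4 P t i j k l
      = (P.transpose * Matrix.of (fun a b => ∑ c, ∑ d, P c k * P d l * t a b c d) * P) i j := by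
  rw [congr_matrix_apply, pull4]
  refine Finset.sum_congr rfl fun a _ => Finset.sum_congr rfl fun b _ => ?_
  simp only [Matrix.of_apply, Finset.mul_sum]
  exact Finset.sum_congr rfl fun c _ => Finset.sum_congr rfl fun d _ => by ring

lemma pull4_eq_last (P : Matrix (Fin 4) (Fin 4) ℝ) (t : Fin 4 → Fin 4 → Fin 4 → Fin 4 → ℝ)
    (i j k l : Fin 4) : pull4 P t i j k l
      = (P.transpose * Matrix.of (fun c d => ∑ a, ∑ b, P a i * P b j * t a b c d) * P) k l := by
  rw [congr_matrix_apply, pull4]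
  simp only [Matrix.of_apply, Finset.mul_sum]
  symm
  calc _ = ∑ c, ∑ a, ∑ b, ∑ d, P c k * P d l * (P a i * P b j * t a b c d) :=
        Finset.sum_congr rfl fun c _ => sum_push2 _
    _ = ∑ a, ∑ b, ∑ d, ∑ c, P c k * P d l * (P a i * P b j * t a b c d) := sum_push3 _
    _ = _ := by
      refine Finset.sum_congr rfl fun a _ => Finset.sum_congr rfl fun b _ => ?_
      rw [Finset.sum_comm]
      exact Finset.sum_congr rfl fun c _ => Finset.sum_congr rfl fun d _ => by ring

/-- Written as a trace, the double contraction contains Θ g⁻¹ Θᵀ twice, and each occurrence is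
diag(1/h). -/
lemma contract_two {x : E4} (hx : x ≠ 0) (hne : ∀ a, h (zc x) a ≠ 0)
    (v w : Matrix (Fin 4) (Fin 4) ℝ) :
    ∑ m, ∑ n, ∑ p, ∑ q, ((coframe x).transpose * v * coframe x) m n * (frameMetric h x)⁻¹ m p
      * (frameMetric h x)⁻¹ n q * ((coframe x).transpose * w * coframe x) p q
      = ∑ e, ∑ f, v e f * (h (zc x) e)⁻¹ * (h (zc x) f)⁻¹ * w e f := by
  set G := (frameMetric h x)⁻¹ with hG
  have hGT : G.transpose = G := by
    rw [hG, Matrix.transpose_nonsing_inv, frameMetric_transpose]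
  have hU := contract_inv hx hne
  rw [← hG] at hU
  set Θ := coframe x
  calc _ = Matrix.trace ((Θ.transpose * v * Θ).transpose * G * (Θ.transpose * w * Θ)
        * G.transpose) := by
        generalize Θ.transpose * v * Θ = V
        generalize Θ.transpose * w * Θ = W
        simp only [Matrix.trace, Matrix.diag, Matrix.mul_apply, Finset.sum_mul,
          Matrix.transpose_apply]
        calc _ = ∑ n, ∑ p, ∑ q, ∑ m, V m n * G m p * G n q * W p q := sum_push3 _
          _ = _ := by
            refine Finset.sum_congr rfl fun n _ => ?_
            rw [Finset.sum_comm]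
            exact Finset.sum_congr rfl fun q _ => Finset.sum_congr rfl fun p _ =>
              Finset.sum_congr rfl fun m _ => by ring
    _ = Matrix.trace (v.transpose * (Θ * G * Θ.transpose) * w * (Θ * G * Θ.transpose)) := by
        rw [hGT, Matrix.transpose_mul, Matrix.transpose_mul, Matrix.transpose_transpose]
        simp only [mul_assoc]
        rw [Matrix.trace_mul_comm]
        simp only [mul_assoc]
    _ = _ := by
        rw [hU, Matrix.trace]
        simp only [Matrix.diag, Matrix.mul_diagonal]
        rw [Finset.sum_comm]
        refine Finset.sum_congr rfl fun f _ => ?_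
        rw [Matrix.mul_apply, Finset.sum_mul]
        refine Finset.sum_congr rfl fun e _ => ?_
        rw [Matrix.mul_diagonal, Matrix.transpose_apply]
        ring

/-- Frame components of the Hodge star. -/
def frameStar (h : ℝ → Fin 4 → ℝ) (t : ℝ → Fin 4 → Fin 4 → Fin 4 → Fin 4 → ℝ) (z : ℝ)
    (a b c d : Fin 4) : ℝ :=
  1 / 2 * ∑ e, ∑ f, frameVol h z a b e f * (h z e)⁻¹ * (h z f)⁻¹ * t z e f c d

/-- The volume form and T are both lifts. For fixed outer indices they are matrices congruent by Θ
in the contracted pair, so `contract_two` applies. -/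
lemma star12_frameMetric {t : ℝ → Fin 4 → Fin 4 → Fin 4 → Fin 4 → ℝ} {T : Tensor4} {x : E4}
    (hx : x ≠ 0) (hne : ∀ a, h (zc x) a ≠ 0) (hT : ∀ i j k l, T i j k l x = lift4 t i j k l x)
    (i j k l : Fin 4) :
    star12 (frameMetric h) T i j k l x = lift4 (frameStar h t) i j k l x := by
  rw [star12]
  simp only [volForm_frameMetric h hx, hT, lift4]
  simp only [pull4_eq_last (coframe x) (frameVol h (zc x)) i j]
  simp only [pull4_eq_first (coframe x) (t (zc x)) _ _ k l]
  rw [contract_two hx hne]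
  unfold frameStar
  rw [pull4_smul]
  congr 1
  simp only [Matrix.of_apply, pull4]
  have e1 : ∀ X : Fin 4 → Fin 4 → Fin 4 → Fin 4 → Fin 4 → Fin 4 → ℝ,
      ∑ a, ∑ b, ∑ c, ∑ d, ∑ e, ∑ f, X e f a b c d
        = ∑ e, ∑ f, ∑ a, ∑ b, ∑ c, ∑ d, X e f a b c d := by
    intro X
    rw [← sum_push4 (fun e a b c d => ∑ f, X e f a b c d)]
    exact Finset.sum_congr rfl fun e _ => (sum_push4 _).symm
  conv_rhs => simp only [Finset.mul_sum]
  rw [e1]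
  refine Finset.sum_congr rfl fun e _ => Finset.sum_congr rfl fun f _ => ?_
  simp only [Finset.sum_mul]
  simp only [Finset.mul_sum]
  exact Finset.sum_congr rfl fun a _ => Finset.sum_congr rfl fun b _ =>
    Finset.sum_congr rfl fun c _ => Finset.sum_congr rfl fun d _ => by ring

/-! ## Divergence in the left-invariant frame -/

/-- The action of four matrices on the slots of a four-tensor. -/
def slots (P Q R S : Matrix (Fin 4) (Fin 4) ℝ) (t : Fin 4 → Fin 4 → Fin 4 → Fin 4 → ℝ)
    (i j k l : Fin 4) : ℝ :=
  ∑ a, ∑ b, ∑ c, ∑ d, P a i * Q b j * R c k * S d l * t a b c d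

section slots

variable (P Q R S C B : Matrix (Fin 4) (Fin 4) ℝ) (t : Fin 4 → Fin 4 → Fin 4 → Fin 4 → ℝ)
  (i j k l : Fin 4)

lemma slots_sub_first : slots (P - B) Q R S t i j k l
    = slots P Q R S t i j k l - slots B Q R S t i j k l := by
  simp only [slots, Matrix.sub_apply, sub_mul, Finset.sum_sub_distrib]

lemma slots_sub_second : slots P (Q - B) R S t i j k l
    = slots P Q R S t i j k l - slots P B R S t i j k l := by
  simp only [slots, Matrix.sub_apply, sub_mul, mul_sub, Finset.sum_sub_distrib]

lemma slots_sub_third : slots P Q (R - B) S t i j k l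
    = slots P Q R S t i j k l - slots P Q B S t i j k l := by
  simp only [slots, Matrix.sub_apply, sub_mul, mul_sub, Finset.sum_sub_distrib]

lemma slots_sub_fourth : slots P Q R (S - B) t i j k l
    = slots P Q R S t i j k l - slots P Q R B t i j k l := by
  simp only [slots, Matrix.sub_apply, sub_mul, mul_sub, Finset.sum_sub_distrib]

/-- A factor on the coordinate side of Θ leaves the slot and acts on the tensor in coordinates, as a
Christoffel symbol does. A factor on the frame side, treated further below, acts on the frame
components, as a connection coefficient does. -/
lemma slots_mul_right_first : slots (P * C) Q R S t i j k l
    = ∑ p, C p i * slots P Q R S t p j k l := by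
  simp only [slots, Matrix.mul_apply, Finset.sum_mul, Finset.mul_sum]
  refine Eq.trans ?_ (sum_push4 _).symm
  exact Finset.sum_congr rfl fun a _ => Finset.sum_congr rfl fun b _ =>
    Finset.sum_congr rfl fun c _ => Finset.sum_congr rfl fun d _ =>
      Finset.sum_congr rfl fun e _ => by ring

lemma slots_mul_right_second : slots P (Q * C) R S t i j k l
    = ∑ p, C p j * slots P Q R S t i p k l := by
  simp only [slots, Matrix.mul_apply, Finset.sum_mul, Finset.mul_sum]
  refine Eq.trans ?_ (sum_push4 _).symm
  exact Finset.sum_congr rfl fun a _ => Finset.sum_congr rfl fun b _ =>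
    Finset.sum_congr rfl fun c _ => Finset.sum_congr rfl fun d _ =>
      Finset.sum_congr rfl fun e _ => by ring

lemma slots_mul_right_third : slots P Q (R * C) S t i j k l
    = ∑ p, C p k * slots P Q R S t i j p l := by
  simp only [slots, Matrix.mul_apply, Finset.sum_mul, Finset.mul_sum]
  refine Eq.trans ?_ (sum_push4 _).symm
  exact Finset.sum_congr rfl fun a _ => Finset.sum_congr rfl fun b _ =>
    Finset.sum_congr rfl fun c _ => Finset.sum_congr rfl fun d _ =>
      Finset.sum_congr rfl fun e _ => by ring

lemma slots_mul_right_fourth : slots P Q R (S * C) t i j k l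
    = ∑ p, C p l * slots P Q R S t i j k p := by
  simp only [slots, Matrix.mul_apply, Finset.sum_mul, Finset.mul_sum]
  refine Eq.trans ?_ (sum_push4 _).symm
  exact Finset.sum_congr rfl fun a _ => Finset.sum_congr rfl fun b _ =>
    Finset.sum_congr rfl fun c _ => Finset.sum_congr rfl fun d _ =>
      Finset.sum_congr rfl fun e _ => by ring

lemma slots_mul_left_first : slots (B * P) Q R S t i j k l
    = slots P Q R S (fun a b c d => ∑ p, B p a * t p b c d) i j k l := by
  simp only [slots, Matrix.mul_apply, Finset.sum_mul, Finset.mul_sum]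
  rw [sum_swap5]
  exact Finset.sum_congr rfl fun a _ => Finset.sum_congr rfl fun b _ =>
    Finset.sum_congr rfl fun c _ => Finset.sum_congr rfl fun d _ =>
      Finset.sum_congr rfl fun e _ => by ring

lemma slots_mul_left_second : slots P (B * Q) R S t i j k l
    = slots P Q R S (fun a b c d => ∑ p, B p b * t a p c d) i j k l := by
  simp only [slots, Matrix.mul_apply, Finset.sum_mul, Finset.mul_sum]
  refine Finset.sum_congr rfl fun a _ => ?_
  rw [sum_swap4]
  exact Finset.sum_congr rfl fun b _ => Finset.sum_congr rfl fun c _ =>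
    Finset.sum_congr rfl fun d _ => Finset.sum_congr rfl fun e _ => by ring

lemma slots_mul_left_third : slots P Q (B * R) S t i j k l
    = slots P Q R S (fun a b c d => ∑ p, B p c * t a b p d) i j k l := by
  simp only [slots, Matrix.mul_apply, Finset.sum_mul, Finset.mul_sum]
  refine Finset.sum_congr rfl fun a _ => Finset.sum_congr rfl fun b _ => ?_
  rw [sum_swap3]
  exact Finset.sum_congr rfl fun c _ => Finset.sum_congr rfl fun d _ =>
    Finset.sum_congr rfl fun e _ => by ring

lemma slots_mul_left_fourth : slots P Q R (B * S) t i j k l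
    = slots P Q R S (fun a b c d => ∑ p, B p d * t a b c p) i j k l := by
  simp only [slots, Matrix.mul_apply, Finset.sum_mul, Finset.mul_sum]
  refine Finset.sum_congr rfl fun a _ => Finset.sum_congr rfl fun b _ =>
    Finset.sum_congr rfl fun c _ => ?_
  rw [Finset.sum_comm]
  exact Finset.sum_congr rfl fun d _ => Finset.sum_congr rfl fun e _ => by ring

end slots

lemma pd_lift4 {t : ℝ → Fin 4 → Fin 4 → Fin 4 → Fin 4 → ℝ}
    {t' : Fin 4 → Fin 4 → Fin 4 → Fin 4 → ℝ} {x : E4} (hx : x ≠ 0)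
    (ht : ∀ a b c d, HasDerivAt (fun z => t z a b c d) (t' a b c d) (zc x)) (m i j k l : Fin 4) :
    pd m (lift4 t i j k l) x =
      slots (pdM m coframe x) (coframe x) (coframe x) (coframe x) (t (zc x)) i j k l
      + slots (coframe x) (pdM m coframe x) (coframe x) (coframe x) (t (zc x)) i j k l
      + slots (coframe x) (coframe x) (pdM m coframe x) (coframe x) (t (zc x)) i j k l
      + slots (coframe x) (coframe x) (coframe x) (pdM m coframe x) (t (zc x)) i j k l
      + coframe x 0 m * pull4 (coframe x) t' i j k l := by
  have hΘ := diffM_coframe hx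
  have hd : ∀ a b c d, DifferentiableAt ℝ (fun y => t (zc y) a b c d) x := fun a b c d =>
    differentiableAt_comp_zc hx (ht a b c d).differentiableAt
  have d1 : ∀ a b, DifferentiableAt ℝ (fun y => coframe y a i * coframe y b j) x := fun a b =>
    (hΘ a i).mul (hΘ b j)
  have d2 : ∀ a b c, DifferentiableAt ℝ
      (fun y => coframe y a i * coframe y b j * coframe y c k) x := fun a b c =>
    (d1 a b).mul (hΘ c k)
  have d3 : ∀ a b c d, DifferentiableAt ℝ
      (fun y => coframe y a i * coframe y b j * coframe y c k * coframe y d l) x :=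
    fun a b c d => (d2 a b c).mul (hΘ d l)
  have d4 : ∀ a b c d, DifferentiableAt ℝ (fun y => coframe y a i * coframe y b j * coframe y c k
      * coframe y d l * t (zc y) a b c d) x := fun a b c d => (d3 a b c d).mul (hd a b c d)
  have e : ∀ a b c d, pd m (fun y => coframe y a i * coframe y b j * coframe y c k
      * coframe y d l * t (zc y) a b c d) x
      = pdM m coframe x a i * coframe x b j * coframe x c k * coframe x d l * t (zc x) a b c d
      + coframe x a i * pdM m coframe x b j * coframe x c k * coframe x d l * t (zc x) a b c d
      + coframe x a i * coframe x b j * pdM m coframe x c k * coframe x d l * t (zc x) a b c d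
      + coframe x a i * coframe x b j * coframe x c k * pdM m coframe x d l * t (zc x) a b c d
      + coframe x 0 m * (coframe x a i * coframe x b j * coframe x c k * coframe x d l
        * t' a b c d) := by
    intro a b c d
    rw [pd_mul (d3 a b c d) (hd a b c d), pd_mul (d2 a b c) (hΘ d l), pd_mul (d1 a b) (hΘ c k),
      pd_mul (hΘ a i) (hΘ b j), pd_comp_zc hx m (ht a b c d)]
    simp only [pdM, Matrix.of_apply]
    ring
  have s : pd m (lift4 t i j k l) x = ∑ a, ∑ b, ∑ c, ∑ d, pd m (fun y => coframe y a i
      * coframe y b j * coframe y c k * coframe y d l * t (zc y) a b c d) x := by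
    unfold lift4 pull4
    have d5 : ∀ a b c, DifferentiableAt ℝ (fun y => ∑ d, coframe y a i
      * coframe y b j * coframe y c k * coframe y d l * t (zc y) a b c d) x := fun a b c =>
      DifferentiableAt.fun_sum fun d _ => d4 a b c d
    have d6 : ∀ a b, DifferentiableAt ℝ (fun y => ∑ c, ∑ d, coframe y a i
      * coframe y b j * coframe y c k * coframe y d l * t (zc y) a b c d) x := fun a b =>
      DifferentiableAt.fun_sum fun c _ => d5 a b c
    rw [pd_sum fun a _ => DifferentiableAt.fun_sum fun b _ => d6 a b]
    refine Finset.sum_congr rfl fun a _ => ?_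
    rw [pd_sum fun b _ => d6 a b]
    refine Finset.sum_congr rfl fun b _ => ?_
    rw [pd_sum fun c _ => d5 a b c]
    refine Finset.sum_congr rfl fun c _ => ?_
    rw [pd_sum fun d _ => d4 a b c d]
  rw [s]
  simp only [e, Finset.sum_add_distrib, slots, pull4, Finset.mul_sum]

/-- Frame components of the covariant derivative of a four-tensor. -/
def frameNabla (A : ℝ → Coeff) (t t' : ℝ → Fin 4 → Fin 4 → Fin 4 → Fin 4 → ℝ) (z : ℝ)
    (n a b c d : Fin 4) : ℝ :=
  (if n = 0 then t' z a b c d else 0) - ∑ p, (A z n p a * t z p b c d + A z n p b * t z a p c d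
    + A z n p c * t z a b p d + A z n p d * t z a b c p)

/-- Substituting ∂Θ = ΘΓ - AΘ in each slot, the Γ terms cancel the Christoffel corrections in ∇ and
the A terms become the frame correction. -/
lemma covDeriv_frameMetric (L : LeviCivita I h h' A A')
    {t t' : ℝ → Fin 4 → Fin 4 → Fin 4 → Fin 4 → ℝ}
    (ht : ∀ z ∈ I, ∀ a b c d, HasDerivAt (fun z => t z a b c d) (t' z a b c d) z)
    {T : Tensor4} (hT : ∀ x ∈ dom I, ∀ i j k l, T i j k l x = lift4 t i j k l x)
    {x : E4} (hx : x ∈ dom I) (m i j k l : Fin 4) :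
    covDeriv (frameMetric h) T m i j k l x
      = ∑ n, coframe x n m * pull4 (coframe x) (frameNabla A t t' (zc x) n) i j k l := by
  have hev : ∀ᶠ y in nhds x, y ∈ dom I := (isOpen_dom L.isOpen).mem_nhds hx
  have h1 : pd m (T i j k l) x = pd m (lift4 t i j k l) x :=
    pd_congr (hev.mono fun y hy => hT y hy i j k l)
  rw [covDeriv, h1, pd_lift4 hx.1 (ht _ hx.2), pdM_coframe_eq hx.1 A]
  rw [slots_sub_first, slots_sub_second, slots_sub_third, slots_sub_fourth,
    slots_mul_left_first _ _ _ _ (connA A m x), slots_mul_left_second _ _ _ _ (connA A m x), slots_mul_left_third _ _ _ _ (connA A m x), slots_mul_left_fourth _ _ _ _ (connA A m x),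
    slots_mul_right_first, slots_mul_right_second, slots_mul_right_third, slots_mul_right_fourth]
  simp only [christoffel_frameMetric L hx, hT x hx, Finset.sum_add_distrib]
  have h2 : ∀ n, pull4 (coframe x) (frameNabla A t t' (zc x) n) i j k l
      = (if n = 0 then pull4 (coframe x) (t' (zc x)) i j k l else 0)
        - pull4 (coframe x) (fun a b c d => ∑ p, (A (zc x) n p a * t (zc x) p b c d
          + A (zc x) n p b * t (zc x) a p c d + A (zc x) n p c * t (zc x) a b p d
          + A (zc x) n p d * t (zc x) a b c p)) i j k l := by
    intro n
    unfold frameNabla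
    rw [pull4_sub]
    congr 1
    split_ifs <;> simp [pull4]
  have h3 : ∀ (f : Fin 4 → Fin 4 → Fin 4 → Fin 4 → Fin 4 → ℝ),
      ∑ n, coframe x n m * pull4 (coframe x) (f n) i j k l
      = slots (coframe x) (coframe x) (coframe x) (coframe x)
        (fun a b c d => ∑ n, coframe x n m * f n a b c d) i j k l := by
    intro f
    simp only [pull4, slots, Finset.mul_sum]
    rw [sum_push4]
    exact Finset.sum_congr rfl fun a _ => Finset.sum_congr rfl fun b _ =>
      Finset.sum_congr rfl fun c _ => Finset.sum_congr rfl fun d _ =>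
        Finset.sum_congr rfl fun e _ => by ring
  simp only [h2, mul_sub, Finset.sum_sub_distrib]
  rw [h3]
  have h4 : ∀ a b c d, ∑ n, coframe x n m * ∑ p, (A (zc x) n p a * t (zc x) p b c d
          + A (zc x) n p b * t (zc x) a p c d + A (zc x) n p c * t (zc x) a b p d
          + A (zc x) n p d * t (zc x) a b c p)
      = ∑ p, connA A m x p a * t (zc x) p b c d + ∑ p, connA A m x p b * t (zc x) a p c d
        + ∑ p, connA A m x p c * t (zc x) a b p d + ∑ p, connA A m x p d * t (zc x) a b c p := by
    intro a b c d
    simp only [connA, Matrix.sum_apply, Matrix.smul_apply, smul_eq_mul, Finset.sum_mul,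
      Finset.mul_sum, ← Finset.sum_add_distrib]
    rw [Finset.sum_comm]
    exact Finset.sum_congr rfl fun p _ => Finset.sum_congr rfl fun n _ => by ring
  simp only [h4]
  have h5 : ∀ (f g u v : Fin 4 → Fin 4 → Fin 4 → Fin 4 → ℝ),
      slots (coframe x) (coframe x) (coframe x) (coframe x)
        (fun a b c d => f a b c d + g a b c d + u a b c d + v a b c d) i j k l
      = slots (coframe x) (coframe x) (coframe x) (coframe x) f i j k l
      + slots (coframe x) (coframe x) (coframe x) (coframe x) g i j k l
      + slots (coframe x) (coframe x) (coframe x) (coframe x) u i j k l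
      + slots (coframe x) (coframe x) (coframe x) (coframe x) v i j k l := by
    intro f g u v
    simp only [slots, mul_add, Finset.sum_add_distrib]
  rw [h5]
  have h6 : ∀ i j k l, slots (coframe x) (coframe x) (coframe x) (coframe x) (t (zc x)) i j k l
      = lift4 t i j k l x := fun _ _ _ _ => rfl
  simp only [h6, mul_ite, mul_zero, Finset.sum_ite_eq', Finset.mem_univ, if_true]
  ring

/-- Frame components of the divergence of a four-tensor. -/
def frameDiv (h : ℝ → Fin 4 → ℝ) (A : ℝ → Coeff)
    (t t' : ℝ → Fin 4 → Fin 4 → Fin 4 → Fin 4 → ℝ) (z : ℝ) (b c d : Fin 4) : ℝ :=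
  ∑ a, (h z a)⁻¹ * frameNabla A t t' z a a b c d

lemma divergence_frameMetric (L : LeviCivita I h h' A A')
    {t t' : ℝ → Fin 4 → Fin 4 → Fin 4 → Fin 4 → ℝ}
    (ht : ∀ z ∈ I, ∀ a b c d, HasDerivAt (fun z => t z a b c d) (t' z a b c d) z)
    {T : Tensor4} (hT : ∀ x ∈ dom I, ∀ i j k l, T i j k l x = lift4 t i j k l x)
    {x : E4} (hx : x ∈ dom I) (j k l : Fin 4) :
    divergence (frameMetric h) T j k l x
      = pull3 (coframe x) (frameDiv h A t t' (zc x)) j k l := by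
  have h1 : ∀ m i, covDeriv (frameMetric h) T m i j k l x = ∑ n, ∑ a, coframe x n m
      * coframe x a i * pull3 (coframe x) (frameNabla A t t' (zc x) n a) j k l := by
    intro m i
    rw [covDeriv_frameMetric L ht hT hx]
    simp only [pull4, pull3, Finset.mul_sum]
    refine Finset.sum_congr rfl fun n _ => Finset.sum_congr rfl fun a _ =>
      Finset.sum_congr rfl fun b _ => Finset.sum_congr rfl fun c _ =>
      Finset.sum_congr rfl fun d _ => by ring
  simp only [divergence, h1]
  have h2 := sum_contract_inv hx.1 (L.ne _ hx.2) (Matrix.of fun n a =>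
    pull3 (coframe x) (frameNabla A t t' (zc x) n a) j k l)
  simp only [Matrix.of_apply] at h2
  rw [h2]
  simp only [pull3, frameDiv, Finset.mul_sum]
  rw [sum_push3]
  exact Finset.sum_congr rfl fun b _ => Finset.sum_congr rfl fun c _ =>
    Finset.sum_congr rfl fun d _ => Finset.sum_congr rfl fun a _ => by ring

/-- A one-sided inverse suffices: multiplying the row vector fP = 0 by Q returns f. Three-tensors
are handled one slot at a time. -/
lemma pull1_eq_zero {P Q : Matrix (Fin 4) (Fin 4) ℝ} (hPQ : P * Q = 1) {f : Fin 4 → ℝ}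
    (hf : ∀ j, ∑ b, P b j * f b = 0) (b : Fin 4) : f b = 0 := by
  have h1 : Matrix.vecMul f P = 0 := by
    ext j
    rw [Matrix.vecMul, dotProduct, Pi.zero_apply, ← hf j]
    exact Finset.sum_congr rfl fun b _ => mul_comm _ _
  have h2 : Matrix.vecMul (Matrix.vecMul f P) Q = f := by
    rw [Matrix.vecMul_vecMul, hPQ, Matrix.vecMul_one]
  rw [h1, Matrix.zero_vecMul] at h2
  rw [← h2]
  rfl

lemma pull3_eq_zero_iff {P Q : Matrix (Fin 4) (Fin 4) ℝ} (hPQ : P * Q = 1)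
    (t : Fin 4 → Fin 4 → Fin 4 → ℝ) :
    (∀ j k l, pull3 P t j k l = 0) ↔ ∀ b c d, t b c d = 0 := by
  constructor
  · intro h b c d
    refine pull1_eq_zero hPQ (f := fun d => t b c d) (fun l => ?_) d
    refine pull1_eq_zero hPQ (f := fun c => ∑ d, P d l * t b c d) (fun k => ?_) c
    refine pull1_eq_zero hPQ (f := fun b => ∑ c, P c k * ∑ d, P d l * t b c d) (fun j => ?_) b
    rw [← h j k l]
    simp only [pull3, Finset.mul_sum]
    exact Finset.sum_congr rfl fun b _ => Finset.sum_congr rfl fun c _ =>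
      Finset.sum_congr rfl fun d _ => by ring
  · intro h j k l
    simp [pull3, h]

lemma divergence_eq_zero_iff (L : LeviCivita I h h' A A')
    {t t' : ℝ → Fin 4 → Fin 4 → Fin 4 → Fin 4 → ℝ}
    (ht : ∀ z ∈ I, ∀ a b c d, HasDerivAt (fun z => t z a b c d) (t' z a b c d) z)
    {T : Tensor4} (hT : ∀ x ∈ dom I, ∀ i j k l, T i j k l x = lift4 t i j k l x) :
    (∀ x ∈ dom I, ∀ j k l, divergence (frameMetric h) T j k l x = 0)
      ↔ ∀ z ∈ I, ∀ b c d, frameDiv h A t t' z b c d = 0 := by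
  have h1 : ∀ x ∈ dom I, (∀ j k l, divergence (frameMetric h) T j k l x = 0) ↔
      ∀ b c d, frameDiv h A t t' (zc x) b c d = 0 := by
    intro x hx
    simp only [divergence_frameMetric L ht hT hx]
    exact pull3_eq_zero_iff (coframe_mul_frame hx.1) _
  constructor
  · intro H z hz
    obtain ⟨x, hx, rfl⟩ := exists_mem_dom hz
    exact (h1 x hx).1 (H x hx)
  · intro H x hx
    exact (h1 x hx).2 (H _ hx.2)

end

section

/-! ## The Levi-Civita connection of a `U(2)`-invariant metric

In the tables below `f` and `p` are the logarithmic derivatives of `F` and `C`, and `r`, `q` the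
derivatives of `f`, `p`. -/

/-- The logarithmic derivative. -/
def logd (F : ℝ → ℝ) (z : ℝ) : ℝ := deriv F z / F z

/-- The frame components of the metric. -/
def hdiag (F C : ℝ → ℝ) (z : ℝ) : Fin 4 → ℝ := ![C z / (4 * F z), C z * F z, C z, C z]

lemma metric_eq (F C : ℝ → ℝ) : metric F C = frameMetric (hdiag F C) := by
  ext x i j
  rw [frameMetric, lift2_apply]
  simp only [Fin.sum_univ_four]
  simp [metric, hdiag, coframe]
  ring

/-- The coefficients of the Levi-Civita connection. -/
def coeffTable (F f p : ℝ) : Coeff :=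
  ![!![(p - f) / 2, 0, 0, 0; 0, (p + f) / 2, 0, 0; 0, 0, p / 2, 0; 0, 0, 0, p / 2],
    !![0, -2 * F ^ 2 * (p + f), 0, 0; (p + f) / 2, 0, 0, 0; 0, 0, 0, F - 2; 0, 0, 2 - F, 0],
    !![0, 0, -2 * F * p, 0; 0, 0, 0, 1; p / 2, 0, 0, 0; 0, -F, 0, 0],
    !![0, 0, 0, -2 * F * p; 0, 0, -1, 0; 0, F, 0, 0; p / 2, 0, 0, 0]]

/-- The derivatives of `coeffTable`. -/
def coeffTable' (F f p q r : ℝ) : Coeff :=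
  ![!![(q - r) / 2, 0, 0, 0; 0, (q + r) / 2, 0, 0; 0, 0, q / 2, 0; 0, 0, 0, q / 2],
    !![0, -2 * F ^ 2 * (q + r) - 4 * F ^ 2 * f * (p + f), 0, 0; (q + r) / 2, 0, 0, 0;
      0, 0, 0, F * f; 0, 0, -(F * f), 0],
    !![0, 0, -2 * F * q - 2 * F * f * p, 0; 0, 0, 0, 0; q / 2, 0, 0, 0; 0, -(F * f), 0, 0],
    !![0, 0, 0, -2 * F * q - 2 * F * f * p; 0, 0, 0, 0; 0, F * f, 0, 0; q / 2, 0, 0, 0]]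

/-- The coefficients of the Levi-Civita connection, as functions of `z`. -/
def coeff (F C : ℝ → ℝ) (z : ℝ) : Coeff := coeffTable (F z) (logd F z) (logd C z)

/-- The derivatives of `coeff`. -/
def coeff' (F C : ℝ → ℝ) (z : ℝ) : Coeff :=
  coeffTable' (F z) (logd F z) (logd C z) (deriv (logd C) z) (deriv (logd F) z)

/-- The derivatives of `hdiag`. -/
def hdiag' (F C : ℝ → ℝ) (z : ℝ) : Fin 4 → ℝ :=
  ![C z / (4 * F z) * (logd C z - logd F z), C z * F z * (logd C z + logd F z),
    C z * logd C z, C z * logd C z]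

/-- A smooth positive function on an open set. -/
structure SmoothPos (I : Set ℝ) (F : ℝ → ℝ) : Prop where
  isOpen : IsOpen I
  smooth : ContDiffOn ℝ ∞ F I
  pos : ∀ z ∈ I, 0 < F z

namespace SmoothPos

variable {I : Set ℝ} {F : ℝ → ℝ}

lemma smooth_deriv (hF : SmoothPos I F) : ContDiffOn ℝ ∞ (deriv F) I :=
  hF.smooth.deriv_of_isOpen hF.isOpen (by simp)

lemma smooth_logd (hF : SmoothPos I F) : ContDiffOn ℝ ∞ (logd F) I :=
  hF.smooth_deriv.div hF.smooth fun z hz => (hF.pos z hz).ne'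

lemma _root_.ContDiffOn.hasDerivAt_of_isOpen {I : Set ℝ} {f : ℝ → ℝ} (hf : ContDiffOn ℝ ∞ f I)
    (hI : IsOpen I) {z : ℝ} (hz : z ∈ I) : HasDerivAt f (deriv f z) z :=
  ((hf.contDiffAt (hI.mem_nhds hz)).differentiableAt (by simp)).hasDerivAt

lemma hasDerivAt (hF : SmoothPos I F) {z : ℝ} (hz : z ∈ I) :
    HasDerivAt F (F z * logd F z) z := by
  have h := hF.smooth.hasDerivAt_of_isOpen hF.isOpen hz
  rwa [logd, mul_div_cancel₀ _ (hF.pos z hz).ne']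

lemma hasDerivAt_logd (hF : SmoothPos I F) {z : ℝ} (hz : z ∈ I) :
    HasDerivAt (logd F) (deriv (logd F) z) z :=
  hF.smooth_logd.hasDerivAt_of_isOpen hF.isOpen hz

lemma deriv_eq (hF : SmoothPos I F) {z : ℝ} (hz : z ∈ I) : deriv F z = F z * logd F z :=
  (hF.hasDerivAt hz).deriv

lemma deriv_deriv_eq (hF : SmoothPos I F) {z : ℝ} (hz : z ∈ I) :
    deriv (deriv F) z = F z * (deriv (logd F) z + logd F z ^ 2) := by
  have h : deriv F =ᶠ[nhds z] fun t => F t * logd F t :=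
    Filter.eventually_of_mem (hF.isOpen.mem_nhds hz) fun t ht => hF.deriv_eq ht
  rw [h.deriv_eq]
  exact ((hF.hasDerivAt hz).mul (hF.hasDerivAt_logd hz)).deriv.trans (by ring)

end SmoothPos

variable {I : Set ℝ} {F C : ℝ → ℝ}

/-- Together with the compatibility check in `leviCivita`, this certifies the table without deriving
it from the Koszul formula. -/
lemma torsionFree_coeffTable (F f p : ℝ) : TorsionFree (coeffTable F f p) := by
  intro a b c
  fin_cases a <;> fin_cases b <;> fin_cases c <;> simp [coeffTable, structConst] <;> ring

lemma hasDerivM_coeff (hF : SmoothPos I F) (hC : SmoothPos I C) {z : ℝ} (hz : z ∈ I)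
    (a : Fin 4) : HasDerivM (fun t => coeff F C t a) (coeff' F C z a) z := by
  have dF := hF.hasDerivAt hz
  have df := hF.hasDerivAt_logd hz
  have dp := hC.hasDerivAt_logd hz
  have e0 := (dp.sub df).div_const 2
  have e1 := (dp.add df).div_const 2
  have e2 := dp.div_const 2
  have e3 : HasDerivAt (fun t => -2 * F t ^ 2 * (logd C t + logd F t)) (-2 * F z ^ 2
      * (deriv (logd C) z + deriv (logd F) z)
      - 4 * F z ^ 2 * logd F z * (logd C z + logd F z)) z :=
    (((dF.pow 2).const_mul (-2)).mul (dp.add df)).congr_deriv (by simp; ring)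
  have e4 := dF.sub_const 2
  have e5 := dF.const_sub 2
  have e6 : HasDerivAt (fun t => -2 * F t * logd C t) (-2 * F z * deriv (logd C) z
      - 2 * F z * logd F z * logd C z) z :=
    ((dF.const_mul (-2)).mul dp).congr_deriv (by ring)
  have e7 := dF.neg
  have c0 := fun r : ℝ => hasDerivAt_const z r
  intro c b
  fin_cases a <;> fin_cases c <;> fin_cases b <;>
    first
      | exact c0 0 | exact c0 1 | exact c0 (-1) | exact e0 | exact e1 | exact e2 | exact e3
      | exact e4 | exact e5 | exact e6 | exact e7 | exact dF

lemma leviCivita (hF : SmoothPos I F) (hC : SmoothPos I C) :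
    LeviCivita I (hdiag F C) (hdiag' F C) (coeff F C) (coeff' F C) where
  isOpen := hF.isOpen
  ne z hz a := by
    have h1 := (hF.pos z hz).ne'
    have h2 := (hC.pos z hz).ne'
    fin_cases a <;> simp [hdiag, h1, h2]
  hasDeriv z hz a := by
    have dF := hF.hasDerivAt hz
    have dC := hC.hasDerivAt hz
    have h1 := (hF.pos z hz).ne'
    have e0 : HasDerivAt (fun t => C t / (4 * F t))
        (C z / (4 * F z) * (logd C z - logd F z)) z :=
      (dC.div (dF.const_mul 4) (by simpa using h1)).congr_deriv (by field_simp)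
    have e1 : HasDerivAt (fun t => C t * F t) (C z * F z * (logd C z + logd F z)) z :=
      (dC.mul dF).congr_deriv (by ring)
    fin_cases a
    exacts [e0, e1, dC, dC]
  hasDeriv_coeff z hz a := hasDerivM_coeff hF hC hz a
  torsion z _ := torsionFree_coeffTable _ _ _
  compat z hz a b c := by
    have h1 := (hF.pos z hz).ne'
    fin_cases a <;> fin_cases b <;> fin_cases c <;>
      simp [coeff, coeffTable, hdiag, hdiag'] <;> field_simp <;> ring

/-! ## Curvature tables -/

/-- The curvature matrices. -/
def curvTable (F f p q r : ℝ) : Fin 4 → Fin 4 → Matrix (Fin 4) (Fin 4) ℝ :=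
  let m01 := !![0, -2 * F ^ 2 * (q + r + f * p + f ^ 2), 0, 0;
    (q + r + f * p + f ^ 2) / 2, 0, 0, 0; 0, 0, 0, F * f; 0, 0, -(F * f), 0]
  let m02 := !![0, 0, -F * (2 * q + f * p), 0; 0, 0, 0, f / 2;
    (2 * q + f * p) / 4, 0, 0, 0; 0, -(F * f) / 2, 0, 0]
  let m03 := !![0, 0, 0, -F * (2 * q + f * p); 0, 0, -f / 2, 0;
    0, F * f / 2, 0, 0; (2 * q + f * p) / 4, 0, 0, 0]
  let m12 := !![0, 0, 0, -2 * F ^ 2 * f; 0, 0, F * (1 - p ^ 2 - f * p), 0;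
    0, -F ^ 2 * (1 - p ^ 2 - f * p), 0, 0; F * f / 2, 0, 0, 0]
  let m13 := !![0, 0, 2 * F ^ 2 * f, 0; 0, 0, 0, F * (1 - p ^ 2 - f * p);
    -(F * f) / 2, 0, 0, 0; 0, -F ^ 2 * (1 - p ^ 2 - f * p), 0, 0]
  let m23 := !![0, 4 * F ^ 2 * f, 0, 0; -f, 0, 0, 0;
    0, 0, 0, 4 - 3 * F - F * p ^ 2; 0, 0, -(4 - 3 * F - F * p ^ 2), 0]
  ![![0, m01, m02, m03], ![-m01, 0, m12, m13], ![-m02, -m12, 0, m23], ![-m03, -m13, -m23, 0]]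

lemma structConst_swap (e a b : Fin 4) : structConst e b a = -structConst e a b := by
  fin_cases e <;> fin_cases a <;> fin_cases b <;> simp [structConst]

lemma curvMat_swap (A A' : ℝ → Coeff) (z : ℝ) (a b : Fin 4) :
    curvMat A A' z b a = -curvMat A A' z a b := by
  simp only [curvMat, structConst_swap _ a b, neg_smul, Finset.sum_neg_distrib]
  abel

lemma curvMat_self (A A' : ℝ → Coeff) (z : ℝ) (a : Fin 4) : curvMat A A' z a a = 0 := by
  ext d c
  have h := congrFun (congrFun (curvMat_swap A A' z a a) d) c
  rw [Matrix.neg_apply] at h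
  rw [Matrix.zero_apply]
  linarith

end

/-! ### Verification of the curvature tables -/

section

set_option linter.unusedSimpArgs false

section curvature

variable {A A' : ℝ → Coeff} {z F f p q r : ℝ}

lemma curvMat_zero (hA : A z = coeffTable F f p) (hA' : A' z = coeffTable' F f p q r) (b : Fin 4) :
    curvMat A A' z 0 b = curvTable F f p q r 0 b := by
  by_cases hb : b = 0
  · subst hb
    rw [curvMat_self]
    rfl
  ext d c
  rw [curvMat, hA, hA']
  simp only [if_true, if_neg hb, sub_zero, Fin.sum_univ_four, Matrix.sub_apply, Matrix.add_apply,
    Matrix.smul_apply, Matrix.mul_apply]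
  fin_cases b
  · exact absurd rfl hb
  all_goals fin_cases d <;> fin_cases c <;>
    simp only [coeffTable, coeffTable', curvTable, structConst, Matrix.of_apply, Matrix.cons_val, Matrix.cons_val_zero,
      Matrix.cons_val_one, Fin.isValue, Fin.zero_eta, Fin.mk_one, Fin.reduceFinMk, Pi.zero_apply,
      Matrix.neg_apply, Matrix.zero_apply, Matrix.diagonal_apply, Fin.reduceEq, ↓reduceIte] <;> ring

/-- For directions tangent to S³ no z-derivative enters, so the curvature is algebraic in the
connection table. -/
lemma curvMat_spatial (hA : A z = coeffTable F f p) {a b : Fin 4} (ha : a ≠ 0) (hb : b ≠ 0) :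
    curvMat A A' z a b = -∑ e, structConst e a b • coeffTable F f p e
      + (coeffTable F f p a * coeffTable F f p b - coeffTable F f p b * coeffTable F f p a) := by
  rw [curvMat, hA]
  simp [ha, hb]

lemma curvTable_swap (a b : Fin 4) : curvTable F f p q r b a = -curvTable F f p q r a b := by
  fin_cases a <;> fin_cases b <;> simp [curvTable]

lemma curvTable_self (a : Fin 4) : curvTable F f p q r a a = 0 := by
  fin_cases a <;> simp [curvTable]

/-- Antisymmetry in the two directions leaves the pairs containing ∂_z and the three tangential
pairs. -/
lemma curvMat_eq (hA : A z = coeffTable F f p) (hA' : A' z = coeffTable' F f p q r)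
    (a b : Fin 4) : curvMat A A' z a b = curvTable F f p q r a b := by
  have h12 : curvMat A A' z 1 2 = curvTable F f p q r 1 2 := by
    rw [curvMat_spatial hA (by decide) (by decide)]
    ext d c
    simp only [Fin.sum_univ_four, Matrix.sub_apply, Matrix.add_apply, Matrix.neg_apply,
      Matrix.smul_apply, Matrix.mul_apply]
    fin_cases d <;> fin_cases c <;>
      simp only [coeffTable, curvTable, structConst, Matrix.of_apply, Matrix.cons_val, Matrix.cons_val_zero,
      Matrix.cons_val_one, Fin.isValue, Fin.zero_eta, Fin.mk_one, Fin.reduceFinMk, Pi.zero_apply,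
      Matrix.neg_apply, Matrix.zero_apply, Matrix.diagonal_apply, Fin.reduceEq, ↓reduceIte] <;> ring
  have h13 : curvMat A A' z 1 3 = curvTable F f p q r 1 3 := by
    rw [curvMat_spatial hA (by decide) (by decide)]
    ext d c
    simp only [Fin.sum_univ_four, Matrix.sub_apply, Matrix.add_apply, Matrix.neg_apply,
      Matrix.smul_apply, Matrix.mul_apply]
    fin_cases d <;> fin_cases c <;>
      simp only [coeffTable, curvTable, structConst, Matrix.of_apply, Matrix.cons_val, Matrix.cons_val_zero,
      Matrix.cons_val_one, Fin.isValue, Fin.zero_eta, Fin.mk_one, Fin.reduceFinMk, Pi.zero_apply,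
      Matrix.neg_apply, Matrix.zero_apply, Matrix.diagonal_apply, Fin.reduceEq, ↓reduceIte] <;> ring
  have h23 : curvMat A A' z 2 3 = curvTable F f p q r 2 3 := by
    rw [curvMat_spatial hA (by decide) (by decide)]
    ext d c
    simp only [Fin.sum_univ_four, Matrix.sub_apply, Matrix.add_apply, Matrix.neg_apply,
      Matrix.smul_apply, Matrix.mul_apply]
    fin_cases d <;> fin_cases c <;>
      simp only [coeffTable, curvTable, structConst, Matrix.of_apply, Matrix.cons_val, Matrix.cons_val_zero,
      Matrix.cons_val_one, Fin.isValue, Fin.zero_eta, Fin.mk_one, Fin.reduceFinMk, Pi.zero_apply,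
      Matrix.neg_apply, Matrix.zero_apply, Matrix.diagonal_apply, Fin.reduceEq, ↓reduceIte] <;> ring
  have h0 := curvMat_zero hA hA'
  have hs : ∀ {a b}, curvMat A A' z a b = curvTable F f p q r a b →
      curvMat A A' z b a = curvTable F f p q r b a := fun {a b} h => by
    rw [curvMat_swap A A' z a b, h, curvTable_swap a b]
  have hd : ∀ a, curvMat A A' z a a = curvTable F f p q r a a := fun a => by
    rw [curvMat_self, curvTable_self]
  fin_cases a <;> fin_cases b
  exacts [h0 0, h0 1, h0 2, h0 3, hs (h0 1), hd 1, h12, h13, hs (h0 2), hs h12, hd 2, h23,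
    hs (h0 3), hs h13, hs h23, hd 3]

/-- The Ricci tensor. -/
def ricTable (F f p q r : ℝ) : Matrix (Fin 4) (Fin 4) ℝ :=
  Matrix.diagonal ![-(r + 3 * q + 2 * f * p + f ^ 2) / 2,
    2 * F ^ 2 * (1 - r - q - p ^ 2 - 2 * f * p - f ^ 2),
    4 - 2 * F * (1 + q + p ^ 2 + f * p), 4 - 2 * F * (1 + q + p ^ 2 + f * p)]

lemma frameRic_eq (hA : A z = coeffTable F f p) (hA' : A' z = coeffTable' F f p q r) :
    frameRic A A' z = ricTable F f p q r := by
  ext b c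
  simp only [frameRic, Matrix.of_apply, curvMat_eq hA hA', Fin.sum_univ_four]
  fin_cases b <;> fin_cases c <;>
    simp only [curvTable, ricTable, Matrix.of_apply, Matrix.cons_val, Matrix.cons_val_zero,
      Matrix.cons_val_one, Fin.isValue, Fin.zero_eta, Fin.mk_one, Fin.reduceFinMk, Pi.zero_apply,
      Matrix.neg_apply, Matrix.zero_apply, Matrix.diagonal_apply, Fin.reduceEq, ↓reduceIte] <;> ring

lemma frameScal_eq {h : ℝ → Fin 4 → ℝ} {C : ℝ} (hF : F ≠ 0) (hC : C ≠ 0)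
    (hh : h z = ![C / (4 * F), C * F, C, C])
    (hA : A z = coeffTable F f p) (hA' : A' z = coeffTable' F f p q r) :
    frameScal h A A' z = (8 - 2 * F - 4 * F * r - 12 * F * q - 12 * F * f * p - 4 * F * f ^ 2
      - 6 * F * p ^ 2) / C := by
  rw [frameScal, frameRic_eq hA hA', hh, Fin.sum_univ_four]
  simp [ricTable]
  field_simp
  ring

end curvature

end

section

set_option linter.unusedSimpArgs false

variable {A A' : ℝ → Coeff} {z F f p q r : ℝ}

/-! ## The Weyl tensor -/

/-- The normal form of a self-dual (`σ = 1`) or anti-self-dual (`σ = -1`) Weyl tensor. -/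
def weylTable (σ F : ℝ) : Fin 4 → Fin 4 → Matrix (Fin 4) (Fin 4) ℝ :=
  let m01 := !![0, 1 / 6, 0, 0; -1 / 6, 0, 0, 0; 0, 0, 0, σ / 3; 0, 0, -σ / 3, 0]
  let m02 := !![0, 0, -1 / (12 * F), 0; 0, 0, 0, σ / 6; 1 / (12 * F), 0, 0, 0; 0, -σ / 6, 0, 0]
  let m03 := !![0, 0, 0, -1 / (12 * F); 0, 0, -σ / 6, 0; 0, σ / 6, 0, 0; 1 / (12 * F), 0, 0, 0]
  let m12 := !![0, 0, 0, -σ / 6; 0, 0, -F / 3, 0; 0, F / 3, 0, 0; σ / 6, 0, 0, 0]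
  let m13 := !![0, 0, σ / 6, 0; 0, 0, 0, -F / 3; -σ / 6, 0, 0, 0; 0, F / 3, 0, 0]
  let m23 := !![0, σ / 3, 0, 0; -σ / 3, 0, 0, 0; 0, 0, 0, 2 / 3; 0, 0, -2 / 3, 0]
  ![![0, m01, m02, m03], ![-m01, 0, m12, m13], ![-m02, -m12, 0, m23], ![-m03, -m13, -m23, 0]]

lemma weylTable_swap (σ F : ℝ) (a b : Fin 4) : weylTable σ F b a = -weylTable σ F a b := by
  fin_cases a <;> fin_cases b <;> simp [weylTable]

lemma frameWeyl_swap (h : ℝ → Fin 4 → ℝ) (A A' : ℝ → Coeff) (z : ℝ) (a b c d : Fin 4) :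
    frameWeyl h A A' z b a c d = -frameWeyl h A A' z a b c d := by
  simp only [frameWeyl, frameRiem, curvMat_swap A A' z a b, Matrix.neg_apply]
  ring

/-- Here F(r + f²) is F'' and Ff is F', so the two coefficients are C(𝓛^±F - 1). The derivatives p,
q of log C cancel, as conformal invariance predicts. The same identity is checked below for the
other direction pairs. -/
lemma frameWeyl_01 {h : ℝ → Fin 4 → ℝ} {C : ℝ} (hF : F ≠ 0) (hC : C ≠ 0)
    (hh : h z = ![C / (4 * F), C * F, C, C])
    (hA : A z = coeffTable F f p) (hA' : A' z = coeffTable' F f p q r) (c d : Fin 4) :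
    frameWeyl h A A' z 0 1 c d
      = C * (F * (r + f ^ 2) / 2 - 3 / 2 * (F * f) + F - 1) * weylTable 1 F 0 1 c d
      + C * (F * (r + f ^ 2) / 2 + 3 / 2 * (F * f) + F - 1) * weylTable (-1) F 0 1 c d := by
  rw [frameWeyl, frameScal_eq hF hC hh hA hA', frameRic_eq hA hA', frameRiem,
    curvMat_eq hA hA', hh]
  fin_cases c <;> fin_cases d <;>
    simp only [curvTable, ricTable, weylTable, Matrix.of_apply, Matrix.cons_val, Matrix.cons_val_zero,
      Matrix.cons_val_one, Fin.isValue, Fin.zero_eta, Fin.mk_one, Fin.reduceFinMk, Pi.zero_apply,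
      Matrix.neg_apply, Matrix.zero_apply, Matrix.diagonal_apply, Fin.reduceEq, ↓reduceIte] <;>
    field_simp <;> ring

lemma frameWeyl_02 {h : ℝ → Fin 4 → ℝ} {C : ℝ} (hF : F ≠ 0) (hC : C ≠ 0)
    (hh : h z = ![C / (4 * F), C * F, C, C])
    (hA : A z = coeffTable F f p) (hA' : A' z = coeffTable' F f p q r) (c d : Fin 4) :
    frameWeyl h A A' z 0 2 c d
      = C * (F * (r + f ^ 2) / 2 - 3 / 2 * (F * f) + F - 1) * weylTable 1 F 0 2 c d
      + C * (F * (r + f ^ 2) / 2 + 3 / 2 * (F * f) + F - 1) * weylTable (-1) F 0 2 c d := by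
  rw [frameWeyl, frameScal_eq hF hC hh hA hA', frameRic_eq hA hA', frameRiem,
    curvMat_eq hA hA', hh]
  fin_cases c <;> fin_cases d <;>
    simp only [curvTable, ricTable, weylTable, Matrix.of_apply, Matrix.cons_val, Matrix.cons_val_zero,
      Matrix.cons_val_one, Fin.isValue, Fin.zero_eta, Fin.mk_one, Fin.reduceFinMk, Pi.zero_apply,
      Matrix.neg_apply, Matrix.zero_apply, Matrix.diagonal_apply, Fin.reduceEq, ↓reduceIte] <;>
    field_simp <;> ring

lemma frameWeyl_03 {h : ℝ → Fin 4 → ℝ} {C : ℝ} (hF : F ≠ 0) (hC : C ≠ 0)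
    (hh : h z = ![C / (4 * F), C * F, C, C])
    (hA : A z = coeffTable F f p) (hA' : A' z = coeffTable' F f p q r) (c d : Fin 4) :
    frameWeyl h A A' z 0 3 c d
      = C * (F * (r + f ^ 2) / 2 - 3 / 2 * (F * f) + F - 1) * weylTable 1 F 0 3 c d
      + C * (F * (r + f ^ 2) / 2 + 3 / 2 * (F * f) + F - 1) * weylTable (-1) F 0 3 c d := by
  rw [frameWeyl, frameScal_eq hF hC hh hA hA', frameRic_eq hA hA', frameRiem,
    curvMat_eq hA hA', hh]
  fin_cases c <;> fin_cases d <;>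
    simp only [curvTable, ricTable, weylTable, Matrix.of_apply, Matrix.cons_val, Matrix.cons_val_zero,
      Matrix.cons_val_one, Fin.isValue, Fin.zero_eta, Fin.mk_one, Fin.reduceFinMk, Pi.zero_apply,
      Matrix.neg_apply, Matrix.zero_apply, Matrix.diagonal_apply, Fin.reduceEq, ↓reduceIte] <;>
    field_simp <;> ring

lemma frameWeyl_12 {h : ℝ → Fin 4 → ℝ} {C : ℝ} (hF : F ≠ 0) (hC : C ≠ 0)
    (hh : h z = ![C / (4 * F), C * F, C, C])
    (hA : A z = coeffTable F f p) (hA' : A' z = coeffTable' F f p q r) (c d : Fin 4) :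
    frameWeyl h A A' z 1 2 c d
      = C * (F * (r + f ^ 2) / 2 - 3 / 2 * (F * f) + F - 1) * weylTable 1 F 1 2 c d
      + C * (F * (r + f ^ 2) / 2 + 3 / 2 * (F * f) + F - 1) * weylTable (-1) F 1 2 c d := by
  rw [frameWeyl, frameScal_eq hF hC hh hA hA', frameRic_eq hA hA', frameRiem,
    curvMat_eq hA hA', hh]
  fin_cases c <;> fin_cases d <;>
    simp only [curvTable, ricTable, weylTable, Matrix.of_apply, Matrix.cons_val, Matrix.cons_val_zero,
      Matrix.cons_val_one, Fin.isValue, Fin.zero_eta, Fin.mk_one, Fin.reduceFinMk, Pi.zero_apply,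
      Matrix.neg_apply, Matrix.zero_apply, Matrix.diagonal_apply, Fin.reduceEq, ↓reduceIte] <;>
    field_simp <;> ring

lemma frameWeyl_13 {h : ℝ → Fin 4 → ℝ} {C : ℝ} (hF : F ≠ 0) (hC : C ≠ 0)
    (hh : h z = ![C / (4 * F), C * F, C, C])
    (hA : A z = coeffTable F f p) (hA' : A' z = coeffTable' F f p q r) (c d : Fin 4) :
    frameWeyl h A A' z 1 3 c d
      = C * (F * (r + f ^ 2) / 2 - 3 / 2 * (F * f) + F - 1) * weylTable 1 F 1 3 c d
      + C * (F * (r + f ^ 2) / 2 + 3 / 2 * (F * f) + F - 1) * weylTable (-1) F 1 3 c d := by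
  rw [frameWeyl, frameScal_eq hF hC hh hA hA', frameRic_eq hA hA', frameRiem,
    curvMat_eq hA hA', hh]
  fin_cases c <;> fin_cases d <;>
    simp only [curvTable, ricTable, weylTable, Matrix.of_apply, Matrix.cons_val, Matrix.cons_val_zero,
      Matrix.cons_val_one, Fin.isValue, Fin.zero_eta, Fin.mk_one, Fin.reduceFinMk, Pi.zero_apply,
      Matrix.neg_apply, Matrix.zero_apply, Matrix.diagonal_apply, Fin.reduceEq, ↓reduceIte] <;>
    field_simp <;> ring

lemma frameWeyl_23 {h : ℝ → Fin 4 → ℝ} {C : ℝ} (hF : F ≠ 0) (hC : C ≠ 0)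
    (hh : h z = ![C / (4 * F), C * F, C, C])
    (hA : A z = coeffTable F f p) (hA' : A' z = coeffTable' F f p q r) (c d : Fin 4) :
    frameWeyl h A A' z 2 3 c d
      = C * (F * (r + f ^ 2) / 2 - 3 / 2 * (F * f) + F - 1) * weylTable 1 F 2 3 c d
      + C * (F * (r + f ^ 2) / 2 + 3 / 2 * (F * f) + F - 1) * weylTable (-1) F 2 3 c d := by
  rw [frameWeyl, frameScal_eq hF hC hh hA hA', frameRic_eq hA hA', frameRiem,
    curvMat_eq hA hA', hh]
  fin_cases c <;> fin_cases d <;>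
    simp only [curvTable, ricTable, weylTable, Matrix.of_apply, Matrix.cons_val, Matrix.cons_val_zero,
      Matrix.cons_val_one, Fin.isValue, Fin.zero_eta, Fin.mk_one, Fin.reduceFinMk, Pi.zero_apply,
      Matrix.neg_apply, Matrix.zero_apply, Matrix.diagonal_apply, Fin.reduceEq, ↓reduceIte] <;>
    field_simp <;> ring

end

section

set_option linter.unusedSimpArgs false

section weyl

variable {A A' : ℝ → Coeff} {z F f p q r : ℝ}

lemma weylTable_self (σ F : ℝ) (a : Fin 4) : weylTable σ F a a = 0 := by
  fin_cases a <;> simp [weylTable]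

lemma frameWeyl_eq {h : ℝ → Fin 4 → ℝ} {C : ℝ} (hF : F ≠ 0) (hC : C ≠ 0)
    (hh : h z = ![C / (4 * F), C * F, C, C])
    (hA : A z = coeffTable F f p) (hA' : A' z = coeffTable' F f p q r) (a b c d : Fin 4) :
    frameWeyl h A A' z a b c d
      = C * (F * (r + f ^ 2) / 2 - 3 / 2 * (F * f) + F - 1) * weylTable 1 F a b c d
      + C * (F * (r + f ^ 2) / 2 + 3 / 2 * (F * f) + F - 1) * weylTable (-1) F a b c d := by
  set X := C * (F * (r + f ^ 2) / 2 - 3 / 2 * (F * f) + F - 1)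
  set Y := C * (F * (r + f ^ 2) / 2 + 3 / 2 * (F * f) + F - 1)
  have hs : ∀ {a b}, frameWeyl h A A' z a b c d
        = X * weylTable 1 F a b c d + Y * weylTable (-1) F a b c d →
      frameWeyl h A A' z b a c d
        = X * weylTable 1 F b a c d + Y * weylTable (-1) F b a c d := fun {a b} e => by
    rw [frameWeyl_swap, e, weylTable_swap 1 F a b, weylTable_swap (-1) F a b, Matrix.neg_apply,
      Matrix.neg_apply]
    ring
  have hd : ∀ a, frameWeyl h A A' z a a c d
        = X * weylTable 1 F a a c d + Y * weylTable (-1) F a a c d := fun a => by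
    have e := frameWeyl_swap h A A' z a a c d
    rw [weylTable_self, weylTable_self, Matrix.zero_apply]
    linarith
  have h01 := frameWeyl_01 hF hC hh hA hA' c d
  have h02 := frameWeyl_02 hF hC hh hA hA' c d
  have h03 := frameWeyl_03 hF hC hh hA hA' c d
  have h12 := frameWeyl_12 hF hC hh hA hA' c d
  have h13 := frameWeyl_13 hF hC hh hA hA' c d
  have h23 := frameWeyl_23 hF hC hh hA hA' c d
  fin_cases a <;> fin_cases b
  exacts [hd 0, h01, h02, h03, hs h01, hd 1, h12, h13, hs h02, hs h12, hd 2, h23,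
    hs h03, hs h13, hs h23, hd 3]

end weyl

/-! ## The Hodge star in the frame -/

/-- The values of the permutation symbol. -/
def leviTable (a b c d : Fin 4) : ℤ :=
  Int.sign (((b : ℤ) - a) * (c - a) * (d - a) * (c - b) * (d - b) * (d - c))

/-- The determinant is taken over ℤ first, where comparison with the sign of the product of
differences is a finite check. -/
lemma levi_eq (a b c d : Fin 4) : levi a b c d = leviTable a b c d := by
  have h1 : levi a b c d = ((Matrix.det (Matrix.of fun i j : Fin 4 =>
      if (![a, b, c, d] : Fin 4 → Fin 4) i = j then (1 : ℤ) else 0) : ℤ) : ℝ) := by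
    rw [levi, ← eq_intCast (Int.castRingHom ℝ), RingHom.map_det]
    congr 1
    ext i j
    simp only [Matrix.of_apply, RingHom.mapMatrix_apply, Matrix.map_apply]
    split_ifs <;> simp
  have h2 : ∀ a b c d : Fin 4, Matrix.det (Matrix.of fun i j : Fin 4 =>
      if (![a, b, c, d] : Fin 4 → Fin 4) i = j then (1 : ℤ) else 0) = leviTable a b c d := by
    decide +kernel
  rw [h1, h2]

lemma leviTable_swap (a b c d : Fin 4) : leviTable b a c d = -leviTable a b c d := by
  revert a b c d
  decide +kernel

lemma frameStar_swap (h : ℝ → Fin 4 → ℝ) (t : ℝ → Fin 4 → Fin 4 → Fin 4 → Fin 4 → ℝ) (z : ℝ)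
    (a b c d : Fin 4) : frameStar h t z b a c d = -frameStar h t z a b c d := by
  simp only [frameStar, frameVol, levi_eq, leviTable_swap a b, Int.cast_neg, mul_neg, neg_mul,
    Finset.sum_neg_distrib]

/-- For a fixed pair (a, b) only the complementary pair (m, n), in its two orders, contributes. The
two terms agree by antisymmetry, which absorbs the factor 1/2. -/
lemma frameStar_pair {h : ℝ → Fin 4 → ℝ} {t : ℝ → Fin 4 → Fin 4 → Fin 4 → Fin 4 → ℝ} {z : ℝ}
    {c d : Fin 4} (ht : ∀ a b, t z b a c d = -t z a b c d) {a b m n : Fin 4} (hmn : m ≠ n)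
    (hab : ∀ e f, leviTable a b e f = if e = m ∧ f = n then leviTable a b m n else
      if e = n ∧ f = m then -leviTable a b m n else 0) :
    frameStar h t z a b c d
      = leviTable a b m n * (√(∏ e, h z e) * (h z m)⁻¹ * (h z n)⁻¹ * t z m n c d) := by
  have key : ∀ e f, frameVol h z a b e f * (h z e)⁻¹ * (h z f)⁻¹ * t z e f c d
      = (if e = m then if f = n then
          leviTable a b m n * (√(∏ e, h z e) * (h z m)⁻¹ * (h z n)⁻¹ * t z m n c d) else 0 else 0)
      + (if e = n then if f = m then
          leviTable a b m n * (√(∏ e, h z e) * (h z m)⁻¹ * (h z n)⁻¹ * t z m n c d)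
          else 0 else 0) := by
    intro e f
    rw [frameVol, levi_eq, hab]
    by_cases h1 : e = m
    · subst h1
      by_cases h2 : f = n
      · subst h2
        simp [hmn]
        ring
      · simp [h2, hmn]
    · by_cases h2 : e = n
      · subst h2
        by_cases h3 : f = m
        · subst h3
          simp [h1, ht f e]
          ring
        · simp [h1, h3]
      · simp [h1, h2]
  have single : ∀ (m n : Fin 4) (K : ℝ),
      ∑ e, ∑ f, (if e = m then if f = n then K else 0 else 0) = K := by
    intro m n K
    rw [Finset.sum_eq_single m (fun b _ hb => by simp [hb]) (by simp)]
    simp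
  rw [frameStar]
  simp only [key, Finset.sum_add_distrib, single]
  ring

/-- The factor C²/2 is the root of the product of the diagonal metric entries. With it, the table
for σ is an eigenvector of the star with eigenvalue σ; the three identities evaluate the star on the
pairs containing ∂_z. -/
lemma weylTable_star {σ F C : ℝ} (hσ : σ = 1 ∨ σ = -1) (hF : F ≠ 0) (hC : C ≠ 0) (c d : Fin 4) :
    C ^ 2 / 2 * C⁻¹ * C⁻¹ * weylTable σ F 2 3 c d = σ * weylTable σ F 0 1 c d ∧
    C ^ 2 / 2 * (C * F)⁻¹ * C⁻¹ * weylTable σ F 1 3 c d = -(σ * weylTable σ F 0 2 c d) ∧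
    C ^ 2 / 2 * (C * F)⁻¹ * C⁻¹ * weylTable σ F 1 2 c d = σ * weylTable σ F 0 3 c d := by
  rcases hσ with rfl | rfl <;> refine ⟨?_, ?_, ?_⟩ <;> fin_cases c <;> fin_cases d <;>
    simp only [weylTable, Matrix.of_apply, Matrix.cons_val, Matrix.cons_val_zero,
      Matrix.cons_val_one, Fin.isValue, Fin.zero_eta, Fin.mk_one, Fin.reduceFinMk, Pi.zero_apply,
      Matrix.neg_apply, Matrix.zero_apply, mul_zero, neg_zero] <;> field_simp <;> norm_num

lemma weylTable_star' {σ F C : ℝ} (hσ : σ = 1 ∨ σ = -1) (hF : F ≠ 0) (hC : C ≠ 0)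
    (c d : Fin 4) :
    C ^ 2 / 2 * (C / (4 * F))⁻¹ * (C * F)⁻¹ * weylTable σ F 0 1 c d = σ * weylTable σ F 2 3 c d ∧
    C ^ 2 / 2 * (C / (4 * F))⁻¹ * C⁻¹ * weylTable σ F 0 2 c d = -(σ * weylTable σ F 1 3 c d) ∧
    C ^ 2 / 2 * (C / (4 * F))⁻¹ * C⁻¹ * weylTable σ F 0 3 c d = σ * weylTable σ F 1 2 c d := by
  rcases hσ with rfl | rfl <;> refine ⟨?_, ?_, ?_⟩ <;> fin_cases c <;> fin_cases d <;>
    simp only [weylTable, Matrix.of_apply, Matrix.cons_val, Matrix.cons_val_zero,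
      Matrix.cons_val_one, Fin.isValue, Fin.zero_eta, Fin.mk_one, Fin.reduceFinMk, Pi.zero_apply,
      Matrix.neg_apply, Matrix.zero_apply, mul_zero, neg_zero] <;> field_simp <;> norm_num

lemma frameStar_weyl {h : ℝ → Fin 4 → ℝ} {t : ℝ → Fin 4 → Fin 4 → Fin 4 → Fin 4 → ℝ}
    {z F C X Y : ℝ} (hF : F ≠ 0) (hC : 0 < C) (hh : h z = ![C / (4 * F), C * F, C, C])
    (ht : ∀ a b c d, t z a b c d = X * weylTable 1 F a b c d + Y * weylTable (-1) F a b c d)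
    (a b c d : Fin 4) :
    frameStar h t z a b c d = X * weylTable 1 F a b c d - Y * weylTable (-1) F a b c d := by
  have hv : √(∏ e, h z e) = C ^ 2 / 2 := by
    rw [hh, Fin.prod_univ_four]
    simp only [Matrix.cons_val]
    -- F cancels from the product of the metric entries, leaving a perfect square; positivity of C
    -- then fixes the root.
    rw [show C / (4 * F) * (C * F) * C * C = (C ^ 2 / 2) ^ 2 by field_simp; norm_num]
    exact Real.sqrt_sq (by positivity)
  have hts : ∀ a b, t z b a c d = -t z a b c d := fun a b => by
    rw [ht, ht, weylTable_swap 1 F a b, weylTable_swap (-1) F a b, Matrix.neg_apply,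
      Matrix.neg_apply]
    ring
  have h0 : h z 0 = C / (4 * F) := by rw [hh]; rfl
  have h1 : h z 1 = C * F := by rw [hh]; rfl
  have h2 : h z 2 = C := by rw [hh]; rfl
  have h3 : h z 3 = C := by rw [hh]; rfl
  obtain ⟨p1, p2, p3⟩ := weylTable_star (Or.inl rfl) hF hC.ne' c d
  obtain ⟨p1', p2', p3'⟩ := weylTable_star' (Or.inl rfl) hF hC.ne' c d
  obtain ⟨m1, m2, m3⟩ := weylTable_star (Or.inr rfl) hF hC.ne' c d
  obtain ⟨m1', m2', m3'⟩ := weylTable_star' (Or.inr rfl) hF hC.ne' c d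
  have hs : ∀ {a b}, frameStar h t z a b c d
        = X * weylTable 1 F a b c d - Y * weylTable (-1) F a b c d →
      frameStar h t z b a c d
        = X * weylTable 1 F b a c d - Y * weylTable (-1) F b a c d := fun {a b} e => by
    rw [frameStar_swap, e, weylTable_swap 1 F a b, weylTable_swap (-1) F a b, Matrix.neg_apply,
      Matrix.neg_apply]
    ring
  have hd : ∀ a, frameStar h t z a a c d
        = X * weylTable 1 F a a c d - Y * weylTable (-1) F a a c d := fun a => by
    have e := frameStar_swap h t z a a c d
    rw [weylTable_self, weylTable_self, Matrix.zero_apply]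
    linarith
  have q01 : frameStar h t z 0 1 c d
      = X * weylTable 1 F 0 1 c d - Y * weylTable (-1) F 0 1 c d := by
    rw [frameStar_pair hts (m := 2) (n := 3) (by decide) (by decide +kernel), hv, h2, h3, ht,
      show leviTable 0 1 2 3 = 1 by decide +kernel, Int.cast_one]
    linear_combination X * p1 + Y * m1
  have q02 : frameStar h t z 0 2 c d
      = X * weylTable 1 F 0 2 c d - Y * weylTable (-1) F 0 2 c d := by
    rw [frameStar_pair hts (m := 1) (n := 3) (by decide) (by decide +kernel), hv, h1, h3, ht,
      show leviTable 0 2 1 3 = -1 by decide +kernel, Int.cast_neg, Int.cast_one]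
    linear_combination -X * p2 - Y * m2
  have q03 : frameStar h t z 0 3 c d
      = X * weylTable 1 F 0 3 c d - Y * weylTable (-1) F 0 3 c d := by
    rw [frameStar_pair hts (m := 1) (n := 2) (by decide) (by decide +kernel), hv, h1, h2, ht,
      show leviTable 0 3 1 2 = 1 by decide +kernel, Int.cast_one]
    linear_combination X * p3 + Y * m3
  have q23 : frameStar h t z 2 3 c d
      = X * weylTable 1 F 2 3 c d - Y * weylTable (-1) F 2 3 c d := by
    rw [frameStar_pair hts (m := 0) (n := 1) (by decide) (by decide +kernel), hv, h0, h1, ht,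
      show leviTable 2 3 0 1 = 1 by decide +kernel, Int.cast_one]
    linear_combination X * p1' + Y * m1'
  have q13 : frameStar h t z 1 3 c d
      = X * weylTable 1 F 1 3 c d - Y * weylTable (-1) F 1 3 c d := by
    rw [frameStar_pair hts (m := 0) (n := 2) (by decide) (by decide +kernel), hv, h0, h2, ht,
      show leviTable 1 3 0 2 = -1 by decide +kernel, Int.cast_neg, Int.cast_one]
    linear_combination -X * p2' - Y * m2'
  have q12 : frameStar h t z 1 2 c d
      = X * weylTable 1 F 1 2 c d - Y * weylTable (-1) F 1 2 c d := by
    rw [frameStar_pair hts (m := 0) (n := 3) (by decide) (by decide +kernel), hv, h0, h3, ht,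
      show leviTable 1 2 0 3 = 1 by decide +kernel, Int.cast_one]
    linear_combination X * p3' + Y * m3'
  fin_cases a <;> fin_cases b
  exacts [hd 0, q01, q02, q03, hs q01, hd 1, q12, q13, hs q02, hs q12, hd 2, q23,
    hs q03, hs q13, hs q23, hd 3]

/-! ## The divergence of a half-Weyl tensor -/

/-- The derivative of `weylTable`. -/
def weylTable' (F f : ℝ) : Fin 4 → Fin 4 → Matrix (Fin 4) (Fin 4) ℝ :=
  let m02 := !![0, 0, f / (12 * F), 0; 0, 0, 0, 0; -f / (12 * F), 0, 0, 0; 0, 0, 0, 0]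
  let m03 := !![0, 0, 0, f / (12 * F); 0, 0, 0, 0; 0, 0, 0, 0; -f / (12 * F), 0, 0, 0]
  let m12 := !![0, 0, 0, 0; 0, 0, -(F * f) / 3, 0; 0, F * f / 3, 0, 0; 0, 0, 0, 0]
  let m13 := !![0, 0, 0, 0; 0, 0, 0, -(F * f) / 3; 0, 0, 0, 0; 0, F * f / 3, 0, 0]
  ![![0, 0, m02, m03], ![0, 0, m12, m13], ![-m02, -m12, 0, 0], ![-m03, -m13, 0, 0]]

lemma hasDerivAt_weylTable (σ : ℝ) {F : ℝ → ℝ} {f z : ℝ} (hF : HasDerivAt F (F z * f) z)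
    (hne : F z ≠ 0) (a b : Fin 4) :
    HasDerivM (fun t => weylTable σ (F t) a b) (weylTable' (F z) f a b) z := by
  have c0 := fun r : ℝ => hasDerivAt_const z r
  have e1 : HasDerivAt (fun t => -1 / (12 * F t)) (f / (12 * F z)) z :=
    ((c0 (-1)).div (hF.const_mul 12) (by simpa using hne)).congr_deriv (by field_simp; ring)
  have e2 : HasDerivAt (fun t => 1 / (12 * F t)) (-f / (12 * F z)) z :=
    ((c0 1).div (hF.const_mul 12) (by simpa using hne)).congr_deriv (by field_simp; ring)
  have e3 : HasDerivAt (fun t => F t / 3) (F z * f / 3) z := hF.div_const 3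
  have e4 : HasDerivAt (fun t => -F t / 3) (-(F z * f) / 3) z := hF.neg.div_const 3
  have h01 : HasDerivM (fun t => weylTable σ (F t) 0 1) (weylTable' (F z) f 0 1) z := by
    intro c d
    fin_cases c <;> fin_cases d <;> exact c0 _
  have h23 : HasDerivM (fun t => weylTable σ (F t) 2 3) (weylTable' (F z) f 2 3) z := by
    intro c d
    fin_cases c <;> fin_cases d <;> exact c0 _
  have h02 : HasDerivM (fun t => weylTable σ (F t) 0 2) (weylTable' (F z) f 0 2) z := by
    intro c d
    fin_cases c <;> fin_cases d <;> first | exact c0 _ | exact e1 | exact e2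
  have h03 : HasDerivM (fun t => weylTable σ (F t) 0 3) (weylTable' (F z) f 0 3) z := by
    intro c d
    fin_cases c <;> fin_cases d <;> first | exact c0 _ | exact e1 | exact e2
  have h12 : HasDerivM (fun t => weylTable σ (F t) 1 2) (weylTable' (F z) f 1 2) z := by
    intro c d
    fin_cases c <;> fin_cases d <;> first | exact c0 _ | exact e3 | exact e4
  have h13 : HasDerivM (fun t => weylTable σ (F t) 1 3) (weylTable' (F z) f 1 3) z := by
    intro c d
    fin_cases c <;> fin_cases d <;> first | exact c0 _ | exact e3 | exact e4
  have hw : ∀ a b, weylTable' (F z) f b a = -weylTable' (F z) f a b := by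
    intro a b
    fin_cases a <;> fin_cases b <;> simp [weylTable']
  have hs : ∀ {a b}, HasDerivM (fun t => weylTable σ (F t) a b) (weylTable' (F z) f a b) z →
      HasDerivM (fun t => weylTable σ (F t) b a) (weylTable' (F z) f b a) z := fun {a b} e c d => by
    rw [hw a b]
    simp only [weylTable_swap σ _ a b]
    exact (e c d).neg
  have hd : ∀ a, HasDerivM (fun t => weylTable σ (F t) a a) (weylTable' (F z) f a a) z := by
    intro a c d
    simp only [weylTable_self]
    fin_cases a <;> exact c0 _
  fin_cases a <;> fin_cases b
  exacts [hd 0, h01, h02, h03, hs h01, hd 1, h12, h13, hs h02, hs h12, hd 2, h23,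
    hs h03, hs h13, hs h23, hd 3]

/-- The divergence of a half-Weyl tensor, up to a factor. -/
def divTable (σ F : ℝ) : Fin 4 → Matrix (Fin 4) (Fin 4) ℝ :=
  ![0, !![0, 2 * F / 3, 0, 0; -2 * F / 3, 0, 0, 0; 0, 0, 0, σ * 4 * F / 3; 0, 0, -σ * 4 * F / 3, 0],
    !![0, 0, -1 / 3, 0; 0, 0, 0, σ * 2 * F / 3; 1 / 3, 0, 0, 0; 0, -σ * 2 * F / 3, 0, 0],
    !![0, 0, 0, -1 / 3; 0, 0, -σ * 2 * F / 3, 0; 0, σ * 2 * F / 3, 0, 0; 1 / 3, 0, 0, 0]]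

end

/-! ### Half-Weyl tensors, their divergence, and the scalar curvature -/

section

set_option linter.unusedSimpArgs false

-- The central calculation. The half-Weyl tensor is Cm times `weylTable`, where p = C'/C and f =
-- F'/F. Every component of its divergence carries the same scalar, m times the logarithmic
-- derivative of e^{3σz/2} m √C wherever m ≠ 0.
set_option maxHeartbeats 4000000 in
lemma divTable_eq {σ C F f p m m' : ℝ} (hσ : σ = 1 ∨ σ = -1) (hF : F ≠ 0) (hC : C ≠ 0)
    (b c d : Fin 4) :
    ∑ a, ((![C / (4 * F), C * F, C, C] : Fin 4 → ℝ) a)⁻¹ * ((if a = 0 then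
      C * (m' + p * m) * weylTable σ F 0 b c d + C * m * weylTable' F f 0 b c d else 0)
      - ∑ e, (coeffTable F f p a e a * (C * m * weylTable σ F e b c d)
        + coeffTable F f p a e b * (C * m * weylTable σ F a e c d)
        + coeffTable F f p a e c * (C * m * weylTable σ F a b e d)
        + coeffTable F f p a e d * (C * m * weylTable σ F a b c e)))
      = (m' + σ * (3 / 2) * m + p / 2 * m) * divTable σ F b c d := by
  simp only [Fin.sum_univ_four]
  rcases hσ with rfl | rfl <;> fin_cases b <;> fin_cases c <;> fin_cases d <;>
    simp only [coeffTable, weylTable, weylTable', divTable, Matrix.of_apply, Matrix.cons_val, Matrix.cons_val_zero,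
      Matrix.cons_val_one, Fin.isValue, Fin.zero_eta, Fin.mk_one, Fin.reduceFinMk, Pi.zero_apply,
      Matrix.neg_apply, Matrix.zero_apply, Fin.reduceEq, ↓reduceIte, mul_zero, zero_mul, add_zero, zero_add, sub_zero,
      neg_zero, zero_sub] <;> field_simp <;> ring

variable {I : Set ℝ} {F C : ℝ → ℝ}

/-- `𝓛⁺ F - 1` for `σ = 1` and `𝓛⁻ F - 1` for `σ = -1`. -/
def weylScalar (σ : ℝ) (F : ℝ → ℝ) (z : ℝ) : ℝ :=
  deriv (deriv F) z / 2 - σ * (3 / 2) * deriv F z + F z - 1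

/-- Frame components of the half-Weyl tensors. -/
def halfWeyl (σ : ℝ) (F C : ℝ → ℝ) (z : ℝ) (a b c d : Fin 4) : ℝ :=
  C z * weylScalar σ F z * weylTable σ (F z) a b c d

/-- The derivative of `halfWeyl`. -/
def halfWeyl' (σ : ℝ) (F C : ℝ → ℝ) (z : ℝ) (a b c d : Fin 4) : ℝ :=
  C z * (deriv (weylScalar σ F) z + logd C z * weylScalar σ F z) * weylTable σ (F z) a b c d
    + C z * weylScalar σ F z * weylTable' (F z) (logd F z) a b c d

lemma SmoothPos.smooth_weylScalar (hF : SmoothPos I F) (σ : ℝ) :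
    ContDiffOn ℝ ∞ (weylScalar σ F) I := by
  have h1 := hF.smooth_deriv
  have h2 : ContDiffOn ℝ ∞ (deriv (deriv F)) I := h1.deriv_of_isOpen hF.isOpen (by simp)
  exact (((h2.div_const 2).sub (contDiffOn_const.mul h1)).add hF.smooth).sub contDiffOn_const

lemma SmoothPos.hasDerivAt_weylScalar (hF : SmoothPos I F) (σ : ℝ) {z : ℝ} (hz : z ∈ I) :
    HasDerivAt (weylScalar σ F) (deriv (weylScalar σ F) z) z :=
  (hF.smooth_weylScalar σ).hasDerivAt_of_isOpen hF.isOpen hz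

lemma hasDerivAt_halfWeyl (hF : SmoothPos I F) (hC : SmoothPos I C) (σ : ℝ) {z : ℝ} (hz : z ∈ I)
    (a b c d : Fin 4) : HasDerivAt (fun t => halfWeyl σ F C t a b c d)
      (halfWeyl' σ F C z a b c d) z :=
  (((hC.hasDerivAt hz).mul (hF.hasDerivAt_weylScalar σ hz)).mul
    (hasDerivAt_weylTable σ (hF.hasDerivAt hz) (hF.pos z hz).ne' a b c d)).congr_deriv (by
      simp only [halfWeyl', Pi.mul_apply]; ring)

/-- The curvature scalars, expressed by logarithmic derivatives in the tables, are rewritten through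
F' and F''. -/
lemma frameWeyl_coeff (hF : SmoothPos I F) (hC : SmoothPos I C) {z : ℝ} (hz : z ∈ I)
    (a b c d : Fin 4) : frameWeyl (hdiag F C) (coeff F C) (coeff' F C) z a b c d
      = C z * weylScalar 1 F z * weylTable 1 (F z) a b c d
        + C z * weylScalar (-1) F z * weylTable (-1) (F z) a b c d := by
  rw [frameWeyl_eq (A := coeff F C) (A' := coeff' F C) (hF.pos z hz).ne' (hC.pos z hz).ne' rfl rfl rfl, weylScalar, weylScalar,
    hF.deriv_eq hz, hF.deriv_deriv_eq hz]
  ring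

lemma frameStar_coeff (hF : SmoothPos I F) (hC : SmoothPos I C) {z : ℝ} (hz : z ∈ I)
    (a b c d : Fin 4) : frameStar (hdiag F C) (frameWeyl (hdiag F C) (coeff F C) (coeff' F C)) z
      a b c d = C z * weylScalar 1 F z * weylTable 1 (F z) a b c d
        - C z * weylScalar (-1) F z * weylTable (-1) (F z) a b c d :=
  frameStar_weyl (hF.pos z hz).ne' (hC.pos z hz) rfl (frameWeyl_coeff hF hC hz) a b c d

lemma weylPlus_metric (hF : SmoothPos I F) (hC : SmoothPos I C) {x : E4} (hx : x ∈ dom I)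
    (i j k l : Fin 4) : weylPlus (metric F C) i j k l x = lift4 (halfWeyl 1 F C) i j k l x := by
  have L := leviCivita hF hC
  have hw := weyl_frameMetric L hx
  rw [metric_eq, weylPlus, star12_frameMetric hx.1 (L.ne _ hx.2) hw, hw, lift4, lift4, ← pull4_add,
    ← pull4_smul, lift4]
  congr 1
  ext a b c d
  rw [frameWeyl_coeff hF hC hx.2, frameStar_coeff hF hC hx.2, halfWeyl]
  ring

lemma weylMinus_metric (hF : SmoothPos I F) (hC : SmoothPos I C) {x : E4} (hx : x ∈ dom I)
    (i j k l : Fin 4) :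
    weylMinus (metric F C) i j k l x = lift4 (halfWeyl (-1) F C) i j k l x := by
  have L := leviCivita hF hC
  have hw := weyl_frameMetric L hx
  rw [metric_eq, weylMinus, star12_frameMetric hx.1 (L.ne _ hx.2) hw, hw, lift4, lift4,
    ← pull4_sub, ← pull4_smul, lift4]
  congr 1
  ext a b c d
  rw [frameWeyl_coeff hF hC hx.2, frameStar_coeff hF hC hx.2, halfWeyl]
  ring

lemma frameDiv_halfWeyl (hF : SmoothPos I F) (hC : SmoothPos I C) {σ : ℝ} (hσ : σ = 1 ∨ σ = -1)
    {z : ℝ} (hz : z ∈ I) (b c d : Fin 4) :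
    frameDiv (hdiag F C) (coeff F C) (halfWeyl σ F C) (halfWeyl' σ F C) z b c d
      = (deriv (weylScalar σ F) z + σ * (3 / 2) * weylScalar σ F z
        + logd C z / 2 * weylScalar σ F z) * divTable σ (F z) b c d := by
  rw [← divTable_eq (f := logd F z) hσ (hF.pos z hz).ne' (hC.pos z hz).ne']
  rw [frameDiv]
  refine Finset.sum_congr rfl fun a _ => ?_
  rw [frameNabla]
  congr 2
  by_cases ha : a = 0
  · subst ha
    simp [halfWeyl']
  · simp [ha]

lemma divergence_iff (hF : SmoothPos I F) (hC : SmoothPos I C) {σ : ℝ} (hσ : σ = 1 ∨ σ = -1)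
    {T : Tensor4} (hT : ∀ x ∈ dom I, ∀ i j k l, T i j k l x = lift4 (halfWeyl σ F C) i j k l x) :
    (∀ x ∈ dom I, ∀ j k l, divergence (metric F C) T j k l x = 0) ↔
      ∀ z ∈ I, deriv (weylScalar σ F) z + σ * (3 / 2) * weylScalar σ F z
        + logd C z / 2 * weylScalar σ F z = 0 := by
  rw [metric_eq, divergence_eq_zero_iff (leviCivita hF hC)
    (fun z hz => hasDerivAt_halfWeyl hF hC σ hz) hT]
  refine forall₂_congr fun z hz => ?_
  simp only [frameDiv_halfWeyl hF hC hσ hz]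
  constructor
  · intro H
    -- This entry of `divTable` is the nonzero constant 1/3, so one component already forces the
    -- scalar to vanish.
    have := H 2 2 0
    simpa [divTable] using this
  · intro H b c d
    rw [H, zero_mul]

/-- The scalar curvature of the metric. -/
def scalFun (F C : ℝ → ℝ) (z : ℝ) : ℝ :=
  (8 - 2 * F z - 4 * deriv (deriv F) z - 12 * F z * deriv (logd C) z
    - 12 * deriv F z * logd C z - 6 * F z * logd C z ^ 2) / C z

lemma scal_metric (hF : SmoothPos I F) (hC : SmoothPos I C) {x : E4} (hx : x ∈ dom I) :
    scal (metric F C) x = scalFun F C (zc x) := by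
  rw [metric_eq, scal_frameMetric (leviCivita hF hC) hx,
    frameScal_eq (A := coeff F C) (A' := coeff' F C) (hF.pos _ hx.2).ne' (hC.pos _ hx.2).ne' rfl rfl rfl, scalFun,
    hF.deriv_eq hx.2, hF.deriv_deriv_eq hx.2]
  congr 1
  ring

end

section

set_option linter.unusedSimpArgs false

variable {I : Set ℝ} {F C : ℝ → ℝ}

/-! ## The complex structure -/

/-- The complex structure in the frame. -/
def jTable (F : ℝ) : Matrix (Fin 4) (Fin 4) ℝ :=
  !![0, -2 * F, 0, 0; 1 / (2 * F), 0, 0, 0; 0, 0, 0, -1; 0, 0, 1, 0]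

/-- The derivative of `jTable`. -/
def jTable' (F f : ℝ) : Matrix (Fin 4) (Fin 4) ℝ :=
  !![0, -2 * (F * f), 0, 0; -f / (2 * F), 0, 0, 0; 0, 0, 0, 0; 0, 0, 0, 0]

/-- The Kähler form in the frame. -/
def kahlerTable (C : ℝ) : Matrix (Fin 4) (Fin 4) ℝ :=
  !![0, C / 2, 0, 0; -(C / 2), 0, 0, 0; 0, 0, 0, C; 0, 0, -C, 0]

lemma Jplus_eq (F : ℝ → ℝ) : Jplus F = liftEnd fun z => jTable (F z) := by
  ext x k i
  rw [liftEnd, Matrix.mul_apply]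
  simp only [Matrix.mul_apply, Fin.sum_univ_four]
  simp [Jplus, jTable, frame, coframe]
  ring

lemma hasDerivM_jTable {F : ℝ → ℝ} {f z : ℝ} (hF : HasDerivAt F (F z * f) z) (hne : F z ≠ 0) :
    HasDerivM (fun t => jTable (F t)) (jTable' (F z) f) z := by
  have c0 := fun r : ℝ => hasDerivAt_const z r
  have e1 : HasDerivAt (fun t => 1 / (2 * F t)) (-f / (2 * F z)) z :=
    ((c0 1).div (hF.const_mul 2) (by simpa using hne)).congr_deriv (by field_simp; ring)
  have e2 := hF.const_mul (-2)
  intro a b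
  fin_cases a <;> fin_cases b <;> first | exact c0 _ | exact e1 | exact e2

lemma hasDerivM_kahlerTable {C : ℝ → ℝ} {c z : ℝ} (hC : HasDerivAt C c z) :
    HasDerivM (fun t => kahlerTable (C t)) (kahlerTable c) z := by
  have c0 := fun r : ℝ => hasDerivAt_const z r
  have e1 := hC.div_const 2
  have e2 := e1.neg
  have e3 := hC.neg
  intro a b
  fin_cases a <;> fin_cases b <;> first | exact c0 _ | exact hC | exact e1 | exact e2 | exact e3

/-- A torsion-free connection with constant coefficients. -/
def flatCoeff : Coeff := fun a => Matrix.of fun c b => structConst c a b / 2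

/-- The Nijenhuis tensor and the exterior derivative can be computed with any torsion-free
connection. Half the bracket is the simplest choice and involves neither F nor C. -/
lemma torsionFree_flatCoeff : TorsionFree flatCoeff := by
  intro a b c
  simp only [flatCoeff, Matrix.of_apply, structConst_swap c a b]
  ring

lemma connA_apply_nabla (A : Coeff) (w w' : Matrix (Fin 4) (Fin 4) ℝ) (x : E4) (i : Fin 4) :
    coframe x 0 i • w' + connA (fun _ => A) i x * w - w * connA (fun _ => A) i x
      = connA (fun _ n => (if n = 0 then w' else 0) + A n * w - w * A n) i x := by
  simp only [connA, smul_add, smul_sub, Finset.sum_add_distrib, Finset.sum_sub_distrib,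
    Finset.sum_mul, Finset.mul_sum, Matrix.smul_mul, Matrix.mul_smul, smul_ite, smul_zero,
    Finset.sum_ite_eq', Finset.mem_univ, if_true]

lemma connA_apply_nabla' (A : Coeff) (w w' : Matrix (Fin 4) (Fin 4) ℝ) (x : E4) (i : Fin 4) :
    coframe x 0 i • w' - (connA (fun _ => A) i x).transpose * w - w * connA (fun _ => A) i x
      = connA (fun _ n => (if n = 0 then w' else 0) - (A n).transpose * w - w * A n) i x := by
  simp only [connA, smul_sub, Finset.sum_sub_distrib, Matrix.transpose_sum, Matrix.transpose_smul,
    Finset.sum_mul, Finset.mul_sum, Matrix.smul_mul, Matrix.mul_smul, smul_ite, smul_zero,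
    Finset.sum_ite_eq', Finset.mem_univ, if_true]

/-- Replacing the direction ∂ᵢ by J∂ᵢ amounts to applying the frame matrix of J to the direction
index of the coefficients. -/
lemma connA_liftEnd {x : E4} (hx : x ≠ 0) (w : ℝ → Matrix (Fin 4) (Fin 4) ℝ) (B : Coeff)
    (i : Fin 4) : ∑ l, liftEnd w x l i • connA (fun _ => B) l x
      = connA (fun _ a => ∑ n, w (zc x) n a • B n) i x := by
  have h1 : coframe x * liftEnd w x = w (zc x) * coframe x := by
    rw [liftEnd, ← mul_assoc, ← mul_assoc, coframe_mul_frame hx, one_mul]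
  have h2 : ∀ n, ∑ l, liftEnd w x l i * coframe x n l = ∑ a, coframe x a i * w (zc x) n a := by
    intro n
    have := congrFun (congrFun h1 n) i
    rw [Matrix.mul_apply, Matrix.mul_apply] at this
    calc _ = ∑ l, coframe x n l * liftEnd w x l i := Finset.sum_congr rfl fun l _ => mul_comm _ _
      _ = _ := by
        rw [this]
        exact Finset.sum_congr rfl fun l _ => mul_comm _ _
  simp only [connA, Finset.smul_sum, smul_smul]
  rw [Finset.sum_comm]
  simp only [← Finset.sum_smul, h2]
  rw [Finset.sum_comm]
  simp only [Finset.sum_smul]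

/-- The Nijenhuis tensor vanishes as soon as it does so in the frame. -/
lemma nijenhuis_liftEnd {w : ℝ → Matrix (Fin 4) (Fin 4) ℝ} {w' : Matrix (Fin 4) (Fin 4) ℝ}
    {A B : Coeff} {x : E4} (hx : x ≠ 0) (hw : HasDerivM w w' (zc x)) (hA : TorsionFree A)
    (hB : ∀ n, B n = (if n = 0 then w' else 0) + A n * w (zc x) - w (zc x) * A n)
    (hN : ∀ a b d, ∑ n, w (zc x) n a * B n d b - (w (zc x) * B a) d b
      = ∑ n, w (zc x) n b * B n d a - (w (zc x) * B b) d a) (i j k : Fin 4) :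
    nijenhuis (liftEnd w) i j k x = 0 := by
  set J := liftEnd w with hJ
  set Γ := fun i => conn (fun _ => A) i x with hΓ
  have hc : ∀ i j k, Γ i k j = Γ j k i := fun i j k => conn_symm hx hA i j k
  have hp : ∀ i, pdM i J x = frame x * connA (fun _ => B) i x * coframe x - Γ i * J x
      + J x * Γ i := by
    intro i
    rw [hJ, pdM_liftEnd (A := fun _ => A) hx hw, connA_apply_nabla]
    congr 5
    ext n
    rw [hB]
  have hpe : ∀ l k j, pd l (fun y => J y k j) x
      = (frame x * connA (fun _ => B) l x * coframe x) k j - ∑ m, Γ l k m * J x m j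
        + ∑ m, J x k m * Γ l m j := by
    intro l k j
    have := congrFun (congrFun (hp l) k) j
    rw [Matrix.add_apply, Matrix.sub_apply, Matrix.mul_apply (M := Γ l),
      Matrix.mul_apply (M := J x)] at this
    exact this
  -- These three identities use symmetry of Γ to cancel the Christoffel terms in the Nijenhuis
  -- tensor, so only covariant derivatives of J remain.
  have hs1 : ∀ i j, ∑ l, J x l i * ∑ m, Γ l k m * J x m j
      = ∑ l, J x l j * ∑ m, Γ l k m * J x m i := by
    intro i j
    simp only [Finset.mul_sum]
    rw [Finset.sum_comm]
    refine Finset.sum_congr rfl fun l _ => Finset.sum_congr rfl fun m _ => ?_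
    rw [hc m l]
    ring
  have hs2 : ∀ i j, ∑ l, J x l i * ∑ m, J x k m * Γ l m j
      = ∑ l, J x k l * ∑ m, Γ j l m * J x m i := by
    intro i j
    simp only [Finset.mul_sum]
    rw [Finset.sum_comm]
    refine Finset.sum_congr rfl fun l _ => Finset.sum_congr rfl fun m _ => ?_
    rw [hc m j]
    ring
  have hs3 : ∀ l, ∑ m, J x l m * Γ i m j = ∑ m, J x l m * Γ j m i := fun l =>
    Finset.sum_congr rfl fun m _ => by rw [hc i j]
  have hT : ∀ i j, ∑ l, J x l i * (frame x * connA (fun _ => B) l x * coframe x) k j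
      - ∑ l, J x k l * (frame x * connA (fun _ => B) i x * coframe x) l j
      = (frame x * connA (fun _ a => ∑ n, w (zc x) n a • B n - w (zc x) * B a) i x
        * coframe x) k j := by
    intro i j
    have e1 : connA (fun _ a => ∑ n, w (zc x) n a • B n - w (zc x) * B a) i x
        = ∑ l, J x l i • connA (fun _ => B) l x - w (zc x) * connA (fun _ => B) i x := by
      rw [hJ, connA_liftEnd hx]
      simp only [connA, smul_sub, Finset.sum_sub_distrib, Finset.mul_sum, Matrix.mul_smul]
    have e2 : J x * (frame x * connA (fun _ => B) i x * coframe x)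
        = frame x * (w (zc x) * connA (fun _ => B) i x) * coframe x := by
      calc _ = frame x * w (zc x) * (coframe x * frame x) * connA (fun _ => B) i x
            * coframe x := by rw [hJ, liftEnd]; noncomm_ring
        _ = _ := by rw [coframe_mul_frame hx]; noncomm_ring
    rw [← Matrix.mul_apply, e2, e1, mul_sub, sub_mul, Matrix.sub_apply]
    congr 1
    simp only [Finset.mul_sum, Finset.sum_mul, Matrix.sum_apply, Matrix.mul_smul, Matrix.smul_mul,
      Matrix.smul_apply, smul_eq_mul]
  have hT1 := hT i j
  have hT2 := hT j i
  have hM := frame_connA_coframe (fun _ a => ∑ n, w (zc x) n a • B n - w (zc x) * B a) i j k x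
  have hM' := frame_connA_coframe (fun _ a => ∑ n, w (zc x) n a • B n - w (zc x) * B a) j i k x
  have hE : (frame x * connA (fun _ a => ∑ n, w (zc x) n a • B n - w (zc x) * B a) i x
        * coframe x) k j = (frame x * connA (fun _ a => ∑ n, w (zc x) n a • B n
          - w (zc x) * B a) j x * coframe x) k i := by
    rw [hM, hM']
    refine Finset.sum_congr rfl fun c _ => ?_
    rw [Finset.sum_comm]
    refine Finset.sum_congr rfl fun b _ => Finset.sum_congr rfl fun a _ => ?_
    have := hN a b c
    simp only [Matrix.sub_apply, Matrix.sum_apply, Matrix.smul_apply, smul_eq_mul]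
    rw [this]
    ring
  rw [nijenhuis]
  simp only [hpe, mul_sub, mul_add, Finset.sum_sub_distrib, Finset.sum_add_distrib, hs1 i j,
    hs2 i j, hs2 j i, hs3]
  linarith

/-- The exterior derivative of a two-form in the frame. -/
lemma closed_lift2_iff {w : ℝ → Matrix (Fin 4) (Fin 4) ℝ} {w' : Matrix (Fin 4) (Fin 4) ℝ}
    {A B : Coeff} {x : E4} (hx : x ≠ 0) (hw : HasDerivM w w' (zc x)) (hA : TorsionFree A)
    (hanti : (w (zc x)).transpose = -w (zc x))
    (hB : ∀ n, B n = (if n = 0 then w' else 0) - (A n).transpose * w (zc x) - w (zc x) * A n) :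
    (∀ i j k, pd i (fun y => lift2 w y j k) x + pd j (fun y => lift2 w y k i) x
      + pd k (fun y => lift2 w y i j) x = 0) ↔
      ∀ a b c, B a b c + B b c a + B c a b = 0 := by
  set Γ := fun i => conn (fun _ => A) i x with hΓ
  have hc : ∀ i j k, Γ i k j = Γ j k i := fun i j k => conn_symm hx hA i j k
  have hM : ∀ i j, lift2 w x j i = -lift2 w x i j := by
    intro i j
    have : (lift2 w x).transpose = -lift2 w x := by
      simp only [lift2, Matrix.transpose_mul, Matrix.transpose_transpose, hanti]
      noncomm_ring
    exact congrFun (congrFun this i) j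
  have hp : ∀ i j k, pd i (fun y => lift2 w y j k) x
      = ∑ a, ∑ b, ∑ c, coframe x a i * coframe x b j * coframe x c k * B a b c
        + ∑ m, (Γ i m j * lift2 w x m k - Γ i m k * lift2 w x m j) := by
    intro i j k
    have h1 := congrFun (congrFun (pdM_lift2 (A := fun _ => A) hx hw i) j) k
    rw [connA_apply_nabla'] at h1
    have h2 : connA (fun _ n => (if n = 0 then w' else 0) - (A n).transpose * w (zc x)
        - w (zc x) * A n) i x = connA (fun _ => B) i x := by
      congr 1
      ext _ n
      rw [hB]
    rw [h2, Matrix.add_apply, Matrix.add_apply, congr_matrix_apply] at h1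
    refine h1.trans ?_
    rw [add_assoc]
    congr 1
    · rw [sum_push2 (fun a b c => coframe x a i * coframe x b j * coframe x c k * B a b c)]
      simp only [connA, Matrix.sum_apply, Finset.mul_sum, Matrix.smul_apply, smul_eq_mul]
      exact Finset.sum_congr rfl fun b _ => Finset.sum_congr rfl fun c _ =>
        Finset.sum_congr rfl fun a _ => by ring
    · rw [Matrix.mul_apply, Matrix.mul_apply, ← Finset.sum_add_distrib]
      refine Finset.sum_congr rfl fun m _ => ?_
      rw [hM m j, Matrix.transpose_apply]
      ring
  have hcyc : ∀ i j k, pd i (fun y => lift2 w y j k) x + pd j (fun y => lift2 w y k i) x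
      + pd k (fun y => lift2 w y i j) x
      = pull3 (coframe x) (fun a b c => B a b c + B b c a + B c a b) i j k := by
    intro i j k
    rw [hp, hp, hp]
    -- In the cyclic sum the Christoffel terms cancel in pairs by symmetry of Γ; the remaining
    -- cyclic sum of ∇ω is dω.
    have z1 : ∑ m, (Γ i m j * lift2 w x m k - Γ i m k * lift2 w x m j)
        + ∑ m, (Γ j m k * lift2 w x m i - Γ j m i * lift2 w x m k)
        + ∑ m, (Γ k m i * lift2 w x m j - Γ k m j * lift2 w x m i) = 0 := by
      rw [← Finset.sum_add_distrib, ← Finset.sum_add_distrib]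
      refine Finset.sum_eq_zero fun m _ => ?_
      rw [hc j i, hc k i, hc k j]
      ring
    have z2 : ∑ a, ∑ b, ∑ c, coframe x a j * coframe x b k * coframe x c i * B a b c
        = ∑ a, ∑ b, ∑ c, coframe x a i * coframe x b j * coframe x c k * B b c a := by
      rw [← sum_push2 (fun c a b => coframe x a j * coframe x b k * coframe x c i * B a b c)]
      exact Finset.sum_congr rfl fun a _ => Finset.sum_congr rfl fun b _ =>
        Finset.sum_congr rfl fun c _ => by ring
    have z3 : ∑ a, ∑ b, ∑ c, coframe x a k * coframe x b i * coframe x c j * B a b c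
        = ∑ a, ∑ b, ∑ c, coframe x a i * coframe x b j * coframe x c k * B c a b := by
      rw [sum_push2 (fun a b c => coframe x a k * coframe x b i * coframe x c j * B a b c)]
      exact Finset.sum_congr rfl fun a _ => Finset.sum_congr rfl fun b _ =>
        Finset.sum_congr rfl fun c _ => by ring
    rw [z2, z3]
    simp only [pull3, mul_add, Finset.sum_add_distrib]
    linarith
  simp only [hcyc]
  exact pull3_eq_zero_iff (coframe_mul_frame hx) _

end

/-! ### The Kähler condition and holomorphic vector fields -/

section

set_option linter.unusedSimpArgs false

variable {I : Set ℝ} {F C : ℝ → ℝ}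

lemma jTable_sq {F : ℝ} (hF : F ≠ 0) : jTable F * jTable F = -1 := by
  ext a b
  rw [Matrix.mul_apply, Fin.sum_univ_four, Matrix.neg_apply, Matrix.one_apply]
  fin_cases a <;> fin_cases b <;> simp [jTable] <;> field_simp

lemma jTable_diag {F C : ℝ} (hF : F ≠ 0) :
    (jTable F).transpose * Matrix.diagonal ![C / (4 * F), C * F, C, C] = kahlerTable C := by
  ext a b
  rw [Matrix.mul_diagonal, Matrix.transpose_apply]
  fin_cases a <;> fin_cases b <;> simp [jTable, kahlerTable] <;> field_simp <;> norm_num [mul_comm]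

lemma kahlerTable_jTable {F C : ℝ} (hF : F ≠ 0) :
    kahlerTable C * jTable F = Matrix.diagonal ![C / (4 * F), C * F, C, C] := by
  ext a b
  rw [Matrix.mul_apply, Fin.sum_univ_four]
  fin_cases a <;> fin_cases b <;> simp [jTable, kahlerTable] <;> field_simp <;> norm_num

lemma transpose_mul_frameMetric {x : E4} (hx : x ≠ 0) (w : ℝ → Matrix (Fin 4) (Fin 4) ℝ)
    (h : ℝ → Fin 4 → ℝ) : (liftEnd w x).transpose * frameMetric h x
      = lift2 (fun z => (w z).transpose * Matrix.diagonal (h z)) x := by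
  have hT : (frame x).transpose * (coframe x).transpose = 1 := by
    rw [← Matrix.transpose_mul, coframe_mul_frame hx, Matrix.transpose_one]
  simp only [liftEnd, frameMetric, lift2, Matrix.transpose_mul]
  calc _ = (coframe x).transpose * ((w (zc x)).transpose * (((frame x).transpose
        * (coframe x).transpose) * Matrix.diagonal (h (zc x)))) * coframe x := by noncomm_ring
    _ = _ := by rw [hT, one_mul]

lemma lift2_mul_liftEnd {x : E4} (hx : x ≠ 0) (v w : ℝ → Matrix (Fin 4) (Fin 4) ℝ) :
    lift2 v x * liftEnd w x = lift2 (fun z => v z * w z) x := by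
  simp only [liftEnd, lift2]
  calc _ = (coframe x).transpose * v (zc x) * (coframe x * frame x) * w (zc x) * coframe x := by
        noncomm_ring
    _ = _ := by rw [coframe_mul_frame hx]; noncomm_ring

lemma kahlerForm_metric {x : E4} (hx : x ≠ 0) (hF : F (zc x) ≠ 0) (i j : Fin 4) :
    kahlerForm (metric F C) (Jplus F) i j x = lift2 (fun z => kahlerTable (C z)) x i j := by
  have h := congrFun (congrFun (transpose_mul_frameMetric hx (fun z => jTable (F z))
    (hdiag F C)) i) j
  rw [← Jplus_eq, ← metric_eq, Matrix.mul_apply] at h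
  refine h.trans ?_
  simp only [lift2, hdiag, jTable_diag hF]

/-- Since dη¹ = -2 η²∧η³ and η²∧η³ is closed, dω = (c + C) dz∧η²∧η³, where c stands for C'. -/
lemma kahlerTable_closed_iff (C c : ℝ) {B : Coeff}
    (hB : ∀ n, B n = (if n = 0 then kahlerTable c else 0)
      - (flatCoeff n).transpose * kahlerTable C - kahlerTable C * flatCoeff n) :
    (∀ a b d, B a b d + B b d a + B d a b = 0) ↔ c = -C := by
  have hB' : ∀ n b d, B n b d = (if n = 0 then kahlerTable c b d else 0)
      - ∑ e, flatCoeff n e b * kahlerTable C e d - ∑ e, kahlerTable C b e * flatCoeff n e d := by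
    intro n b d
    rw [hB, Matrix.sub_apply, Matrix.sub_apply, Matrix.mul_apply, Matrix.mul_apply]
    congr 2
    split_ifs <;> rfl
  simp only [hB', Fin.sum_univ_four]
  constructor
  · intro H
    -- The component along dz∧η²∧η³ is the only one that is not identically zero.
    have := H 0 2 3
    simp only [flatCoeff, structConst, kahlerTable, Matrix.of_apply, Matrix.cons_val, Matrix.cons_val_zero,
      Matrix.cons_val_one, Fin.isValue, Fin.zero_eta, Fin.mk_one, Fin.reduceFinMk, Pi.zero_apply,
      Matrix.neg_apply, Matrix.zero_apply, Fin.reduceEq, ↓reduceIte] at this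
    linarith
  · rintro rfl a b d
    fin_cases a <;> fin_cases b <;> fin_cases d <;>
      simp only [flatCoeff, structConst, kahlerTable, Matrix.of_apply, Matrix.cons_val, Matrix.cons_val_zero,
      Matrix.cons_val_one, Fin.isValue, Fin.zero_eta, Fin.mk_one, Fin.reduceFinMk, Pi.zero_apply,
      Matrix.neg_apply, Matrix.zero_apply, Fin.reduceEq, ↓reduceIte] <;> ring

lemma jTable_integrable {F f : ℝ} (hF : F ≠ 0) {B : Coeff}
    (hB : ∀ n, B n = (if n = 0 then jTable' F f else 0) + flatCoeff n * jTable F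
      - jTable F * flatCoeff n) (a b d : Fin 4) :
    ∑ n, jTable F n a * B n d b - (jTable F * B a) d b
      = ∑ n, jTable F n b * B n d a - (jTable F * B b) d a := by
  have hB' : ∀ n b d, B n b d = (if n = 0 then jTable' F f b d else 0)
      + ∑ e, flatCoeff n b e * jTable F e d - ∑ e, jTable F b e * flatCoeff n e d := by
    intro n b d
    rw [hB, Matrix.sub_apply, Matrix.add_apply, Matrix.mul_apply, Matrix.mul_apply]
    congr 2
    split_ifs <;> rfl
  simp only [Matrix.mul_apply, hB', Fin.sum_univ_four]
  fin_cases a <;> fin_cases b <;> fin_cases d <;>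
    simp only [flatCoeff, structConst, jTable, jTable', Matrix.of_apply, Matrix.cons_val, Matrix.cons_val_zero,
      Matrix.cons_val_one, Fin.isValue, Fin.zero_eta, Fin.mk_one, Fin.reduceFinMk, Pi.zero_apply,
      Matrix.neg_apply, Matrix.zero_apply, Fin.reduceEq, ↓reduceIte, mul_zero, zero_mul, add_zero, zero_add, sub_zero,
      neg_zero, zero_sub] <;> field_simp <;> ring

/-- The algebraic conditions and integrability hold for all positive F and C; closedness of ω alone
restricts C. -/
lemma isKahler_iff (hF : SmoothPos I F) (hC : SmoothPos I C) :
    IsKahler (dom I) (metric F C) (Jplus F) ↔ ∀ z ∈ I, deriv C z = -C z := by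
  have hJ : ∀ x ∈ dom I, Jplus F x = liftEnd (fun z => jTable (F z)) x := fun x _ => by
    rw [Jplus_eq]
  have hclosed : ∀ x ∈ dom I, (∀ i j k, pd i (kahlerForm (metric F C) (Jplus F) j k) x
      + pd j (kahlerForm (metric F C) (Jplus F) k i) x
      + pd k (kahlerForm (metric F C) (Jplus F) i j) x = 0) ↔ deriv C (zc x) = -C (zc x) := by
    intro x hx
    have hev : ∀ᶠ y in nhds x, y ∈ dom I := (isOpen_dom hF.isOpen).mem_nhds hx
    have hp : ∀ i j k, pd i (kahlerForm (metric F C) (Jplus F) j k) x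
        = pd i (fun y => lift2 (fun z => kahlerTable (C z)) y j k) x := fun i j k =>
      pd_congr (hev.mono fun y hy => kahlerForm_metric hy.1 (hF.pos _ hy.2).ne' j k)
    simp only [hp]
    have hanti : (kahlerTable (C (zc x))).transpose = -kahlerTable (C (zc x)) := by
      ext a b
      fin_cases a <;> fin_cases b <;> simp [kahlerTable]
    rw [closed_lift2_iff hx.1 (hasDerivM_kahlerTable
      (hC.smooth.hasDerivAt_of_isOpen hC.isOpen hx.2)) torsionFree_flatCoeff hanti fun _ => rfl]
    exact kahlerTable_closed_iff _ _ fun _ => rfl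
  constructor
  · intro K z hz
    obtain ⟨x, hx, rfl⟩ := exists_mem_dom hz
    exact (hclosed x hx).1 (K.closed x hx)
  · intro H
    refine ⟨fun x hx => ?_, fun x hx => ?_, fun x hx i j k => ?_, fun x hx =>
      (hclosed x hx).2 (H _ hx.2)⟩
    · rw [hJ x hx, liftEnd]
      calc _ = frame x * jTable (F (zc x)) * (coframe x * frame x) * jTable (F (zc x))
            * coframe x := by noncomm_ring
        _ = frame x * (jTable (F (zc x)) * jTable (F (zc x))) * coframe x := by
            rw [coframe_mul_frame hx.1]; noncomm_ring
        _ = _ := by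
            rw [jTable_sq (hF.pos _ hx.2).ne', mul_neg, neg_mul, mul_one, frame_mul_coframe hx.1]
    · rw [hJ x hx, metric_eq, transpose_mul_frameMetric hx.1, lift2_mul_liftEnd hx.1]
      simp only [lift2, frameMetric, hdiag, jTable_diag (hF.pos _ hx.2).ne',
        kahlerTable_jTable (hF.pos _ hx.2).ne']
    · rw [Jplus_eq]
      have hne := (hF.pos _ hx.2).ne'
      exact nijenhuis_liftEnd hx.1 (hasDerivM_jTable (hF.hasDerivAt hx.2) hne)
        torsionFree_flatCoeff (fun _ => rfl) (jTable_integrable hne fun _ => rfl) i j k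

/-- The Lie derivative of the complex structure along a vector field `ξ(z) ∂_z`. -/
lemma lieDerivEnd_Jplus (hF : SmoothPos I F) {ξ : ℝ → ℝ} {ξ' : ℝ} {X : Fin 4 → E4 → ℝ} {x : E4}
    (hx : x ∈ dom I) (hX : ∀ y ∈ dom I, ∀ k, X k y = ξ (zc y) * frame y k 0)
    (hξ : HasDerivAt ξ ξ' (zc x)) (hξF : ξ' * F (zc x) = deriv F (zc x) * ξ (zc x))
    (k i : Fin 4) : lieDerivEnd X (Jplus F) k i x = 0 := by
  have hev : ∀ᶠ y in nhds x, y ∈ dom I := (isOpen_dom hF.isOpen).mem_nhds hx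
  have hne := (hF.pos _ hx.2).ne'
  rw [Jplus_eq]
  set J := liftEnd fun z => jTable (F z) with hJ
  set D := jTable' (F (zc x)) (logd F (zc x)) with hD
  -- ∂_z is the field x/2, so its Jacobian is half the identity. The resulting terms in the Lie
  -- derivative commute with J and cancel.
  have hdf : ∀ l k, dframe l k 0 = if k = l then 1 / 2 else 0 := by
    intro l k
    by_cases hkl : k = l <;> simp [dframe, frame, ez, hkl]
  have hpX : ∀ l k, pd l (X k) x = ξ' * coframe x 0 l * frame x k 0
      + ξ (zc x) * (if k = l then 1 / 2 else 0) := by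
    intro l k
    rw [pd_congr (hev.mono fun y hy => hX y hy k),
      pd_mul (differentiableAt_comp_zc hx.1 hξ.differentiableAt) (diffM_frame x k 0),
      pd_comp_zc hx.1 l hξ]
    have := congrFun (congrFun (pdM_frame l x) k) 0
    simp only [pdM, Matrix.of_apply] at this
    rw [this, hdf]
  have hz : ∀ l, connA (fun _ => (0 : Coeff)) l x = 0 := fun l => by simp [connA]
  have hpJ : ∀ l, pdM l J x = coframe x 0 l • (frame x * D * coframe x)
      + dframe l * coframe x * J x - J x * (dframe l * coframe x) := by
    intro l
    -- With zero coefficients the connection matrix is -dE Θ, so the formula becomes the plain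
    -- product rule for EwΘ.
    rw [hJ, pdM_liftEnd (A := fun _ => 0) hx.1 (hasDerivM_jTable (hF.hasDerivAt hx.2) hne),
      conn, hz]
    simp only [zero_mul, mul_zero, add_zero, sub_zero, zero_sub, Matrix.mul_smul, Matrix.smul_mul,
      neg_mul, mul_neg]
    abel
  have hE0 : ∑ l, frame x l 0 * coframe x 0 l = 1 := by
    have := congrFun (congrFun (coframe_mul_frame hx.1) 0) 0
    rw [Matrix.mul_apply, Matrix.one_apply_eq] at this
    rw [← this]
    exact Finset.sum_congr rfl fun l _ => mul_comm _ _
  have hED : ∑ l, frame x l 0 • dframe l = (1 / 2 : ℝ) • frame x := by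
    rw [sum_smul_dframe, ← frame_smul]
    rfl
  have hsum : ∑ l, frame x l 0 • pdM l J x = frame x * D * coframe x := by
    simp only [hpJ, smul_sub, smul_add, Finset.sum_sub_distrib, Finset.sum_add_distrib, smul_smul,
      ← Finset.sum_smul, hE0, one_smul]
    have e1 : ∑ l, frame x l 0 • (dframe l * coframe x * J x)
        = (∑ l, frame x l 0 • dframe l) * coframe x * J x := by
      simp only [Finset.sum_mul, Matrix.smul_mul]
    have e2 : ∑ l, frame x l 0 • (J x * (dframe l * coframe x))
        = J x * ((∑ l, frame x l 0 • dframe l) * coframe x) := by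
      simp only [Finset.sum_mul, Finset.mul_sum, Matrix.smul_mul, Matrix.mul_smul]
    rw [e1, e2, hED, Matrix.smul_mul, frame_mul_coframe hx.1]
    simp
  have h1 : ∑ l, X l x * pd l (fun y => J y k i) x
      = ξ (zc x) * (frame x * D * coframe x) k i := by
    rw [← hsum, Matrix.sum_apply, Finset.mul_sum]
    refine Finset.sum_congr rfl fun l _ => ?_
    rw [hX x hx, Matrix.smul_apply, pdM, Matrix.of_apply, smul_eq_mul, mul_assoc]
  have hCJ : coframe x * J x = jTable (F (zc x)) * coframe x := by
    simp only [hJ, liftEnd]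
    rw [← mul_assoc, ← mul_assoc, coframe_mul_frame hx.1, one_mul]
  have hJE : J x * frame x = frame x * jTable (F (zc x)) := by
    simp only [hJ, liftEnd]
    rw [mul_assoc, coframe_mul_frame hx.1, mul_one]
  have h2 : ∑ l, J x l i * pd l (X k) x
      = ξ' * frame x k 0 * (jTable (F (zc x)) * coframe x) 0 i + ξ (zc x) / 2 * J x k i := by
    rw [← hCJ, Matrix.mul_apply, Finset.mul_sum]
    simp only [hpX, mul_add, Finset.sum_add_distrib]
    congr 1
    · exact Finset.sum_congr rfl fun l _ => by ring
    · simp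
      ring
  have h3 : ∑ l, J x k l * pd i (X l) x
      = ξ' * coframe x 0 i * (frame x * jTable (F (zc x))) k 0 + ξ (zc x) / 2 * J x k i := by
    rw [← hJE, Matrix.mul_apply, Finset.mul_sum]
    simp only [hpX, mul_add, Finset.sum_add_distrib]
    congr 1
    · exact Finset.sum_congr rfl fun l _ => by ring
    · simp
      ring
  rw [lieDerivEnd, Finset.sum_add_distrib, Finset.sum_sub_distrib, h1, h2, h3]
  have hdF := hF.deriv_eq hx.2
  rw [hdF] at hξF
  -- The hypothesis says that ξ and F have proportional derivatives, that is, ξ/F has derivative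
  -- zero at this point. This is exactly what cancels the derivative of the F-dependent entries of
  -- J.
  have hξ2 : ξ' = logd F (zc x) * ξ (zc x) := by
    have : F (zc x) * (ξ' - logd F (zc x) * ξ (zc x)) = 0 := by linarith
    rcases mul_eq_zero.1 this with h | h
    · exact absurd h hne
    · linarith
  rw [Matrix.mul_apply, Matrix.mul_apply (M := jTable _), Matrix.mul_apply (N := jTable _), hξ2]
  simp only [Matrix.mul_apply, Fin.sum_univ_four, hD]
  simp only [jTable, jTable', Matrix.of_apply, Matrix.cons_val, Matrix.cons_val_zero,
      Matrix.cons_val_one, Fin.isValue, Fin.zero_eta, Fin.mk_one, Fin.reduceFinMk, Pi.zero_apply,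
      Matrix.neg_apply, Matrix.zero_apply]
  field_simp
  ring

/-- For a function of z the gradient points along ∂_z, scaled by the inverse 4F/C of g(∂_z, ∂_z). -/
lemma grad_metric (hF : SmoothPos I F) (hC : SmoothPos I C) {s : E4 → ℝ} {σ σ' : ℝ → ℝ}
    (hs : ∀ x ∈ dom I, s x = σ (zc x)) (hσ : ∀ z ∈ I, HasDerivAt σ (σ' z) z) {x : E4}
    (hx : x ∈ dom I) (k : Fin 4) :
    grad (metric F C) s k x = 4 * F (zc x) / C (zc x) * σ' (zc x) * frame x k 0 := by
  have hev : ∀ᶠ y in nhds x, y ∈ dom I := (isOpen_dom hF.isOpen).mem_nhds hx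
  have h1 : ∀ l, pd l s x = σ' (zc x) * coframe x 0 l := fun l => by
    rw [pd_congr (hev.mono fun y hy => hs y hy), pd_comp_zc hx.1 l (hσ _ hx.2)]
  have hT : (frame x).transpose * (coframe x).transpose = 1 := by
    rw [← Matrix.transpose_mul, coframe_mul_frame hx.1, Matrix.transpose_one]
  have h2 := inv_frameMetric (h := hdiag F C) hx.1 ((leviCivita hF hC).ne _ hx.2)
  have h3 : ((metric F C x)⁻¹ * (coframe x).transpose) k 0
      = frame x k 0 * (hdiag F C (zc x) 0)⁻¹ := by
    rw [metric_eq, h2, mul_assoc, hT, mul_one, Matrix.mul_diagonal]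
  rw [Matrix.mul_apply] at h3
  simp only [grad, h1]
  calc _ = σ' (zc x) * ∑ l, (metric F C x)⁻¹ k l * (coframe x).transpose l 0 := by
        rw [Finset.mul_sum]
        exact Finset.sum_congr rfl fun l _ => by rw [Matrix.transpose_apply]; ring
    _ = _ := by
        rw [h3, show hdiag F C (zc x) 0 = C (zc x) / (4 * F (zc x)) from rfl, inv_div]
        ring

end

section

variable {I : Set ℝ} {F C : ℝ → ℝ}

/-! ## Ordinary differential equations -/

/-- Connectedness of I passes from zero derivative to a single constant. All first integrals below
are obtained this way. -/
lemma exists_const_iff (hIo : IsOpen I) (hIc : I.OrdConnected) {u u' : ℝ → ℝ}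
    (hu : ∀ z ∈ I, HasDerivAt u (u' z) z) :
    (∃ κ : ℝ, ∀ z ∈ I, u z = κ) ↔ ∀ z ∈ I, u' z = 0 := by
  constructor
  · rintro ⟨κ, hκ⟩ z hz
    have h : u =ᶠ[nhds z] fun _ => κ := Filter.eventually_of_mem (hIo.mem_nhds hz) hκ
    exact (hu z hz).unique ((hasDerivAt_const z κ).congr_of_eventuallyEq h)
  · intro H
    rcases I.eq_empty_or_nonempty with rfl | ⟨z₀, hz₀⟩
    · exact ⟨0, fun z hz => absurd hz (Set.notMem_empty z)⟩
    · exact ⟨u z₀, fun z hz => hIo.is_const_of_deriv_eq_zero hIc.isPreconnected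
        (fun z hz => (hu z hz).differentiableAt.differentiableWithinAt)
        (fun z hz => by rw [(hu z hz).deriv, H z hz]; rfl) hz hz₀⟩

lemma hasDerivAt_exp_mul (c z : ℝ) :
    HasDerivAt (fun t => Real.exp (c * t)) (c * Real.exp (c * z)) z := by
  have h := ((hasDerivAt_id z).const_mul c).exp
  exact h.congr_deriv (by simp; ring)

lemma SmoothPos.hasDerivAt_sqrt (hC : SmoothPos I C) {z : ℝ} (hz : z ∈ I) :
    HasDerivAt (fun t => √(C t)) (√(C z) * (logd C z / 2)) z := by
  have hp := hC.pos z hz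
  refine ((hC.hasDerivAt hz).sqrt hp.ne').congr_deriv ?_
  have h1 := Real.sqrt_pos.2 hp
  have h2 := Real.mul_self_sqrt hp.le
  field_simp
  linear_combination (-logd C z) * h2

/-- The positive function e^{3σz/2} √C is an integrating factor, since √C has logarithmic derivative
C'/(2C). -/
lemma half_harmonic_iff (hIc : I.OrdConnected) (hF : SmoothPos I F) (hC : SmoothPos I C) (σ : ℝ) :
    (∀ z ∈ I, deriv (weylScalar σ F) z + σ * (3 / 2) * weylScalar σ F z
        + logd C z / 2 * weylScalar σ F z = 0) ↔
      ∃ κ : ℝ, ∀ z ∈ I, Real.exp (σ * (3 / 2) * z) * weylScalar σ F z * √(C z) = κ := by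
  rw [exists_const_iff hF.isOpen hIc (u' := fun z => Real.exp (σ * (3 / 2) * z) * √(C z)
    * (deriv (weylScalar σ F) z + σ * (3 / 2) * weylScalar σ F z
        + logd C z / 2 * weylScalar σ F z))]
  · refine forall₂_congr fun z hz => ?_
    have h1 := Real.sqrt_pos.2 (hC.pos z hz)
    have h2 := Real.exp_pos (σ * (3 / 2) * z)
    rw [mul_eq_zero_iff_left (by positivity)]
  · intro z hz
    exact (((hasDerivAt_exp_mul _ z).mul (hF.hasDerivAt_weylScalar σ hz)).mul
      (hC.hasDerivAt_sqrt hz)).congr_deriv (by simp only [Pi.mul_apply]; ring)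

lemma Lplus_eq (hF : SmoothPos I F) {z : ℝ} (hz : z ∈ I) :
    Lplus F z - 1 = weylScalar 1 F z := by
  have h1 := hF.smooth.hasDerivAt_of_isOpen hF.isOpen hz
  have h2 := hF.smooth_deriv.hasDerivAt_of_isOpen hF.isOpen hz
  have h3 : deriv (fun t => -deriv F t + F t) z = -deriv (deriv F) z + deriv F z :=
    (h2.neg.add h1).deriv
  rw [Lplus, weylScalar]
  simp only [h3]
  ring

lemma Lminus_eq (hF : SmoothPos I F) {z : ℝ} (hz : z ∈ I) :
    Lminus F z - 1 = weylScalar (-1) F z := by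
  have h1 := hF.smooth.hasDerivAt_of_isOpen hF.isOpen hz
  have h2 := hF.smooth_deriv.hasDerivAt_of_isOpen hF.isOpen hz
  have h3 : deriv (fun t => deriv F t + F t) z = deriv (deriv F) z + deriv F z :=
    (h2.add h1).deriv
  rw [Lminus, weylScalar]
  simp only [h3]
  ring

lemma forall_dom_iff {P : ℝ → Prop} : (∀ x ∈ dom I, P (zc x)) ↔ ∀ z ∈ I, P z := by
  constructor
  · intro H z hz
    obtain ⟨x, hx, rfl⟩ := exists_mem_dom hz
    exact H x hx
  · exact fun H x hx => H _ hx.2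

/-- Clearing the denominator C and multiplying by √C > 0 gives the equation. The terms with C' and
C'' assemble into 24(F(√C)')', because √C has logarithmic derivative C'/(2C). -/
lemma scalFun_eq_iff (hF : SmoothPos I F) (hC : SmoothPos I C) (s₀ : ℝ) {z : ℝ} (hz : z ∈ I) :
    scalFun F C z = s₀ ↔ 0 = s₀ * C z ^ (3 / 2 : ℝ)
        + 4 * C z ^ (1 / 2 : ℝ) * (deriv (deriv F) z + 1 / 2 * F z - 2)
        + 24 * deriv (fun t => F t * deriv (fun u => C u ^ (1 / 2 : ℝ)) t) z := by
  have hp := hC.pos z hz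
  have hw := Real.sqrt_pos.2 hp
  have hw2 := Real.mul_self_sqrt hp.le
  have e1 : (fun u => C u ^ (1 / 2 : ℝ)) = fun u => √(C u) := by
    ext u
    rw [Real.sqrt_eq_rpow]
  have e2 : C z ^ (3 / 2 : ℝ) = C z * √(C z) := by
    rw [show (3 / 2 : ℝ) = 1 + 1 / 2 by norm_num, Real.rpow_add hp, Real.rpow_one,
      Real.sqrt_eq_rpow]
  have e3 : (fun t => F t * deriv (fun u => √(C u)) t)
      =ᶠ[nhds z] fun t => F t * (√(C t) * (logd C t / 2)) :=
    Filter.eventually_of_mem (hF.isOpen.mem_nhds hz) fun t ht => by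
      simp only [(hC.hasDerivAt_sqrt ht).deriv]
  have e4 : deriv (fun t => F t * (√(C t) * (logd C t / 2))) z = √(C z) * (deriv F z
      * (logd C z / 2) + F z * (logd C z ^ 2 / 4 + deriv (logd C) z / 2)) := by
    refine ((hF.smooth.hasDerivAt_of_isOpen hF.isOpen hz).mul ((hC.hasDerivAt_sqrt hz).mul
      ((hC.hasDerivAt_logd hz).div_const 2))).deriv.trans ?_
    simp only [Pi.mul_apply]
    ring
  rw [e1, e3.deriv_eq, e4, e2, ← Real.sqrt_eq_rpow, scalFun, div_eq_iff hp.ne']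
  constructor
  · intro h
    linear_combination √(C z) * h
  · intro h
    have : √(C z) * (8 - 2 * F z - 4 * deriv (deriv F) z - 12 * F z * deriv (logd C) z
        - 12 * deriv F z * logd C z - 6 * F z * logd C z ^ 2 - s₀ * C z) = 0 := by
      linear_combination h
    rcases mul_eq_zero.1 this with h0 | h0
    · exact absurd h0 hw.ne'
    · linarith

/-! ### Exponential conformal factors and the explicit solutions for F -/

lemma deriv_eq_neg_iff (hIc : I.OrdConnected) (hC : SmoothPos I C) :
    (∀ z ∈ I, deriv C z = -C z) ↔ ∃ C₀ : ℝ, 0 < C₀ ∧ ∀ z ∈ I, C z = C₀ * Real.exp (-z) := by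
  have h1 := exists_const_iff hC.isOpen hIc (u := fun z => C z * Real.exp (1 * z))
    (u' := fun z => (deriv C z + C z) * Real.exp (1 * z)) fun z hz =>
      ((hC.smooth.hasDerivAt_of_isOpen hC.isOpen hz).mul (hasDerivAt_exp_mul 1 z)).congr_deriv
        (by ring)
  have h2 : (∀ z ∈ I, deriv C z = -C z) ↔ ∀ z ∈ I, (deriv C z + C z) * Real.exp (1 * z) = 0 := by
    refine forall₂_congr fun z _ => ?_
    rw [mul_eq_zero_iff_right (Real.exp_pos _).ne', eq_neg_iff_add_eq_zero]
  rw [h2, ← h1]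
  have h3 : ∀ κ z, C z * Real.exp (1 * z) = κ ↔ C z = κ * Real.exp (-z) := by
    intro κ z
    rw [one_mul, Real.exp_neg, ← div_eq_mul_inv, eq_div_iff (Real.exp_pos z).ne']
  simp only [h3]
  constructor
  · rintro ⟨κ, hκ⟩
    -- On an empty interval any positive constant serves; otherwise positivity of C at one point
    -- gives positivity of the constant.
    rcases I.eq_empty_or_nonempty with rfl | ⟨z₀, hz₀⟩
    · exact ⟨1, one_pos, fun z hz => absurd hz (Set.notMem_empty z)⟩
    · refine ⟨κ, ?_, hκ⟩
      have := hC.pos z₀ hz₀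
      rw [hκ z₀ hz₀] at this
      exact pos_of_mul_pos_left this (Real.exp_pos _).le
  · rintro ⟨κ, _, hκ⟩
    exact ⟨κ, hκ⟩

lemma logd_of_exp (hC : SmoothPos I C) {C₀ : ℝ} (h : ∀ z ∈ I, C z = C₀ * Real.exp (-z)) :
    (∀ z ∈ I, deriv C z = -C z) ∧ (∀ z ∈ I, logd C z = -1) ∧ ∀ z ∈ I, deriv (logd C) z = 0 := by
  have h1 : ∀ z ∈ I, deriv C z = -C z := by
    intro z hz
    have e : C =ᶠ[nhds z] fun t => C₀ * Real.exp (-1 * t) :=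
      Filter.eventually_of_mem (hC.isOpen.mem_nhds hz) fun t ht => by
        simp only [h t ht, neg_one_mul]
    rw [e.deriv_eq, ((hasDerivAt_exp_mul (-1) z).const_mul C₀).deriv, h z hz, neg_one_mul]
    ring_nf
  have h2 : ∀ z ∈ I, logd C z = -1 := fun z hz => by
    rw [logd, h1 z hz, neg_div, div_self (hC.pos z hz).ne']
  refine ⟨h1, h2, fun z hz => ?_⟩
  have e : logd C =ᶠ[nhds z] fun _ => -1 :=
    Filter.eventually_of_mem (hC.isOpen.mem_nhds hz) h2
  rw [e.deriv_eq, deriv_const]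

/-- Both operators fix the constant 1. The operator 𝓛⁺ kills e^z and e^{2z}, 𝓛⁻ kills e^{-z} and
e^{-2z}, so each scalar retains only the other two exponentials. -/
lemma derivs_of_exp_sum (hF : SmoothPos I F) {a b c d : ℝ}
    (h : ∀ z ∈ I, F z = 1 + a * Real.exp (-2 * z) + b * Real.exp (-1 * z) + c * Real.exp (1 * z)
      + d * Real.exp (2 * z)) {z : ℝ} (hz : z ∈ I) :
    weylScalar 1 F z = 6 * a * Real.exp (-2 * z) + 3 * b * Real.exp (-1 * z) ∧
    weylScalar (-1) F z = 3 * c * Real.exp (1 * z) + 6 * d * Real.exp (2 * z) := by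
  have key : ∀ (k a b c d z : ℝ), HasDerivAt (fun t => k + a * Real.exp (-2 * t)
      + b * Real.exp (-1 * t) + c * Real.exp (1 * t) + d * Real.exp (2 * t))
      (0 + (-2 * a) * Real.exp (-2 * z) + (-b) * Real.exp (-1 * z) + c * Real.exp (1 * z)
        + (2 * d) * Real.exp (2 * z)) z := fun k a b c d z =>
    (((((hasDerivAt_const z k).add ((hasDerivAt_exp_mul (-2) z).const_mul a)).add
      ((hasDerivAt_exp_mul (-1) z).const_mul b)).add ((hasDerivAt_exp_mul 1 z).const_mul c)).add
      ((hasDerivAt_exp_mul 2 z).const_mul d)).congr_deriv (by ring)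
  have deriv_eq : ∀ {f : ℝ → ℝ} {k a b c d : ℝ}, (∀ z ∈ I, f z = k + a * Real.exp (-2 * z)
      + b * Real.exp (-1 * z) + c * Real.exp (1 * z) + d * Real.exp (2 * z)) →
      ∀ z ∈ I, deriv f z = 0 + (-2 * a) * Real.exp (-2 * z) + (-b) * Real.exp (-1 * z)
        + c * Real.exp (1 * z) + (2 * d) * Real.exp (2 * z) := by
    intro f k a b c d hf z hz
    have e : f =ᶠ[nhds z] fun t => k + a * Real.exp (-2 * t) + b * Real.exp (-1 * t)
        + c * Real.exp (1 * t) + d * Real.exp (2 * t) :=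
      Filter.eventually_of_mem (hF.isOpen.mem_nhds hz) hf
    exact e.deriv_eq.trans (key k a b c d z).deriv
  have h1 := deriv_eq h
  have h2 := deriv_eq h1
  rw [weylScalar, weylScalar, h2 z hz, h1 z hz, h z hz]
  constructor <;> ring

/-- The equation is (D-1)(D-2)F = 2 + 2κe^{-z}, with particular solution 1 + (κ/3)e^{-z}. Its two
factors give first integrals from which F is found linearly. -/
lemma weylScalar_plus_iff (hIc : I.OrdConnected) (hF : SmoothPos I F) :
    (∃ κ : ℝ, ∀ z ∈ I, weylScalar 1 F z = κ * Real.exp (-z)) ↔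
      ∃ C₂ C₃ C₄ : ℝ, ∀ z ∈ I, F z = 1 + C₂ * Real.exp (-z) + C₃ * Real.exp z
          + 1 / 2 * C₄ * Real.exp (2 * z) := by
  constructor
  · rintro ⟨κ, hκ⟩
    have d1 := fun z (hz : z ∈ I) => hF.smooth.hasDerivAt_of_isOpen hF.isOpen hz
    have d2 := fun z (hz : z ∈ I) => hF.smooth_deriv.hasDerivAt_of_isOpen hF.isOpen hz
    have hk : ∀ z ∈ I, deriv (deriv F) z - 3 * deriv F z + 2 * F z - 2
        - 2 * κ * Real.exp (-1 * z) = 0 := by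
      intro z hz
      have := hκ z hz
      rw [weylScalar, ← neg_one_mul] at this
      linear_combination 2 * this
    -- With G = F - 1 - (κ/3)e^{-z}, the integrals are A = e^{-2z}(G' - G) and, next, B = e^{-z}(G'
    -- - 2G). Subtraction gives G = Ae^{2z} - Be^z, hence the constants chosen below.
    obtain ⟨A, hA⟩ := (exists_const_iff hF.isOpen hIc
      (u := fun z => Real.exp (-2 * z) * (deriv F z - F z + 1
        + 2 * (κ / 3) * Real.exp (-1 * z)))
      (u' := fun z => Real.exp (-2 * z) * (deriv (deriv F) z - 3 * deriv F z + 2 * F z - 2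
        - 2 * κ * Real.exp (-1 * z))) fun z hz =>
      ((hasDerivAt_exp_mul (-2) z).mul ((((d2 z hz).sub (d1 z hz)).add_const 1).add
        ((hasDerivAt_exp_mul (-1) z).const_mul (2 * (κ / 3))))).congr_deriv (by
          simp only [Pi.add_apply, Pi.sub_apply]; ring)).2 fun z hz => by
            rw [hk z hz, mul_zero]
    obtain ⟨B, hB⟩ := (exists_const_iff hF.isOpen hIc
      (u := fun z => Real.exp (-1 * z) * (deriv F z - 2 * F z + 2 + κ * Real.exp (-1 * z)))
      (u' := fun z => Real.exp (-1 * z) * (deriv (deriv F) z - 3 * deriv F z + 2 * F z - 2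
        - 2 * κ * Real.exp (-1 * z))) fun z hz =>
      ((hasDerivAt_exp_mul (-1) z).mul ((((d2 z hz).sub ((d1 z hz).const_mul 2)).add_const 2).add
        ((hasDerivAt_exp_mul (-1) z).const_mul κ))).congr_deriv (by
          simp only [Pi.add_apply, Pi.sub_apply]; ring)).2 fun z hz => by
            rw [hk z hz, mul_zero]
    refine ⟨κ / 3, -B, 2 * A, fun z hz => ?_⟩
    have h1 := hA z hz
    have h2 := hB z hz
    have i2 : Real.exp (2 * z) * Real.exp (-2 * z) = 1 := by
      rw [← Real.exp_add]; ring_nf; exact Real.exp_zero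
    have i1 : Real.exp z * Real.exp (-1 * z) = 1 := by
      rw [← Real.exp_add]; ring_nf; exact Real.exp_zero
    rw [← neg_one_mul z]
    linear_combination (-Real.exp (2 * z)) * h1 * (-1) + Real.exp z * h2 * (-1)
      - (deriv F z - F z + 1 + 2 * (κ / 3) * Real.exp (-1 * z)) * i2
      + (deriv F z - 2 * F z + 2 + κ * Real.exp (-1 * z)) * i1
  · rintro ⟨C₂, C₃, C₄, h⟩
    refine ⟨3 * C₂, fun z hz => ?_⟩
    have := (derivs_of_exp_sum hF (a := 0) (b := C₂) (c := C₃) (d := 1 / 2 * C₄)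
      (fun z hz => by rw [h z hz]; simp) hz).1
    rw [this, neg_one_mul]
    ring

/-- Here (D+1)(D+2)F = 2 + 2κe^{2z}, with particular solution 1 + (κ/6)e^{2z}; this is why the third
constant is κ/3. -/
lemma weylScalar_minus_iff (hIc : I.OrdConnected) (hF : SmoothPos I F) :
    (∃ κ : ℝ, ∀ z ∈ I, weylScalar (-1) F z = κ * Real.exp (2 * z)) ↔
      ∃ C₁ C₂ C₄ : ℝ, ∀ z ∈ I, F z = 1 + 1 / 2 * C₁ * Real.exp (-2 * z)
          + C₂ * Real.exp (-z) + 1 / 2 * C₄ * Real.exp (2 * z) := by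
  constructor
  · rintro ⟨κ, hκ⟩
    have d1 := fun z (hz : z ∈ I) => hF.smooth.hasDerivAt_of_isOpen hF.isOpen hz
    have d2 := fun z (hz : z ∈ I) => hF.smooth_deriv.hasDerivAt_of_isOpen hF.isOpen hz
    have hk : ∀ z ∈ I, deriv (deriv F) z + 3 * deriv F z + 2 * F z - 2
        - 2 * κ * Real.exp (2 * z) = 0 := by
      intro z hz
      have := hκ z hz
      rw [weylScalar] at this
      linear_combination 2 * this
    -- With G = F - 1 - (κ/6)e^{2z}, the integrals are A = e^{2z}(G' + G) and B = e^z(G' + 2G),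
    -- whence G = Be^{-z} - Ae^{-2z}.
    obtain ⟨A, hA⟩ := (exists_const_iff hF.isOpen hIc
      (u := fun z => Real.exp (2 * z) * (deriv F z + F z - 1 - κ / 2 * Real.exp (2 * z)))
      (u' := fun z => Real.exp (2 * z) * (deriv (deriv F) z + 3 * deriv F z + 2 * F z - 2
        - 2 * κ * Real.exp (2 * z))) fun z hz =>
      ((hasDerivAt_exp_mul 2 z).mul ((((d2 z hz).add (d1 z hz)).sub_const 1).sub
        ((hasDerivAt_exp_mul 2 z).const_mul (κ / 2)))).congr_deriv (by
          simp only [Pi.add_apply, Pi.sub_apply]; ring)).2 fun z hz => by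
            rw [hk z hz, mul_zero]
    obtain ⟨B, hB⟩ := (exists_const_iff hF.isOpen hIc
      (u := fun z => Real.exp (1 * z) * (deriv F z + 2 * F z - 2
        - 2 * (κ / 3) * Real.exp (2 * z)))
      (u' := fun z => Real.exp (1 * z) * (deriv (deriv F) z + 3 * deriv F z + 2 * F z - 2
        - 2 * κ * Real.exp (2 * z))) fun z hz =>
      ((hasDerivAt_exp_mul 1 z).mul ((((d2 z hz).add ((d1 z hz).const_mul 2)).sub_const 2).sub
        ((hasDerivAt_exp_mul 2 z).const_mul (2 * (κ / 3))))).congr_deriv (by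
          simp only [Pi.add_apply, Pi.sub_apply]; ring)).2 fun z hz => by
            rw [hk z hz, mul_zero]
    refine ⟨-2 * A, B, κ / 3, fun z hz => ?_⟩
    have h1 := hA z hz
    have h2 := hB z hz
    have i2 : Real.exp (-2 * z) * Real.exp (2 * z) = 1 := by
      rw [← Real.exp_add]; ring_nf; exact Real.exp_zero
    have i1 : Real.exp (-z) * Real.exp (1 * z) = 1 := by
      rw [← Real.exp_add]; ring_nf; exact Real.exp_zero
    linear_combination Real.exp (-z) * h2 - Real.exp (-2 * z) * h1
      - (deriv F z + 2 * F z - 2 - 2 * (κ / 3) * Real.exp (2 * z)) * i1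
      + (deriv F z + F z - 1 - κ / 2 * Real.exp (2 * z)) * i2
  · rintro ⟨C₁, C₂, C₄, h⟩
    refine ⟨3 * C₄, fun z hz => ?_⟩
    have := (derivs_of_exp_sum hF (a := 1 / 2 * C₁) (b := C₂) (c := 0) (d := 1 / 2 * C₄)
      (fun z hz => by rw [h z hz]; simp) hz).2
    rw [this]
    ring

/-- With C'/C = -1 the scalar curvature involves only F'' - 3F' + 2F - 2. This reflects the fact
that W⁺ of a Kähler surface is determined by its scalar curvature. -/
lemma scalFun_kahler (hC : SmoothPos I C) {C₀ : ℝ} (h : ∀ z ∈ I, C z = C₀ * Real.exp (-z))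
    {z : ℝ} (hz : z ∈ I) : scalFun F C z = -8 * weylScalar 1 F z / C z := by
  obtain ⟨-, h2, h3⟩ := logd_of_exp hC h
  rw [scalFun, h2 z hz, h3 z hz, weylScalar]
  congr 1
  ring

/-- Since √C is a multiple of e^{-z/2}, the integrating factor becomes an exponential. The resulting
rate 1/2 - 3σ/2 equals -1 for W⁺ and 2 for W⁻. -/
lemma half_harmonic_kahler (hC : SmoothPos I C) (hF : SmoothPos I F) (hIc : I.OrdConnected)
    {C₀ : ℝ} (h : ∀ z ∈ I, C z = C₀ * Real.exp (-z)) (σ : ℝ) :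
    (∀ z ∈ I, deriv (weylScalar σ F) z + σ * (3 / 2) * weylScalar σ F z
        + logd C z / 2 * weylScalar σ F z = 0) ↔
      ∃ κ : ℝ, ∀ z ∈ I, weylScalar σ F z = κ * Real.exp ((1 / 2 - σ * (3 / 2)) * z) := by
  obtain ⟨-, h2, -⟩ := logd_of_exp hC h
  have h1 := exists_const_iff hF.isOpen hIc
    (u := fun z => weylScalar σ F z * Real.exp ((σ * (3 / 2) - 1 / 2) * z))
    (u' := fun z => (deriv (weylScalar σ F) z + σ * (3 / 2) * weylScalar σ F z
        + logd C z / 2 * weylScalar σ F z) * Real.exp ((σ * (3 / 2) - 1 / 2) * z)) fun z hz =>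
      ((hF.hasDerivAt_weylScalar σ hz).mul (hasDerivAt_exp_mul _ z)).congr_deriv
        (by rw [h2 z hz]; ring)
  have h3 : ∀ κ z, weylScalar σ F z * Real.exp ((σ * (3 / 2) - 1 / 2) * z) = κ ↔
      weylScalar σ F z = κ * Real.exp ((1 / 2 - σ * (3 / 2)) * z) := by
    intro κ z
    rw [show (1 / 2 - σ * (3 / 2)) * z = -((σ * (3 / 2) - 1 / 2) * z) by ring, Real.exp_neg,
      ← div_eq_mul_inv, eq_div_iff (Real.exp_pos _).ne']
  simp only [h3] at h1
  rw [h1]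
  refine forall₂_congr fun z _ => ?_
  rw [mul_eq_zero_iff_right (Real.exp_pos _).ne']

end

end U2Inv

end
-- Assembly of the three parts
theorem mainTheorem11 (I : Set ℝ) (hIo : IsOpen I) (hIc : I.OrdConnected)
    (F C : ℝ → ℝ) (hF : ContDiffOn ℝ ∞ F I) (hC : ContDiffOn ℝ ∞ C I)
    (hFpos : ∀ z ∈ I, 0 < F z) (hCpos : ∀ z ∈ I, 0 < C z) :
    -- prescribed constant scalar curvature
    (∀ s₀ : ℝ, (∀ x ∈ dom I, scal (metric F C) x = s₀) ↔
      ∀ z ∈ I, 0 = s₀ * C z ^ (3 / 2 : ℝ)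
        + 4 * C z ^ (1 / 2 : ℝ) * (deriv (deriv F) z + 1 / 2 * F z - 2)
        + 24 * deriv (fun t => F t * deriv (fun u => C u ^ (1 / 2 : ℝ)) t) z) ∧
    -- half-harmonic metrics
    ((∀ x ∈ dom I, ∀ j k l,
        divergence (metric F C) (weylPlus (metric F C)) j k l x = 0) ↔
      ∃ κ : ℝ, ∀ z ∈ I, Real.exp (3 / 2 * z) * (Lplus F z - 1) * √(C z) = κ) ∧
    ((∀ x ∈ dom I, ∀ j k l,
        divergence (metric F C) (weylMinus (metric F C)) j k l x = 0) ↔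
      ∃ κ : ℝ, ∀ z ∈ I, Real.exp (-(3 / 2) * z) * (Lminus F z - 1) * √(C z) = κ) ∧
    -- the meaning of the Kähler condition
    (IsKahler (dom I) (metric F C) (Jplus F) ↔
      ∃ C₀ : ℝ, 0 < C₀ ∧ ∀ z ∈ I, C z = C₀ * Real.exp (-z)) ∧
    -- half-harmonic metrics in the Kähler case
    (∀ C₀ : ℝ, (∀ z ∈ I, C z = C₀ * Real.exp (-z)) →
      ((∀ x ∈ dom I, ∀ j k l,
          divergence (metric F C) (weylPlus (metric F C)) j k l x = 0) ↔
        ∃ C₂ C₃ C₄ : ℝ, ∀ z ∈ I, F z = 1 + C₂ * Real.exp (-z) + C₃ * Real.exp z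
          + 1 / 2 * C₄ * Real.exp (2 * z)) ∧
      (∀ C₂ C₃ C₄ : ℝ, (∀ z ∈ I, F z = 1 + C₂ * Real.exp (-z) + C₃ * Real.exp z
          + 1 / 2 * C₄ * Real.exp (2 * z)) →
        ∀ x ∈ dom I, scal (metric F C) x = -24 * C₂ / C₀) ∧
      ((∀ x ∈ dom I, ∀ j k l,
          divergence (metric F C) (weylMinus (metric F C)) j k l x = 0) ↔
        ∃ C₁ C₂ C₄ : ℝ, ∀ z ∈ I, F z = 1 + 1 / 2 * C₁ * Real.exp (-2 * z)
          + C₂ * Real.exp (-z) + 1 / 2 * C₄ * Real.exp (2 * z)) ∧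
      (∀ C₁ C₂ C₄ : ℝ, (∀ z ∈ I, F z = 1 + 1 / 2 * C₁ * Real.exp (-2 * z)
          + C₂ * Real.exp (-z) + 1 / 2 * C₄ * Real.exp (2 * z)) →
        IsExtremal (dom I) (metric F C) (Jplus F) ∧
        ∀ x ∈ dom I, scal (metric F C) x = -24 / C₀ * (C₁ * Real.exp (-zc x) + C₂))) := by
  have sF : SmoothPos I F := ⟨hIo, hF, hFpos⟩
  have sC : SmoothPos I C := ⟨hIo, hC, hCpos⟩
  have hp := divergence_iff sF sC (Or.inl rfl) fun x hx => weylPlus_metric sF sC hx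
  have hm := divergence_iff sF sC (Or.inr rfl) fun x hx => weylMinus_metric sF sC hx
  have hK := (isKahler_iff sF sC).trans (deriv_eq_neg_iff hIc sC)
  refine ⟨fun s₀ => ?_, ?_, ?_, hK, fun C₀ hC₀ => ⟨?_, fun C₂ C₃ C₄ h x hx => ?_, ?_,
    fun C₁ C₂ C₄ h => ?_⟩⟩
  · rw [← forall_dom_iff]
    refine forall₂_congr fun x hx => ?_
    rw [scal_metric sF sC hx]
    exact scalFun_eq_iff sF sC s₀ hx.2
  · rw [hp, half_harmonic_iff hIc sF sC]
    refine exists_congr fun κ => forall₂_congr fun z hz => ?_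
    rw [Lplus_eq sF hz, one_mul]
  · rw [hm, half_harmonic_iff hIc sF sC]
    refine exists_congr fun κ => forall₂_congr fun z hz => ?_
    rw [Lminus_eq sF hz, neg_one_mul]
  · rw [hp, half_harmonic_kahler sC sF hIc hC₀, ← weylScalar_plus_iff hIc sF]
    refine exists_congr fun κ => forall₂_congr fun z hz => ?_
    rw [show (1 / 2 - 1 * (3 / 2)) * z = -z by ring]
  · have hw := (derivs_of_exp_sum sF (a := 0) (b := C₂) (c := C₃) (d := 1 / 2 * C₄)
      (fun z hz => by rw [h z hz]; simp) hx.2).1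
    have hpos := hCpos _ hx.2
    rw [scal_metric sF sC hx, scalFun_kahler sC hC₀ hx.2, hw]
    rw [hC₀ _ hx.2] at hpos ⊢
    -- No sign of C₀ is assumed here; it is nonzero because C is positive at the point considered.
    have hne : C₀ ≠ 0 := fun h0 => by simp [h0] at hpos
    rw [neg_one_mul]
    field_simp
    ring
  · rw [hm, half_harmonic_kahler sC sF hIc hC₀, ← weylScalar_minus_iff hIc sF]
    refine exists_congr fun κ => forall₂_congr fun z hz => ?_
    rw [show (1 / 2 - -1 * (3 / 2)) * z = 2 * z by ring]
  · have hs : ∀ x ∈ dom I, scal (metric F C) x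
        = -24 / C₀ * (C₁ * Real.exp (-zc x) + C₂) := by
      intro x hx
      have hw := (derivs_of_exp_sum sF (a := 1 / 2 * C₁) (b := C₂) (c := 0) (d := 1 / 2 * C₄)
        (fun z hz => by rw [h z hz]; simp) hx.2).1
      have hpos := hCpos _ hx.2
      rw [scal_metric sF sC hx, scalFun_kahler sC hC₀ hx.2, hw]
      rw [hC₀ _ hx.2] at hpos ⊢
      have hne : C₀ ≠ 0 := fun h0 => by simp [h0] at hpos
      rw [show -2 * zc x = -zc x + -zc x by ring, Real.exp_add, neg_one_mul]
      field_simp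
      ring
    refine ⟨⟨(isKahler_iff sF sC).2 (logd_of_exp sC hC₀).1, fun x hx k i => ?_⟩, hs⟩
    have hd : ∀ z ∈ I, HasDerivAt (fun z => -24 / C₀ * (C₁ * Real.exp (-1 * z) + C₂))
        (24 / C₀ * C₁ * Real.exp (-1 * z)) z := fun z _ =>
      ((((hasDerivAt_exp_mul (-1) z).const_mul C₁).add_const C₂).const_mul
        (-24 / C₀)).congr_deriv (by ring)
    -- The gradient is (4F/C) s_z ∂_z with s_z = (24C₁/C₀)e^{-z} and C = C₀e^{-z}. The exponentials
    -- cancel, leaving the constant 96C₁/C₀² times F ∂_z.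
    refine lieDerivEnd_Jplus sF hx (ξ := fun z => 96 * C₁ / C₀ ^ 2 * F z)
      (ξ' := 96 * C₁ / C₀ ^ 2 * deriv F (zc x)) (fun y hy k => ?_)
      ((hF.hasDerivAt_of_isOpen hIo hx.2).const_mul _) (by ring) k i
    rw [grad_metric sF sC (fun x hx => by rw [hs x hx, neg_one_mul]) hd hy]
    have hpos := hCpos _ hy.2
    rw [hC₀ _ hy.2] at hpos ⊢
    have hne : C₀ ≠ 0 := fun h0 => by simp [h0] at hpos
    rw [neg_one_mul]
    field_simp
    ring
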